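/- For $L>0$ let $\mathcal B=\mathcal B(L)$ be the operator $\mathcal B\varphi=-\varphi'''-\varphi'$ on $L^2(0,L)$ (complex valued) with domain $\{\varphi\in H^3(0,L):\varphi(0)=\varphi(L)=0,\ \varphi'(0)=\varphi'(L)\}$. An eigenvalue $i\mu$ ($\mu\in\mathbb R$) is called elliptic if $|\mu|<\frac{2\sqrt3}{9}$. Let $\mathcal N=\{2\pi\sqrt{(k^2+kl+l^2)/3}:k,l\in\mathbb N^*\}$. Let $k,l\in\mathbb N^*$, $q=k^2+kl+l^2$, $L_0=2\pi\sqrt{q/3}$, $\lambda_c=\dfrac{(2k+l)(k-l)(2l+k)}{3\sqrt3\,q^{3/2}}$, and, with $e_a(x)=\exp\!\big(\tfrac{i\sqrt3\,a}{3\sqrt q}x\big)$, $$\mathcal G=\pi\sqrt{\tfrac{2}{3L_0^3}}\Big(-l\,e_{2k+l}-k\,e_{-(k+2l)}+(k+l)\,e_{l-k}\Big),\qquad \widetilde{\mathcal G}=\tfrac1{\sqrt{2L_0}}\big(e_{2k+l}-e_{-(k+2l)}\big)$$ (Type 1 and Type 2), and $\widetilde G=-\frac{k-l}{\sqrt3(k+l)}\mathcal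 G+\frac{L_0}{\pi(k+l)}\widetilde{\mathcal G}$. For $s=\pm1$ put $$\mathcal P^{s}=\frac{\sqrt3L_0\,\mathcal G-(2\pi(k-l)+s\sqrt3L_0)\,\widetilde{\mathcal G}}{\sqrt{6L_0^2+2s\sqrt3\pi L_0(k-l)}},\qquad \epsilon^{s}=-i\,\frac{\sqrt2\,\pi(k+l)}{L_0^{3/2}}\cdot\frac{2\pi(k-l)+s\sqrt3L_0}{\sqrt{6L_0^2+2s\sqrt3\pi L_0(k-l)}} .$$ Then there are $\delta\in(0,L_0/2)$ and $r,c,C>0$ such that, with $I=[L_0-\delta,L_0+\delta]$, one has $I\cap\mathcal N=\{L_0\}$ and the following hold. (0) For every $L\in I$ and every elliptic eigenvalue $i\mu$ of $\mathcal B(L)$ there is an eigenvalue $i\mu_0$ of $\mathcal B(L_0)$ with $|\mu-\mu_0|\le C|L-L_0|$. (1) Suppose $k\equiv l \bmod 3$. Then $\mathcal G$, $\widetilde{\mathcal G}$ and $\widetilde G$ are normalized eigenfunctions of $\mathcal B(L_0)$ for $i\lambda_c$, $\mathcal G\perp\widetilde G$ in $L^2(0,L_0)$, and with $\theta=\arccos\frac{\pi(k-l)}{\sqrt3L_0}$,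 $$\mathcal P^{+}=-\cos\tfrac{3\theta}2\,\mathcal G-\sin\tfrac{3\theta}2\,\widetilde G,\qquad \mathcal P^{-}=\sin\tfrac{3\theta}2\,\mathcal G-\cos\tfrac{3\theta}2\,\widetilde G .$$ For every $L\in I\setminus\{L_0\}$ the eigenvalues $z$ of $\mathcal B(L)$ with $|z-i\lambda_c|<r$ are exactly two, $i\lambda^{-}$ and $i\lambda^{+}$ with $\lambda^-<\lambda^+$; both are elliptic, and $$\Big|\lambda^{\pm}-\Big(\lambda_c-\frac{(k-l)(k+2l)(2k+l)}{2\pi q^2}(L-L_0)\pm\frac{|L-L_0|}{\pi\sqrt q}\Big)\Big|\le C(L-L_0)^2 .$$ Every normalized eigenfunction $\mathcal E^\pm$ for $i\lambda^\pm$ satisfies, for some $w\in\mathbb C$ with $|w|=1$ and with $s=\mp\operatorname{sgn}(L-L_0)$, $$\sup_{[0,L]}|\mathcal E^\pm-w\,\mathcal P^{s}|\le C|L-L_0|,\qquad |(\mathcal E^\pm)'(0)-w\,\epsilon^{s}|\le C|L-L_0|,\qquad |(\mathcal E^\pm)'(L)-w\,\epsilon^{s}|\le C|L-L_0|,$$ and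 $c\le|(\mathcal E^\pm)'(0)|,\,|(\mathcal E^\pm)'(L)|\le C$. (2) Suppose $k\not\equiv l \bmod 3$. Then $\mathcal G$ is a normalized eigenfunction of $\mathcal B(L_0)$ for $i\lambda_c$. For every $L\in I$ there is exactly one eigenvalue $i\mu$ of $\mathcal B(L)$ in the disc $|z-i\lambda_c|<r$; it is elliptic and $|\mu-\lambda_c|\le C(L-L_0)^2$. Every normalized eigenfunction $\mathcal E$ for it satisfies $\sup_{[0,L]}|\mathcal E-w\,\mathcal G|\le C|L-L_0|$ for some $|w|=1$, and $c|L-L_0|\le|\mathcal E'(0)|,\,|\mathcal E'(L)|\le C|L-L_0|$. -/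

import Mathlib

open Set MeasureTheory

noncomputable section

namespace KdV

/-- The domain `{u ∈ H³(0,L) : u(0) = u(L) = 0, u'(0) = u'(L)}` of `ℬ`, where an `H³` class is
represented by its continuous representative on `[0,L]`: `u` is `C²` up to the boundary and `u''`
is absolutely continuous, i.e. the primitive of its almost everywhere derivative `u'''`, which
lies in `L²(0,L)`. Values of `u` outside `[0,L]` play no role. -/
structure MemDomB (L : ℝ) (u : ℝ → ℂ) : Prop where
  contDiffOn : ContDiffOn ℝ 2 u (Icc 0 L)
  memLp : MemLp (iteratedDerivWithin 3 u (Icc 0 L)) 2 (volume.restrict (Ioo 0 L))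
  primitive : ∀ x ∈ Icc 0 L, iteratedDerivWithin 2 u (Icc 0 L) x =
    iteratedDerivWithin 2 u (Icc 0 L) 0 + ∫ t in (0 : ℝ)..x, iteratedDerivWithin 3 u (Icc 0 L) t
  left : u 0 = 0
  right : u L = 0
  deriv_eq : derivWithin u (Icc 0 L) 0 = derivWithin u (Icc 0 L) L

/-- `ℬ u = -u''' - u'` on `(0,L)`. -/
def opB (L : ℝ) (u : ℝ → ℂ) (x : ℝ) : ℂ :=
  -iteratedDerivWithin 3 u (Icc 0 L) x - derivWithin u (Icc 0 L) x

/-- `u` is an eigenfunction of `ℬ` on `(0,L)` for the eigenvalue `z`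
(equality in `L²(0,L)`, i.e. almost everywhere). -/
structure IsEigenfunction (L : ℝ) (z : ℂ) (u : ℝ → ℂ) : Prop where
  mem : MemDomB L u
  eq : ∀ᵐ x ∂(volume.restrict (Ioo 0 L)), opB L u x = z * u x
  ne_zero : ∃ x ∈ Icc 0 L, u x ≠ 0

def IsEigenvalue (L : ℝ) (z : ℂ) : Prop := ∃ u, IsEigenfunction L z u

/-- Eigenfunctions of unit norm in `L²(0,L)`. -/
structure IsNormalizedEigenfunction (L : ℝ) (z : ℂ) (u : ℝ → ℂ) : Prop
    extends IsEigenfunction L z u where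
  norm_eq : ∫ x in (0 : ℝ)..L, ‖u x‖ ^ 2 = 1

/-- The elliptic regime for an eigenvalue `iμ`: the characteristic equation `ξ³ - ξ - μ = 0` has
three distinct real roots. -/
def IsElliptic (μ : ℝ) : Prop := |μ| < 2 * √3 / 9

/-- `k² + kl + l²`. -/
def q (k l : ℕ) : ℝ := (k : ℝ) ^ 2 + k * l + (l : ℝ) ^ 2

/-- `2π √((k² + kl + l²)/3)`. -/
def critLength (k l : ℕ) : ℝ := 2 * Real.pi * √(q k l / 3)

/-- The set `𝒩` of critical lengths. -/
def criticalLengths : Set ℝ := {L | ∃ k l : ℕ, 0 < k ∧ 0 < l ∧ L = critLength k l}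

/-- The critical eigenvalue is `i λ_c(k,l)`. -/
def lamC (k l : ℕ) : ℝ :=
  ((2 * k + l) * (k - l) * (2 * l + k)) / (3 * √3 * (q k l) ^ (3 / 2 : ℝ))

/-- `exp(i x √3 a / (3 √(k² + kl + l²)))`. -/
def wave (k l : ℕ) (a x : ℝ) : ℂ :=
  Complex.exp (Complex.I * ((x * (√3 * a / (3 * √(q k l))) : ℝ) : ℂ))

/-- The Type 1 eigenfunction at the critical length. -/
def typeOne (k l : ℕ) (x : ℝ) : ℂ :=
  ((Real.pi * √(2 / (3 * critLength k l ^ 3)) : ℝ) : ℂ) *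
    (-(l : ℂ) * wave k l (2 * k + l) x - (k : ℂ) * wave k l (-(k + 2 * l)) x
      + ((k : ℂ) + l) * wave k l (-k + l) x)

/-- The Type 2 eigenfunction at the critical length (when `k ≡ l` mod `3`). -/
def typeTwo (k l : ℕ) (x : ℝ) : ℂ :=
  ((1 / √(2 * critLength k l) : ℝ) : ℂ) *
    (wave k l (2 * k + l) x - wave k l (-(k + 2 * l)) x)

/-- The Type 2 eigenfunction obtained from the pair by Gram-Schmidt. -/
def typeTwoOrth (k l : ℕ) (x : ℝ) : ℂ :=
  ((-((k - l) / (√3 * (k + l))) : ℝ) : ℂ) * typeOne k l x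
    + ((critLength k l / (Real.pi * (k + l)) : ℝ) : ℂ) * typeTwo k l x

/-- The angle between the Type 1 and Type 2 eigenfunctions. -/
def angle (k l : ℕ) : ℝ := Real.arccos (Real.pi * (k - l) / (√3 * critLength k l))

/-- `√(6 L₀² + s 2√3 π L₀ (k - l))`, for `s = ±1`. -/
def profileNorm (k l : ℕ) (s : ℝ) : ℝ :=
  √(6 * critLength k l ^ 2 + s * (2 * √3 * Real.pi * critLength k l * (k - l)))

/-- The limiting eigenfunction
`(√3 L₀ 𝒢 - (2π(k-l) + s √3 L₀) 𝒢~) / √(6 L₀² + s 2√3 π L₀ (k-l))`, for `s = ±1`. -/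
def profile (k l : ℕ) (s : ℝ) (x : ℝ) : ℂ :=
  (((√3 * critLength k l : ℝ) : ℂ) * typeOne k l x
    - ((2 * Real.pi * (k - l) + s * (√3 * critLength k l) : ℝ) : ℂ) * typeTwo k l x)
    / ((profileNorm k l s : ℝ) : ℂ)

/-- The boundary derivative of the limiting eigenfunction. -/
def boundarySlope (k l : ℕ) (s : ℝ) : ℂ :=
  -Complex.I * ((√2 * Real.pi * (k + l) / critLength k l ^ (3 / 2 : ℝ)
    * ((2 * Real.pi * (k - l) + s * (√3 * critLength k l)) / profileNorm k l s) : ℝ) : ℂ)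

end KdV

end

/-!
Let `g = g(·; z)` be the solution of `y''' + y' + z y = 0` with `g(0) = g'(0) = 0`, `g''(0) = 1`.
Every eigenfunction of `ℬ(L)` for `z` is a combination `a g' + b g`, with `a` its slope and `b` its
curvature at `0` (`IsEigenfunction.exists_data`), and the conditions at `L` are a `2 × 2` linear
system for `(a, b)`. Since `ℬ` is skew-symmetric its eigenvalues are imaginary, and for `z = iμ` the
determinant of that system is `2 Re g(L; iμ)` (`det_eq_two_re`), because the Wronskian of `g'` and
`g` is the fundamental solution for `-z`. So `iμ` is an eigenvalue iff `Re g(L; iμ) = 0`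
(`isEigenvalue_iff_re`).

At the critical parameter `g` is a combination of the three waves of the Type 1 eigenfunction. They
take a common value `ω` at `L₀`, a cube root of unity with `ω = 1` iff `k ≡ l` mod `3`, and they are
orthogonal on `(0, L₀)`. With `t = L - L₀` and `m = μ - λ_c` this gives, to first order,
`g(L) = -i√3 ω W m`, `g'(L) = ω (t - W c m)` and `g''(L) = ω (1 + i W m / √3)`, where
`c = 3√3 λ_c / 2 ∈ (-1, 1)` and `W = π √q / (1 - c²)` (`exists_crit_expansion`).

* If `ω ≠ 1`, then `Re g(L)` has a nonzero slope in `m`, so its zeros satisfy `m = O(t²)`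
  (`exists_zeros_simple`). The kernel of the linear system is spanned by `(g'(L), 1 - g''(L))`,
  which is close to `(ω t, 1 - ω)`: a Type 1 profile with boundary slope of exact order `t`
  (`exists_nearData_simple`).
* If `ω = 1`, the first order of `Re g(L)` vanishes and the determinant supplies the second:
  `2 Re g(L) = (t - W (c + 1) m) (t - W (c - 1) m) + O((|t| + |m|)³)`
  (`exists_quadratic_expansion`). The zeros lie on the two branches
  `m = (τ - c) t / (π √q) + O(t²)`, `τ = ±1` (`exists_zeros_on_branch`, `exists_zero_branch`), and
  on each of them the kernel `(-g(L), g'(L))`, divided by `t`, converges to the data of the profile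
  `𝒫^{-τ}` (`exists_nearData_double`).

That each branch carries one eigenvalue only needs no derivative of `g` in `μ`: eigenfunctions for
different eigenvalues are orthogonal, but two eigenfunctions close to the same profile have overlap
close to `1` (`exists_unique_near`). Normalized eigenfunctions inherit the rates of their data up to
a phase (`exists_close_of_near`). Finally, for all elliptic eigenvalues at once the Lipschitz bound
follows by compactness: along a sequence of eigenfunctions converging to an eigenfunction at `L₀`,
Green's formula turns the shift of the eigenvalue into a boundary term of size `|L - L₀|`
(`exists_eigenvalue_near`).
-/

namespace KdV

/-! ### The fundamental solution -/

/-- The companion operator of `y''' + y' + z y = 0`, acting on `(y, y', y'')`. -/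
noncomputable def companion (z : ℂ) : (Fin 3 → ℂ) →L[ℂ] (Fin 3 → ℂ) :=
  LinearMap.toContinuousLinearMap (Matrix.toLin' !![0, 1, 0; 0, 0, 1; 0, -1, 0]) +
    z • LinearMap.toContinuousLinearMap (Matrix.toLin' !![0, 0, 0; 0, 0, 0; -1, 0, 0])

lemma companion_apply (z : ℂ) (v : Fin 3 → ℂ) :
    companion z v = ![v 1, v 2, -v 1 - z * v 0] := by
  ext i
  fin_cases i <;> simp [companion, dotProduct, Fin.sum_univ_three]
  ring

lemma companion_pow_three (z : ℂ) (v : Fin 3 → ℂ) :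
    (companion z ^ 3) v = -companion z v - z • v := by
  simp only [pow_succ, pow_zero, one_mul, mul_apply_eq_comp, companion_apply]
  ext i
  fin_cases i <;> simp

/-- `fund n z` is the `n`-th derivative of the solution `g` of `y''' + y' + z y = 0` with
`(g, g', g'')(0) = (0, 0, 1)`. -/
noncomputable def fund (n : ℕ) (z : ℂ) (x : ℝ) : ℂ :=
  ((companion z ^ n) (NormedSpace.exp ((x : ℂ) • companion z) ![0, 0, 1])) 0

lemma hasDerivAt_fund (n : ℕ) (z : ℂ) (x : ℝ) :
    HasDerivAt (fund n z) (fund (n + 1) z x) x := by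
  let ev : ((Fin 3 → ℂ) →L[ℂ] (Fin 3 → ℂ)) →L[ℂ] ℂ :=
    (ContinuousLinearMap.proj 0).comp ((companion z ^ n).comp
      (ContinuousLinearMap.apply ℂ (Fin 3 → ℂ) ![0, 0, 1]))
  have h := (ev.hasFDerivAt.comp_hasDerivAt (x : ℂ)
    (hasDerivAt_exp_smul_const' (𝕂 := ℂ) (companion z) (x : ℂ))).comp_ofReal
  refine HasDerivAt.congr_deriv h ?_
  rw [fund, pow_succ]
  rfl

lemma continuous_fund_uncurry (n : ℕ) : Continuous fun p : ℂ × ℝ => fund n p.1 p.2 := by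
  let _ : NormedAlgebra ℚ ((Fin 3 → ℂ) →L[ℂ] (Fin 3 → ℂ)) := NormedAlgebra.restrictScalars ℚ ℂ _
  have hc : Continuous companion := by unfold companion; fun_prop
  have h1 : Continuous fun p : ℂ × ℝ => companion p.1 ^ n := (hc.comp continuous_fst).pow n
  have h2 : Continuous fun p : ℂ × ℝ => NormedSpace.exp ((p.2 : ℂ) • companion p.1) :=
    NormedSpace.exp_continuous.comp ((Complex.continuous_ofReal.comp continuous_snd).smul (hc.comp continuous_fst))
  exact (continuous_apply 0).comp (h1.clm_apply (h2.clm_apply continuous_const))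

lemma continuous_fund (n : ℕ) (z : ℂ) : Continuous (fund n z) :=
  (continuous_fund_uncurry n).comp (continuous_const.prodMk continuous_id)

lemma fund_add_three (n : ℕ) (z : ℂ) (x : ℝ) :
    fund (n + 3) z x = -fund (n + 1) z x - z * fund n z x := by
  simp only [fund, pow_add, mul_apply_eq_comp, companion_pow_three, map_sub, map_neg, map_smul,
    pow_one, Pi.sub_apply, Pi.neg_apply, Pi.smul_apply, smul_eq_mul]

lemma fund_three (z : ℂ) (x : ℝ) : fund 3 z x = -fund 1 z x - z * fund 0 z x :=
  fund_add_three 0 z x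

lemma exp_zero_smul_companion (z : ℂ) :
    NormedSpace.exp (((0 : ℝ) : ℂ) • companion z) = 1 :=
  (congrArg _ (zero_smul ℂ (companion z))).trans NormedSpace.exp_zero

lemma fund_apply_zero (n : ℕ) (z : ℂ) : fund n z 0 = ((companion z ^ n) ![0, 0, 1]) 0 := by
  rw [fund, exp_zero_smul_companion]
  rfl

@[simp] lemma fund_zero_zero (z : ℂ) : fund 0 z 0 = 0 := by
  simp [fund_apply_zero]

@[simp] lemma fund_one_zero (z : ℂ) : fund 1 z 0 = 0 := by
  simp [fund_apply_zero, companion_apply]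

@[simp] lemma fund_two_zero (z : ℂ) : fund 2 z 0 = 1 := by
  simp [fund_apply_zero, pow_succ, companion_apply]

@[simp] lemma fund_three_zero (z : ℂ) : fund 3 z 0 = 0 := by
  simp [fund_three]

@[simp] lemma fund_four_zero (z : ℂ) : fund 4 z 0 = -1 := by
  simp [fund_add_three 1]

/-- `y`, `y₁ = y'`, `y₂ = y''` solve `y''' + y' + z y = 0` on `s`. -/
structure Solves (z : ℂ) (y y₁ y₂ : ℝ → ℂ) (s : Set ℝ) : Prop where
  d0 : ∀ x ∈ s, HasDerivWithinAt y (y₁ x) s x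
  d1 : ∀ x ∈ s, HasDerivWithinAt y₁ (y₂ x) s x
  d2 : ∀ x ∈ s, HasDerivWithinAt y₂ (-y₁ x - z * y x) s x

lemma Solves.mono {z : ℂ} {y y₁ y₂ : ℝ → ℂ} {s t : Set ℝ} (h : Solves z y y₁ y₂ s)
    (hts : t ⊆ s) : Solves z y y₁ y₂ t :=
  ⟨fun x hx => (h.d0 x (hts hx)).mono hts, fun x hx => (h.d1 x (hts hx)).mono hts,
    fun x hx => (h.d2 x (hts hx)).mono hts⟩

lemma solves_fund (n : ℕ) (z : ℂ) (s : Set ℝ) :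
    Solves z (fund n z) (fund (n + 1) z) (fund (n + 2) z) s :=
  ⟨fun x _ => (hasDerivAt_fund n z x).hasDerivWithinAt,
    fun x _ => (hasDerivAt_fund (n + 1) z x).hasDerivWithinAt,
    fun x _ => by
      rw [← fund_add_three]; exact (hasDerivAt_fund (n + 2) z x).hasDerivWithinAt⟩

/-- The fundamental theorem of calculus on `[0, s]` with one-sided derivatives at the ends. -/
lemma integral_eq_sub_of_within {f f' : ℝ → ℂ} {s : ℝ} (hs : 0 ≤ s)
    (h : ∀ x ∈ Icc 0 s, HasDerivWithinAt f (f' x) (Icc 0 s) x)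
    (hf' : ContinuousOn f' (Icc 0 s)) : ∫ x in (0 : ℝ)..s, f' x = f s - f 0 := by
  apply intervalIntegral.integral_eq_sub_of_hasDeriv_right_of_le hs
  · exact fun x hx => (h x hx).continuousWithinAt
  · intro x hx
    exact ((h x (Ioo_subset_Icc_self hx)).hasDerivAt (Icc_mem_nhds hx.1 hx.2)).hasDerivWithinAt
  · rw [← uIcc_of_le hs] at hf'
    exact hf'.intervalIntegrable

/-- Lagrange's identity: a solution `y` for `z` is compared with the translates of a solution for
`z₀` read backwards. -/
lemma lagrange_identity {z : ℂ} {y y₁ y₂ : ℝ → ℂ} {s : ℝ} (hs : 0 ≤ s)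
    (hy : Solves z y y₁ y₂ (Icc 0 s)) (z₀ : ℂ) (n : ℕ) :
    y₂ s * fund n z₀ 0 + y₁ s * fund (n + 1) z₀ 0 + y s * (fund (n + 2) z₀ 0 + fund n z₀ 0) =
      y₂ 0 * fund n z₀ s + y₁ 0 * fund (n + 1) z₀ s + y 0 * (fund (n + 2) z₀ s + fund n z₀ s)
      - (z - z₀) * ∫ t in (0 : ℝ)..s, y t * fund n z₀ (s - t) := by
  have hu : ∀ m, ∀ t ∈ Icc (0 : ℝ) s,
      HasDerivWithinAt (fun t => fund m z₀ (s - t)) (-fund (m + 1) z₀ (s - t)) (Icc 0 s) t := by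
    intro m t _
    have := (hasDerivAt_fund m z₀ (s - t)).scomp t ((hasDerivAt_id t).const_sub s)
    simpa [Function.comp_def] using this.hasDerivWithinAt
  have hder : ∀ t ∈ Icc (0 : ℝ) s, HasDerivWithinAt
      (fun t => y₂ t * fund n z₀ (s - t) + y₁ t * fund (n + 1) z₀ (s - t)
        + y t * (fund (n + 2) z₀ (s - t) + fund n z₀ (s - t)))
      (-(z - z₀) * (y t * fund n z₀ (s - t))) (Icc 0 s) t := by
    intro t ht
    have := (((hy.d2 t ht).mul (hu n t ht)).add ((hy.d1 t ht).mul (hu (n + 1) t ht))).add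
      ((hy.d0 t ht).mul ((hu (n + 2) t ht).add (hu n t ht)))
    refine this.congr_deriv ?_
    rw [show n + 2 + 1 = n + 3 from rfl, fund_add_three]
    simp only [Pi.add_apply]
    ring
  have hc : ContinuousOn (fun t => -(z - z₀) * (y t * fund n z₀ (s - t))) (Icc 0 s) := by
    have h0 : ContinuousOn y (Icc 0 s) := fun x hx => (hy.d0 x hx).continuousWithinAt
    have h1 : Continuous fun t => fund n z₀ (s - t) :=
      (continuous_fund n z₀).comp (continuous_const.sub continuous_id)
    exact continuousOn_const.mul (h0.mul h1.continuousOn)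
  have := integral_eq_sub_of_within hs hder hc
  rw [intervalIntegral.integral_const_mul] at this
  simp only [sub_self, sub_zero] at this
  linear_combination -this

/-- Variation of the parameter: the solutions for two parameters differ by a convolution. -/
lemma fund_sub_fund {n : ℕ} (hn : n < 3) (z z₀ : ℂ) {s : ℝ} (hs : 0 ≤ s) :
    fund n z s - fund n z₀ s =
      -((z - z₀) * ∫ t in (0 : ℝ)..s, fund 0 z t * fund n z₀ (s - t)) := by
  have h := lagrange_identity hs (solves_fund 0 z (Icc 0 s)) z₀ n
  interval_cases n <;> simp at h <;> linear_combination h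

/-- A solution is determined by its initial values. -/
lemma Solves.eq_fund {z : ℂ} {y y₁ y₂ : ℝ → ℂ} {L : ℝ} (hy : Solves z y y₁ y₂ (Icc 0 L))
    (h0 : y 0 = 0) {s : ℝ} (hs : s ∈ Icc 0 L) :
    y s = y₁ 0 * fund 1 z s + y₂ 0 * fund 0 z s ∧
    y₁ s = y₁ 0 * fund 2 z s + y₂ 0 * fund 1 z s ∧
    y₂ s = y₁ 0 * fund 3 z s + y₂ 0 * fund 2 z s := by
  have hy' := hy.mono (Icc_subset_Icc_right hs.2)
  have e0 := lagrange_identity hs.1 hy' z 0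
  have e1 := lagrange_identity hs.1 hy' z 1
  have e2 := lagrange_identity hs.1 hy' z 2
  simp [h0] at e0 e1 e2
  refine ⟨by linear_combination e0, by linear_combination e1, by linear_combination e2⟩

/-- The Wronskian of `g'` and `g` is the fundamental solution for the adjoint parameter. -/
lemma fund_neg (z : ℂ) {x : ℝ} (hx : 0 ≤ x) :
    fund 0 (-z) x = fund 1 z x ^ 2 - fund 0 z x * fund 2 z x := by
  have hs : Solves (-z) (fun x => fund 1 z x ^ 2 - fund 0 z x * fund 2 z x)
      (fun x => fund 1 z x * fund 2 z x - fund 0 z x * fund 3 z x)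
      (fun x => fund 2 z x ^ 2 - fund 0 z x * fund 4 z x) (Icc 0 x) := by
    refine ⟨fun t _ => ?_, fun t _ => ?_, fun t _ => ?_⟩
    · refine ((((hasDerivAt_fund 1 z t).pow 2).sub
        ((hasDerivAt_fund 0 z t).mul (hasDerivAt_fund 2 z t))).congr_deriv ?_).hasDerivWithinAt
      simp
      ring
    · refine ((((hasDerivAt_fund 1 z t).mul (hasDerivAt_fund 2 z t)).sub
        ((hasDerivAt_fund 0 z t).mul (hasDerivAt_fund 3 z t))).congr_deriv ?_).hasDerivWithinAt
      simp
      ring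
    · refine ((((hasDerivAt_fund 2 z t).pow 2).sub
        ((hasDerivAt_fund 0 z t).mul (hasDerivAt_fund 4 z t))).congr_deriv ?_).hasDerivWithinAt
      simp [fund_add_three 0, fund_add_three 1, fund_add_three 2]
      ring
  have := (hs.eq_fund (by simp) (right_mem_Icc.2 hx)).1
  simp at this
  exact this.symm

lemma star_fund (z : ℂ) {x : ℝ} (hx : 0 ≤ x) :
    star (fund 0 z x) = fund 0 (star z) x := by
  have hs : Solves (star z) (fun x => star (fund 0 z x)) (fun x => star (fund 1 z x))
      (fun x => star (fund 2 z x)) (Icc 0 x) := by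
    refine ⟨fun t _ => (hasDerivAt_fund 0 z t).star.hasDerivWithinAt,
      fun t _ => (hasDerivAt_fund 1 z t).star.hasDerivWithinAt, fun t _ => ?_⟩
    refine ((hasDerivAt_fund 2 z t).star.congr_deriv ?_).hasDerivWithinAt
    simp [fund_add_three 0]
  have := (hs.eq_fund (by simp) (right_mem_Icc.2 hx)).1
  simpa using this

/-- The characteristic determinant at an imaginary parameter is twice the real part of the
fundamental solution. -/
lemma det_eq_two_re (μ : ℝ) {L : ℝ} (hL : 0 ≤ L) :
    fund 1 (Complex.I * μ) L ^ 2 - fund 0 (Complex.I * μ) L * (fund 2 (Complex.I * μ) L - 1) =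
      ((2 * (fund 0 (Complex.I * μ) L).re : ℝ) : ℂ) := by
  have h1 := fund_neg (Complex.I * μ) hL
  have h2 := star_fund (Complex.I * μ) hL
  have h3 : star (Complex.I * (μ : ℂ)) = -(Complex.I * μ) := by simp
  rw [h3, h1] at h2
  have h4 := Complex.add_conj (fund 0 (Complex.I * μ) L)
  rw [← h4]
  change star _ = _ at h2
  rw [starRingEnd_apply, h2]
  ring

lemma exists_norm_fund_le (n : ℕ) (R : ℝ) :
    ∃ B, 0 < B ∧ ∀ z : ℂ, ‖z‖ ≤ R → ∀ x : ℝ, |x| ≤ R → ‖fund n z x‖ ≤ B := by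
  obtain ⟨B, hB⟩ := ((isCompact_closedBall (0 : ℂ) R).prod
    (isCompact_closedBall (0 : ℝ) R)).exists_bound_of_continuousOn
    (continuous_fund_uncurry n).continuousOn
  refine ⟨max B 1, by positivity, fun z hz x hx => (hB (z, x) ⟨?_, ?_⟩).trans (le_max_left _ _)⟩
  · simpa using hz
  · simpa using hx

/-! ### Eigenfunctions as solutions of the differential equation -/

section
variable {L : ℝ} {z : ℂ}

lemma Solves.derivWithin_eq {y y₁ y₂ : ℝ → ℂ} (hL : 0 < L) (hy : Solves z y y₁ y₂ (Icc 0 L)) :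
    (∀ x ∈ Icc 0 L, derivWithin y (Icc 0 L) x = y₁ x) ∧
    (∀ x ∈ Icc 0 L, iteratedDerivWithin 2 y (Icc 0 L) x = y₂ x) ∧
    (∀ x ∈ Icc 0 L, iteratedDerivWithin 3 y (Icc 0 L) x = -y₁ x - z * y x) := by
  have hu := uniqueDiffOn_Icc hL
  have e1 : ∀ x ∈ Icc 0 L, derivWithin y (Icc 0 L) x = y₁ x :=
    fun x hx => (hy.d0 x hx).derivWithin (hu x hx)
  have e2 : ∀ x ∈ Icc 0 L, iteratedDerivWithin 2 y (Icc 0 L) x = y₂ x := by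
    intro x hx
    rw [iteratedDerivWithin_succ, iteratedDerivWithin_one,
      derivWithin_congr (f := y₁) (fun t ht => e1 t ht) (e1 x hx)]
    exact (hy.d1 x hx).derivWithin (hu x hx)
  refine ⟨e1, e2, fun x hx => ?_⟩
  rw [iteratedDerivWithin_succ, derivWithin_congr (f := y₂) (fun t ht => e2 t ht) (e2 x hx)]
  exact (hy.d2 x hx).derivWithin (hu x hx)

lemma Solves.isEigenfunction {y y₁ y₂ : ℝ → ℂ} (hL : 0 < L)
    (hy : Solves z y y₁ y₂ (Icc 0 L)) (h0 : y 0 = 0) (h1 : y L = 0) (h2 : y₁ 0 = y₁ L)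
    (hne : ∃ x ∈ Icc 0 L, y x ≠ 0) : IsEigenfunction L z y := by
  obtain ⟨e1, e2, e3⟩ := hy.derivWithin_eq hL
  have h00 : (0 : ℝ) ∈ Icc 0 L := left_mem_Icc.2 hL.le
  have hLL : L ∈ Icc 0 L := right_mem_Icc.2 hL.le
  have c0 : ContinuousOn y (Icc 0 L) := fun x hx => (hy.d0 x hx).continuousWithinAt
  have c1 : ContinuousOn y₁ (Icc 0 L) := fun x hx => (hy.d1 x hx).continuousWithinAt
  have c2 : ContinuousOn y₂ (Icc 0 L) := fun x hx => (hy.d2 x hx).continuousWithinAt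
  have c3 : ContinuousOn (fun x => -y₁ x - z * y x) (Icc 0 L) :=
    c1.neg.sub (continuousOn_const.mul c0)
  have e1' : ∀ x ∈ Icc 0 L, iteratedDerivWithin 1 y (Icc 0 L) x = y₁ x := by
    intro x hx
    rw [iteratedDerivWithin_one, e1 x hx]
  refine ⟨⟨?_, ?_, ?_, h0, h1, ?_⟩, ?_, hne⟩
  · refine contDiffOn_of_continuousOn_differentiableOn_deriv (fun m hm => ?_) (fun m hm => ?_)
    · have hm' : m ≤ 2 := by exact_mod_cast hm
      interval_cases m
      · simpa using c0
      · exact c1.congr e1'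
      · exact c2.congr e2
    · have hm' : m < 2 := by exact_mod_cast hm
      interval_cases m
      · rw [iteratedDerivWithin_zero]
        exact fun x hx => (hy.d0 x hx).differentiableWithinAt
      · exact DifferentiableOn.congr (f := y₁)
          (fun x hx => (hy.d1 x hx).differentiableWithinAt) e1'
  · obtain ⟨B, hB⟩ := isCompact_Icc.exists_bound_of_continuousOn c3
    have hae : iteratedDerivWithin 3 y (Icc 0 L) =ᵐ[volume.restrict (Ioo 0 L)]
        fun x => -y₁ x - z * y x := by
      filter_upwards [ae_restrict_mem measurableSet_Ioo] with x hx
      exact e3 x (Ioo_subset_Icc_self hx)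
    rw [memLp_congr_ae hae]
    refine MemLp.of_bound ((c3.mono Ioo_subset_Icc_self).aestronglyMeasurable measurableSet_Ioo)
      B ?_
    filter_upwards [ae_restrict_mem measurableSet_Ioo] with x hx
    exact hB x (Ioo_subset_Icc_self hx)
  · intro x hx
    have hsub : Icc 0 x ⊆ Icc 0 L := Icc_subset_Icc_right hx.2
    have := integral_eq_sub_of_within hx.1
      (fun t ht => (hy.d2 t (hsub ht)).mono hsub) (c3.mono hsub)
    rw [e2 x hx, e2 0 h00, intervalIntegral.integral_congr
      (g := fun x => -y₁ x - z * y x) (fun t ht => ?_), this]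
    · ring
    · rw [uIcc_of_le hx.1] at ht
      exact e3 t (hsub ht)
  · rw [e1 0 h00, e1 L hLL, h2]
  · filter_upwards [ae_restrict_mem measurableSet_Ioo] with x hx
    have hx' := Ioo_subset_Icc_self hx
    rw [opB, e1 x hx', e3 x hx']
    ring

lemma IsEigenfunction.solves {u : ℝ → ℂ} (hL : 0 < L) (hu : IsEigenfunction L z u) :
    Solves z u (derivWithin u (Icc 0 L)) (iteratedDerivWithin 2 u (Icc 0 L)) (Icc 0 L) := by
  have hU := uniqueDiffOn_Icc hL
  have hc := hu.mem.contDiffOn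
  have c0 : ContinuousOn u (Icc 0 L) := hc.continuousOn
  have c1 : ContinuousOn (derivWithin u (Icc 0 L)) (Icc 0 L) := by
    have := hc.continuousOn_iteratedDerivWithin (m := 1) (by norm_num) hU
    rwa [iteratedDerivWithin_one] at this
  refine ⟨fun x hx => ?_, fun x hx => ?_, ?_⟩
  · exact ((hc.differentiableOn (by norm_num)) x hx).hasDerivWithinAt
  · have h1 := hc.differentiableOn_iteratedDerivWithin (m := 1) (by norm_num) hU x hx
    have h2 := h1.hasDerivWithinAt
    rwa [← iteratedDerivWithin_succ, iteratedDerivWithin_one] at h2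
  · -- the equation holds almost everywhere, hence `u''` is the primitive of a continuous function
    set V : ℝ → ℂ := IccExtend hL.le
      ((Icc 0 L).domRestrict fun x => -derivWithin u (Icc 0 L) x - z * u x) with hV
    have hVc : Continuous V :=
      (continuousOn_iff_continuous_domRestrict.1 (c1.neg.sub (continuousOn_const.mul c0))).Icc_extend'
    have hVe : ∀ x ∈ Icc 0 L, V x = -derivWithin u (Icc 0 L) x - z * u x := by
      intro x hx
      rw [hV, IccExtend_of_mem _ _ hx]
      rfl
    have hprim : ∀ x ∈ Icc 0 L, iteratedDerivWithin 2 u (Icc 0 L) x =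
        iteratedDerivWithin 2 u (Icc 0 L) 0 + ∫ t in (0 : ℝ)..x, V t := by
      intro x hx
      rw [hu.mem.primitive x hx]
      congr 1
      apply intervalIntegral.integral_congr_ae
      rw [uIoc_of_le hx.1]
      have h1 := (ae_restrict_iff' measurableSet_Ioo).1 hu.eq
      have h2 : ∀ᵐ t ∂(volume : Measure ℝ), t ≠ L := by
        simp [ae_iff, measure_singleton]
      filter_upwards [h1, h2] with t ht htL htx
      have htI : t ∈ Ioo 0 L := ⟨htx.1, lt_of_le_of_ne (htx.2.trans hx.2) htL⟩
      have := ht htI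
      rw [hVe t (Ioo_subset_Icc_self htI)]
      rw [opB] at this
      linear_combination -this
    intro x hx
    have h1 : HasDerivAt (fun x => iteratedDerivWithin 2 u (Icc 0 L) 0 + ∫ t in (0 : ℝ)..x, V t)
        (V x) x := (intervalIntegral.integral_hasDerivAt_right (hVc.intervalIntegrable _ _)
          (hVc.stronglyMeasurableAtFilter _ _) hVc.continuousAt).const_add _
    rw [← hVe x hx]
    exact h1.hasDerivWithinAt.congr (fun t ht => hprim t ht) (hprim x hx)

/-- The `n`-th derivative of the solution of `y''' + y' + z y = 0` with `y(0) = 0`, `y'(0) = a`,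
`y''(0) = b`. -/
noncomputable def sol (a b z : ℂ) (n : ℕ) (x : ℝ) : ℂ := a * fund (n + 1) z x + b * fund n z x

lemma hasDerivAt_sol (a b z : ℂ) (n : ℕ) (x : ℝ) :
    HasDerivAt (sol a b z n) (sol a b z (n + 1) x) x :=
  ((hasDerivAt_fund (n + 1) z x).const_mul a).add ((hasDerivAt_fund n z x).const_mul b)

lemma sol_three (a b z : ℂ) (x : ℝ) : sol a b z 3 x = -sol a b z 1 x - z * sol a b z 0 x := by
  simp only [sol, fund_add_three 1, fund_add_three 0]
  ring

@[simp] lemma sol_zero_zero (a b z : ℂ) : sol a b z 0 0 = 0 := by simp [sol]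

@[simp] lemma sol_one_zero (a b z : ℂ) : sol a b z 1 0 = a := by simp [sol]

lemma continuous_sol (a b z : ℂ) (n : ℕ) : Continuous (sol a b z n) :=
  ((continuous_fund _ z).const_mul a).add ((continuous_fund _ z).const_mul b)

lemma solves_sol (a b z : ℂ) (s : Set ℝ) :
    Solves z (sol a b z 0) (sol a b z 1) (sol a b z 2) s :=
  ⟨fun x _ => (hasDerivAt_sol a b z 0 x).hasDerivWithinAt,
    fun x _ => (hasDerivAt_sol a b z 1 x).hasDerivWithinAt,
    fun x _ => by rw [← sol_three]; exact (hasDerivAt_sol a b z 2 x).hasDerivWithinAt⟩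

/-- `(a, b)` are the initial slope and curvature of an eigenfunction of `ℬ` on `(0, L)` for
the eigenvalue `z`. -/
structure IsEigenData (L : ℝ) (z a b : ℂ) : Prop where
  ne : a ≠ 0 ∨ b ≠ 0
  right : sol a b z 0 L = 0
  slope : sol a b z 1 L = a

lemma IsEigenData.exists_ne {a b : ℂ} (hL : 0 < L) (h : IsEigenData L z a b) :
    ∃ x ∈ Icc 0 L, sol a b z 0 x ≠ 0 := by
  by_contra! hc
  have hU := uniqueDiffOn_Icc hL
  have h00 : (0 : ℝ) ∈ Icc 0 L := left_mem_Icc.2 hL.le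
  have key : ∀ n, ∀ x ∈ Icc 0 L, sol a b z n x = 0 := by
    intro n
    induction n with
    | zero => exact hc
    | succ n ih =>
      intro x hx
      have h1 : HasDerivWithinAt (sol a b z n) 0 (Icc 0 L) x :=
        (hasDerivWithinAt_const x (Icc 0 L) (0 : ℂ)).congr (fun t ht => ih t ht) (ih x hx)
      exact (hU x hx).eq_deriv _ (hasDerivAt_sol a b z n x).hasDerivWithinAt h1
  have ha := key 1 0 h00
  have hb := key 2 0 h00
  simp [sol] at ha hb
  rcases h.ne with h | h <;> simp_all

lemma IsEigenData.isEigenfunction {a b : ℂ} (hL : 0 < L) (h : IsEigenData L z a b) :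
    IsEigenfunction L z (sol a b z 0) :=
  (solves_sol a b z _).isEigenfunction hL (by simp) h.right (by simp [h.slope])
    (h.exists_ne hL)

lemma IsEigenfunction.exists_data {u : ℝ → ℂ} (hL : 0 < L) (hu : IsEigenfunction L z u) :
    ∃ a b, IsEigenData L z a b ∧ (∀ x ∈ Icc 0 L, u x = sol a b z 0 x) ∧
      derivWithin u (Icc 0 L) 0 = a ∧ derivWithin u (Icc 0 L) L = a := by
  have hs := hu.solves hL
  have hLL : L ∈ Icc 0 L := right_mem_Icc.2 hL.le
  have he := fun x (hx : x ∈ Icc 0 L) => hs.eq_fund hu.mem.left hx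
  refine ⟨_, _, ⟨?_, ?_, ?_⟩, fun x hx => (he x hx).1, rfl, hu.mem.deriv_eq.symm⟩
  · by_contra! hc
    obtain ⟨x, hx, hne⟩ := hu.ne_zero
    exact hne (by rw [(he x hx).1, hc.1, hc.2]; simp)
  · exact (he L hLL).1.symm.trans hu.mem.right
  · exact (he L hLL).2.1.symm.trans hu.mem.deriv_eq.symm

lemma isEigenvalue_iff_exists_data (hL : 0 < L) :
    IsEigenvalue L z ↔ ∃ a b, IsEigenData L z a b :=
  ⟨fun ⟨_, hu⟩ => let ⟨a, b, h, _⟩ := hu.exists_data hL; ⟨a, b, h⟩,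
    fun ⟨_, _, h⟩ => ⟨_, h.isEigenfunction hL⟩⟩

/-- Green's formula: the skew-symmetry of `ℬ` up to boundary terms. -/
lemma green_identity (a b a' b' z w : ℂ) (s : ℝ) :
    -(z + star w) * ∫ x in (0 : ℝ)..s, sol a b z 0 x * star (sol a' b' w 0 x) =
      sol a b z 2 s * star (sol a' b' w 0 s) + sol a b z 0 s * star (sol a' b' w 2 s)
      - sol a b z 1 s * star (sol a' b' w 1 s) + sol a b z 0 s * star (sol a' b' w 0 s)
      + a * star a' := by
  have hder : ∀ x, HasDerivAt (fun s => sol a b z 2 s * star (sol a' b' w 0 s)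
      + sol a b z 0 s * star (sol a' b' w 2 s)
      - sol a b z 1 s * star (sol a' b' w 1 s) + sol a b z 0 s * star (sol a' b' w 0 s))
      (-(z + star w) * (sol a b z 0 x * star (sol a' b' w 0 x))) x := by
    intro x
    have hy := hasDerivAt_sol a b z
    have hu := fun n x => (hasDerivAt_sol a' b' w n x).star
    refine (((((hy 2 x).mul (hu 0 x)).add ((hy 0 x).mul (hu 2 x))).sub
      ((hy 1 x).mul (hu 1 x))).add ((hy 0 x).mul (hu 0 x))).congr_deriv ?_
    simp only [Nat.reduceAdd, sol_three, star_sub, star_neg, star_mul']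
    ring
  have h := intervalIntegral.integral_eq_sub_of_hasDerivAt (a := 0) (b := s)
    (fun x _ => hder x) ((continuous_const.mul ((continuous_sol a b z 0).mul
      (continuous_sol a' b' w 0).star)).intervalIntegrable _ _)
  rw [intervalIntegral.integral_const_mul] at h
  rw [h, sol_zero_zero, sol_one_zero]
  simp

lemma IsEigenData.green {a b a' b' z w : ℂ} (h : IsEigenData L z a b)
    (h' : IsEigenData L w a' b') :
    (z + star w) * ∫ x in (0 : ℝ)..L, sol a b z 0 x * star (sol a' b' w 0 x) = 0 := by
  have := green_identity a b a' b' z w L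
  rw [h.right, h'.right, h.slope, h'.slope] at this
  simp only [star_zero, mul_zero, zero_mul, add_zero, zero_sub, neg_add_cancel] at this
  linear_combination -this

lemma IsEigenData.integral_pos {a b : ℂ} (hL : 0 < L) (h : IsEigenData L z a b) :
    0 < ∫ x in (0 : ℝ)..L, ‖sol a b z 0 x‖ ^ 2 := by
  obtain ⟨x, hx, hne⟩ := h.exists_ne hL
  refine intervalIntegral.integral_pos hL ((continuous_sol a b z 0).norm.pow 2).continuousOn
    (fun _ _ => by positivity) ⟨x, hx, by positivity⟩

lemma mul_star_eq (w : ℂ) : w * star w = ((‖w‖ ^ 2 : ℝ) : ℂ) := by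
  rw [Complex.star_def, Complex.mul_conj, Complex.normSq_eq_norm_sq]

/-- The eigenvalues of the skew-symmetric operator `ℬ` are imaginary. -/
lemma IsEigenvalue.re_eq_zero (hL : 0 < L) (h : IsEigenvalue L z) : z.re = 0 := by
  obtain ⟨a, b, hd⟩ := (isEigenvalue_iff_exists_data hL).1 h
  have h1 := hd.green hd
  have h2 := hd.integral_pos hL
  simp only [mul_star_eq] at h1
  rw [intervalIntegral.integral_ofReal] at h1
  rcases mul_eq_zero.1 h1 with h3 | h3
  · have := congrArg Complex.re h3
    simp at this
    linarith
  · exact absurd (Complex.ofReal_eq_zero.1 h3) h2.ne'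

lemma IsEigenvalue.exists_eq (hL : 0 < L) (h : IsEigenvalue L z) :
    ∃ μ : ℝ, z = Complex.I * μ :=
  ⟨z.im, by apply Complex.ext <;> simp [h.re_eq_zero hL]⟩

/-- The characteristic equation on the imaginary axis. -/
lemma isEigenvalue_iff_re (hL : 0 < L) (μ : ℝ) :
    IsEigenvalue L (Complex.I * μ) ↔ (fund 0 (Complex.I * μ) L).re = 0 := by
  have hdet := det_eq_two_re μ hL.le
  set z : ℂ := Complex.I * μ
  rw [isEigenvalue_iff_exists_data hL]
  constructor
  · rintro ⟨a, b, ⟨hne, h1, h2⟩⟩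
    simp only [sol] at h1 h2
    have hd : fund 1 z L ^ 2 - fund 0 z L * (fund 2 z L - 1) = 0 := by
      rcases hne with h | h
      · refine (mul_eq_zero (a := a).1 ?_).resolve_left h
        linear_combination fund 1 z L * h1 - fund 0 z L * h2
      · refine (mul_eq_zero (a := b).1 ?_).resolve_left h
        linear_combination -(fund 2 z L - 1) * h1 + fund 1 z L * h2
    rw [hd] at hdet
    have := Complex.ofReal_eq_zero.1 hdet.symm
    linarith
  · intro h
    rw [h] at hdet
    simp at hdet
    by_cases h0 : fund 0 z L = 0 ∧ fund 1 z L = 0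
    · exact ⟨0, 1, by simp, by simp [sol, h0.1], by simp [sol, h0.2]⟩
    · refine ⟨-fund 0 z L, fund 1 z L, ?_, ?_, ?_⟩
      · by_contra! hc
        exact h0 ⟨neg_eq_zero.1 hc.1, hc.2⟩
      · simp only [sol]
        ring
      · simp only [sol]
        linear_combination hdet

end

/-! ### The critical length -/

section
variable {k l : ℕ}

lemma q_pos (hk : 0 < k) (l : ℕ) : 0 < q k l := by
  have : (0 : ℝ) < k := by exact_mod_cast hk
  unfold q
  positivity

lemma critLength_eq (k l : ℕ) : critLength k l = 2 * Real.pi * √(q k l) / √3 := by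
  rw [critLength, Real.sqrt_div' _ (by norm_num)]
  ring

lemma critLength_pos (hk : 0 < k) (l : ℕ) : 0 < critLength k l := by
  have := q_pos hk l
  rw [critLength]
  positivity

/-- The exponent of `wave`: `wave k l a x = exp (i x (rate k l a))`. -/
noncomputable def rate (k l : ℕ) (a : ℝ) : ℝ := √3 * a / (3 * √(q k l))

lemma rate_mul_critLength (hk : 0 < k) (l : ℕ) (a : ℝ) :
    critLength k l * rate k l a = 2 * Real.pi * a / 3 := by
  have h := Real.sqrt_pos.2 (q_pos hk l)
  have h3 : 0 < √(3 : ℝ) := by positivity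
  rw [critLength_eq, rate]
  field_simp

lemma sq_rate (hk : 0 < k) (l : ℕ) (a : ℝ) : rate k l a ^ 2 = a ^ 2 / (3 * q k l) := by
  have h := q_pos hk l
  rw [rate, div_pow, mul_pow, mul_pow, Real.sq_sqrt h.le, Real.sq_sqrt (by norm_num)]
  field_simp

lemma lamC_eq (hk : 0 < k) (l : ℕ) :
    lamC k l = ((2 * k + l) * (k - l) * (2 * l + k)) / (3 * √3 * (q k l * √(q k l))) := by
  have h := q_pos hk l
  rw [lamC, show (3 / 2 : ℝ) = 1 + 1 / 2 by norm_num, Real.rpow_add h, Real.rpow_one,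
    ← Real.sqrt_eq_rpow]

/-- The exponents solve the characteristic equation `ξ³ - ξ = λ_c`. -/
lemma rate_cube (hk : 0 < k) (l : ℕ) {a : ℝ}
    (ha : a ^ 3 - 3 * q k l * a = (2 * k + l) * (k - l) * (2 * l + k)) :
    rate k l a ^ 3 = rate k l a + lamC k l := by
  have h := q_pos hk l
  have hs := Real.sqrt_pos.2 h
  have h3 : 0 < √(3 : ℝ) := by positivity
  have h33 : √(3 : ℝ) ^ 2 = 3 := Real.sq_sqrt (by norm_num)
  rw [lamC_eq hk, ← ha, pow_succ, sq_rate hk, rate]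
  field_simp
  rw [h33]
  ring

/-- A linear combination of the three waves at the critical parameter. -/
noncomputable def tri (k l : ℕ) (p₁ p₂ p₃ : ℂ) (x : ℝ) : ℂ :=
  p₁ * wave k l (2 * k + l) x + p₂ * wave k l (-(k + 2 * l)) x + p₃ * wave k l (-k + l) x

lemma hasDerivAt_wave (k l : ℕ) (a x : ℝ) :
    HasDerivAt (wave k l a) (Complex.I * rate k l a * wave k l a x) x := by
  have h1 : HasDerivAt (fun x : ℝ => ((x * rate k l a : ℝ) : ℂ)) (rate k l a : ℂ) x := by
    simpa using ((hasDerivAt_id x).mul_const (rate k l a)).ofReal_comp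
  have := (h1.const_mul Complex.I).cexp
  refine this.congr_deriv ?_
  rw [wave, rate]
  ring

lemma hasDerivAt_tri (k l : ℕ) (p₁ p₂ p₃ : ℂ) (x : ℝ) :
    HasDerivAt (tri k l p₁ p₂ p₃)
      (tri k l (p₁ * (Complex.I * rate k l (2 * k + l)))
        (p₂ * (Complex.I * rate k l (-(k + 2 * l)))) (p₃ * (Complex.I * rate k l (-k + l))) x) x := by
  refine ((((hasDerivAt_wave k l _ x).const_mul p₁).add
    ((hasDerivAt_wave k l _ x).const_mul p₂)).add
      ((hasDerivAt_wave k l _ x).const_mul p₃)).congr_deriv ?_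
  rw [tri]
  ring

@[simp] lemma wave_zero (k l : ℕ) (a : ℝ) : wave k l a 0 = 1 := by simp [wave]

@[simp] lemma tri_zero (k l : ℕ) (p₁ p₂ p₃ : ℂ) : tri k l p₁ p₂ p₃ 0 = p₁ + p₂ + p₃ := by
  simp [tri]

lemma solves_tri (hk : 0 < k) (l : ℕ) (p₁ p₂ p₃ : ℂ) (s : Set ℝ) :
    Solves (Complex.I * lamC k l) (tri k l p₁ p₂ p₃)
      (tri k l (p₁ * (Complex.I * rate k l (2 * k + l)))
        (p₂ * (Complex.I * rate k l (-(k + 2 * l)))) (p₃ * (Complex.I * rate k l (-k + l))))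
      (tri k l (p₁ * (Complex.I * rate k l (2 * k + l)) * (Complex.I * rate k l (2 * k + l)))
        (p₂ * (Complex.I * rate k l (-(k + 2 * l))) * (Complex.I * rate k l (-(k + 2 * l))))
        (p₃ * (Complex.I * rate k l (-k + l)) * (Complex.I * rate k l (-k + l)))) s := by
  refine ⟨fun x _ => (hasDerivAt_tri k l _ _ _ x).hasDerivWithinAt,
    fun x _ => (hasDerivAt_tri k l _ _ _ x).hasDerivWithinAt,
    fun x _ => ((hasDerivAt_tri k l _ _ _ x).congr_deriv ?_).hasDerivWithinAt⟩
  have key : ∀ a : ℝ, a ^ 3 - 3 * q k l * a = (2 * k + l) * (k - l) * (2 * l + k) →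
      (rate k l a : ℂ) ^ 3 = rate k l a + lamC k l := by
    intro a ha
    exact_mod_cast rate_cube hk l ha
  have h1 := key (2 * k + l) (by unfold q; ring)
  have h2 := key (-(k + 2 * l)) (by unfold q; ring)
  have h3 := key (-k + l) (by unfold q; ring)
  simp only [tri]
  set r₁ : ℂ := (rate k l (2 * k + l) : ℂ)
  set r₂ : ℂ := (rate k l (-(k + 2 * l)) : ℂ)
  set r₃ : ℂ := (rate k l (-k + l) : ℂ)
  have hI : Complex.I ^ 2 = -1 := Complex.I_sq
  linear_combination
    (p₁ * r₁ ^ 3 * wave k l (2 * k + l) x + p₂ * r₂ ^ 3 * wave k l (-(k + 2 * l)) x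
      + p₃ * r₃ ^ 3 * wave k l (-k + l) x) * Complex.I * hI
    - Complex.I * (p₁ * wave k l (2 * k + l) x * h1 + p₂ * wave k l (-(k + 2 * l)) x * h2
      + p₃ * wave k l (-k + l) x * h3)

/-- The initial slope of `tri`. -/
noncomputable def triSlope (k l : ℕ) (p₁ p₂ p₃ : ℂ) : ℂ :=
  Complex.I * (p₁ * rate k l (2 * k + l) + p₂ * rate k l (-(k + 2 * l)) + p₃ * rate k l (-k + l))

/-- The initial curvature of `tri`. -/
noncomputable def triCurv (k l : ℕ) (p₁ p₂ p₃ : ℂ) : ℂ :=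
  -(p₁ * rate k l (2 * k + l) ^ 2 + p₂ * rate k l (-(k + 2 * l)) ^ 2
    + p₃ * rate k l (-k + l) ^ 2)

lemma tri_eq_sol (hk : 0 < k) (l : ℕ) {p₁ p₂ p₃ : ℂ} (hp : p₁ + p₂ + p₃ = 0) {x : ℝ}
    (hx : 0 ≤ x) : tri k l p₁ p₂ p₃ x =
      sol (triSlope k l p₁ p₂ p₃) (triCurv k l p₁ p₂ p₃) (Complex.I * lamC k l) 0 x := by
  rw [((solves_tri hk l p₁ p₂ p₃ (Icc 0 x)).eq_fund (by simp [hp]) (right_mem_Icc.2 hx)).1]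
  have hI : Complex.I ^ 2 = -1 := Complex.I_sq
  simp only [tri_zero, sol, triSlope, triCurv]
  linear_combination (p₁ * rate k l (2 * k + l) ^ 2 + p₂ * rate k l (-(k + 2 * l)) ^ 2
    + p₃ * rate k l (-k + l) ^ 2) * fund 0 (Complex.I * lamC k l) x * hI

/-- The common value of the three waves at the critical length, a cube root of unity. -/
noncomputable def omega (k l : ℕ) : ℂ := wave k l (2 * k + l) (critLength k l)

lemma wave_critLength (hk : 0 < k) (l : ℕ) (a : ℝ) :
    wave k l a (critLength k l) = Complex.exp (2 * Real.pi * Complex.I * (a / 3 : ℝ)) := by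
  have := rate_mul_critLength hk l a
  rw [rate] at this
  rw [wave, this]
  congr 1
  push_cast
  ring

lemma wave_add (k l : ℕ) (a b x : ℝ) : wave k l (a + b) x = wave k l a x * wave k l b x := by
  simp only [wave]
  rw [← Complex.exp_add]
  congr 1
  push_cast
  ring

lemma wave_three_mul (hk : 0 < k) (l : ℕ) (n : ℤ) :
    wave k l (3 * n) (critLength k l) = 1 := by
  rw [wave_critLength hk, ← Complex.exp_int_mul_two_pi_mul_I n]
  congr 1
  push_cast
  ring

lemma wave_critLength_two (hk : 0 < k) (l : ℕ) :
    wave k l (-(k + 2 * l)) (critLength k l) = omega k l := by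
  have := wave_three_mul hk l (-(k + l))
  rw [omega, show (-(k + 2 * l) : ℝ) = (2 * k + l) + 3 * ((-(k + l) : ℤ) : ℝ) by push_cast; ring,
    wave_add, this, mul_one]

lemma wave_critLength_three (hk : 0 < k) (l : ℕ) :
    wave k l (-k + l) (critLength k l) = omega k l := by
  have := wave_three_mul hk l (-k)
  rw [omega, show (-k + l : ℝ) = (2 * k + l) + 3 * ((-k : ℤ) : ℝ) by push_cast; ring,
    wave_add, this, mul_one]

lemma tri_critLength (hk : 0 < k) (l : ℕ) (p₁ p₂ p₃ : ℂ) :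
    tri k l p₁ p₂ p₃ (critLength k l) = omega k l * (p₁ + p₂ + p₃) := by
  rw [tri, wave_critLength_two hk, wave_critLength_three hk, ← omega]
  ring

lemma star_wave (k l : ℕ) (a x : ℝ) : star (wave k l a x) = wave k l (-a) x := by
  rw [wave, wave, Complex.star_def, ← Complex.exp_conj]
  congr 1
  simp only [map_mul, Complex.conj_I, Complex.conj_ofReal]
  push_cast
  ring

lemma wave_reflect (k l : ℕ) (a L x : ℝ) : wave k l a (L - x) = wave k l a L * wave k l (-a) x := by
  simp only [wave]
  rw [← Complex.exp_add]
  congr 1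
  push_cast
  ring

/-- At the critical length, reflection of the interval acts on the waves as conjugation. -/
lemma tri_reflect (hk : 0 < k) (l : ℕ) (p₁ p₂ p₃ : ℂ) (x : ℝ) :
    tri k l p₁ p₂ p₃ (critLength k l - x) =
      omega k l * star (tri k l (star p₁) (star p₂) (star p₃) x) := by
  simp only [tri, wave_reflect, star_add, star_mul', star_wave, star_star,
    wave_critLength_two hk, wave_critLength_three hk]
  rw [← omega]
  ring

lemma integral_wave_mul (hk : 0 < k) (l : ℕ) {a b : ℝ} (n : ℤ) (hn : n ≠ 0)
    (hab : a - b = 3 * n) :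
    ∫ x in (0 : ℝ)..critLength k l, wave k l a x * star (wave k l b x) = 0 := by
  have hs := Real.sqrt_pos.2 (q_pos hk l)
  have hr : (Complex.I * rate k l (3 * n) : ℂ) ≠ 0 := by
    have hn' : (n : ℝ) ≠ 0 := by exact_mod_cast hn
    have : rate k l (3 * n) ≠ 0 := by rw [rate]; positivity
    simp [this]
  have h := intervalIntegral.integral_eq_sub_of_hasDerivAt (a := 0) (b := critLength k l)
    (fun x _ => hasDerivAt_wave k l (3 * n) x) ((continuous_const.mul
      (continuous_iff_continuousAt.2 fun x => (hasDerivAt_wave k l (3 * n) x).continuousAt)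
      ).intervalIntegrable _ _)
  rw [wave_three_mul hk, wave_zero, sub_self, intervalIntegral.integral_const_mul] at h
  simp_rw [star_wave, ← wave_add, ← sub_eq_add_neg, hab]
  exact (mul_eq_zero.1 h).resolve_left hr

lemma integral_wave_mul_self (k l : ℕ) (a : ℝ) :
    ∫ x in (0 : ℝ)..critLength k l, wave k l a x * star (wave k l a x) = critLength k l := by
  simp_rw [star_wave, ← wave_add, add_neg_cancel]
  simp [wave]

/-- The three waves are orthogonal on the critical interval. -/
lemma integral_tri_mul (hk : 0 < k) (hl : 0 < l) (p₁ p₂ p₃ r₁ r₂ r₃ : ℂ) :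
    ∫ x in (0 : ℝ)..critLength k l, tri k l p₁ p₂ p₃ x * star (tri k l r₁ r₂ r₃ x) =
      critLength k l * (p₁ * star r₁ + p₂ * star r₂ + p₃ * star r₃) := by
  have hI : ∀ (p : ℂ) (a b : ℝ), IntervalIntegrable
      (fun x => p * (wave k l a x * star (wave k l b x))) volume 0 (critLength k l) := by
    intro p a b
    have hc : ∀ a, Continuous (wave k l a) := fun a =>
      continuous_iff_continuousAt.2 fun x => (hasDerivAt_wave k l a x).continuousAt
    exact (continuous_const.mul ((hc a).mul (hc b).star)).intervalIntegrable _ _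
  have e : ∀ x, tri k l p₁ p₂ p₃ x * star (tri k l r₁ r₂ r₃ x) =
      (p₁ * star r₁) * (wave k l (2 * k + l) x * star (wave k l (2 * k + l) x))
      + (p₁ * star r₂) * (wave k l (2 * k + l) x * star (wave k l (-(k + 2 * l)) x))
      + (p₁ * star r₃) * (wave k l (2 * k + l) x * star (wave k l (-k + l) x))
      + (p₂ * star r₁) * (wave k l (-(k + 2 * l)) x * star (wave k l (2 * k + l) x))
      + (p₂ * star r₂) * (wave k l (-(k + 2 * l)) x * star (wave k l (-(k + 2 * l)) x))
      + (p₂ * star r₃) * (wave k l (-(k + 2 * l)) x * star (wave k l (-k + l) x))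
      + (p₃ * star r₁) * (wave k l (-k + l) x * star (wave k l (2 * k + l) x))
      + (p₃ * star r₂) * (wave k l (-k + l) x * star (wave k l (-(k + 2 * l)) x))
      + (p₃ * star r₃) * (wave k l (-k + l) x * star (wave k l (-k + l) x)) := by
    intro x
    simp only [tri, star_add, star_mul']
    ring
  simp_rw [e]
  repeat rw [intervalIntegral.integral_add
    (by repeat' first | exact hI _ _ _ | refine IntervalIntegrable.add ?_ ?_) (hI _ _ _)]
  simp only [intervalIntegral.integral_const_mul, integral_wave_mul_self]
  rw [integral_wave_mul hk l (k + l) (by positivity) (by push_cast; ring),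
    integral_wave_mul hk l k (by positivity) (by push_cast; ring),
    integral_wave_mul hk l (-(k + l)) (by rw [neg_ne_zero]; positivity) (by push_cast; ring),
    integral_wave_mul hk l (-l) (by rw [neg_ne_zero]; positivity) (by push_cast; ring),
    integral_wave_mul hk l (-k) (by rw [neg_ne_zero]; positivity) (by push_cast; ring),
    integral_wave_mul hk l l (by positivity) (by push_cast; ring)]
  ring

lemma omega_eq (hk : 0 < k) (l : ℕ) :
    omega k l = Complex.exp (((2 * Real.pi * ((2 * k + l) / 3) : ℝ) : ℂ) * Complex.I) := by
  rw [omega, wave_critLength hk]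
  congr 1
  push_cast
  ring

lemma norm_omega (hk : 0 < k) (l : ℕ) : ‖omega k l‖ = 1 := by
  rw [omega_eq hk, Complex.norm_exp_ofReal_mul_I]

lemma omega_eq_one (hk : 0 < k) (h : k ≡ l [MOD 3]) : omega k l = 1 := by
  obtain ⟨n, hn⟩ : 3 ∣ 2 * k + l := by
    unfold Nat.ModEq at h
    omega
  rw [omega_eq hk, ← Complex.exp_int_mul_two_pi_mul_I n]
  have : (2 * k + l : ℝ) = 3 * n := by exact_mod_cast hn
  rw [this]
  congr 1
  push_cast
  ring

lemma omega_im_ne_zero (hk : 0 < k) (h : ¬ k ≡ l [MOD 3]) : (omega k l).im ≠ 0 := by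
  rw [omega_eq hk, Complex.exp_ofReal_mul_I_im]
  intro h0
  obtain ⟨n, hn⟩ := Real.sin_eq_zero_iff.1 h0
  have hn' : (3 * n : ℝ) = 2 * (2 * k + l) := by
    have := Real.pi_pos
    field_simp at hn
    linarith
  have hn'' : 3 * n = 2 * (2 * (k : ℤ) + l) := by exact_mod_cast hn'
  apply h
  unfold Nat.ModEq
  omega

end

section
variable {k l : ℕ}

/-! ### The fundamental solution at the critical parameter -/

/-- The critical eigenvalue `i λ_c`. -/
noncomputable def zC (k l : ℕ) : ℂ := Complex.I * lamC k l

/-- `c = (3√3/2) λ_c`, which lies in `(-1, 1)`. -/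
noncomputable def cosPar (k l : ℕ) : ℝ :=
  (k - l) * (k + 2 * l) * (2 * k + l) / (2 * (q k l * √(q k l)))

/-- The scale `π √q / (1 - c²)` of the characteristic function near the critical point. -/
noncomputable def scale (k l : ℕ) : ℝ := Real.pi * √(q k l) / (1 - cosPar k l ^ 2)

lemma one_sub_cosPar_sq (hk : 0 < k) (l : ℕ) :
    1 - cosPar k l ^ 2 = 27 * (k * l * (k + l)) ^ 2 / (4 * q k l ^ 3) := by
  have h := q_pos hk l
  rw [cosPar, div_pow, mul_pow 2, mul_pow (q k l), Real.sq_sqrt h.le]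
  field_simp
  unfold q
  ring

lemma cosPar_sq_lt_one (hk : 0 < k) (hl : 0 < l) : cosPar k l ^ 2 < 1 := by
  have h := q_pos hk l
  have hk' : (0 : ℝ) < k := by exact_mod_cast hk
  have hl' : (0 : ℝ) < l := by exact_mod_cast hl
  have : 0 < 1 - cosPar k l ^ 2 := by rw [one_sub_cosPar_sq hk]; positivity
  linarith

lemma scale_pos (hk : 0 < k) (hl : 0 < l) : 0 < scale k l := by
  have h := Real.sqrt_pos.2 (q_pos hk l)
  have := cosPar_sq_lt_one hk hl
  exact div_pos (mul_pos Real.pi_pos h) (by linarith)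

lemma isElliptic_lamC (hk : 0 < k) (hl : 0 < l) : |lamC k l| < 2 * √3 / 9 := by
  have h3 : 0 < √(3 : ℝ) := by positivity
  have h33 : √(3 : ℝ) ^ 2 = 3 := Real.sq_sqrt (by norm_num)
  have h := q_pos hk l
  have hs := Real.sqrt_pos.2 h
  have e : lamC k l = cosPar k l * (2 * √3 / 9) := by
    rw [lamC_eq hk, cosPar]
    field_simp
    rw [h33]
    ring
  have hc : |cosPar k l| < 1 := (sq_lt_one_iff_abs_lt_one _).1 (cosPar_sq_lt_one hk hl)
  rw [e, abs_mul, abs_of_pos (by positivity : 0 < 2 * √3 / 9)]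
  exact mul_lt_of_lt_one_left (by positivity) hc

/-- The factor `q / (3 k l (k + l))` between the fundamental solution and the waves. -/
noncomputable def fundFactor (k l : ℕ) : ℝ := q k l / (3 * (k * l * (k + l)))

/-- The fundamental solution at the critical parameter is a combination of the three waves, with
the same coefficients, up to a factor, as the Type 1 eigenfunction. -/
lemma fund_eq_tri (hk : 0 < k) (hl : 0 < l) {x : ℝ} (hx : 0 ≤ x) {n : ℕ} (hn : n < 3) :
    fund n (zC k l) x = tri k l
      (fundFactor k l * -l * (Complex.I * rate k l (2 * k + l)) ^ n)
      (fundFactor k l * -k * (Complex.I * rate k l (-(k + 2 * l))) ^ n)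
      (fundFactor k l * (k + l) * (Complex.I * rate k l (-k + l)) ^ n) x := by
  have h := q_pos hk l
  have hk' : (0 : ℝ) < k := by exact_mod_cast hk
  have hl' : (0 : ℝ) < l := by exact_mod_cast hl
  have hI : Complex.I ^ 2 = -1 := Complex.I_sq
  have e1 : fundFactor k l * -l * rate k l (2 * k + l) + fundFactor k l * -k *
      rate k l (-(k + 2 * l)) + fundFactor k l * (k + l) * rate k l (-k + l) = 0 := by
    simp only [rate]
    ring
  have e2 : fundFactor k l * -l * rate k l (2 * k + l) ^ 2 + fundFactor k l * -k *
      rate k l (-(k + 2 * l)) ^ 2 + fundFactor k l * (k + l) * rate k l (-k + l) ^ 2 = -1 := by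
    simp only [sq_rate hk, fundFactor]
    field_simp
    ring
  have e1' := congrArg (fun x : ℝ => (x : ℂ)) e1
  have e2' := congrArg (fun x : ℝ => (x : ℂ)) e2
  push_cast at e1' e2'
  have hs := (solves_tri hk l (fundFactor k l * -l) (fundFactor k l * -k)
    (fundFactor k l * (k + l)) (Icc 0 x)).eq_fund (by rw [tri_zero]; ring) (right_mem_Icc.2 hx)
  simp only [tri_zero] at hs
  rw [show (fundFactor k l * -l * (Complex.I * rate k l (2 * k + l)) +
      fundFactor k l * -k * (Complex.I * rate k l (-(k + 2 * l))) +
      fundFactor k l * (k + l) * (Complex.I * rate k l (-k + l)) : ℂ) = 0 by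
        linear_combination Complex.I * e1',
    show (fundFactor k l * -l * (Complex.I * rate k l (2 * k + l)) *
      (Complex.I * rate k l (2 * k + l)) +
      fundFactor k l * -k * (Complex.I * rate k l (-(k + 2 * l))) *
      (Complex.I * rate k l (-(k + 2 * l))) +
      fundFactor k l * (k + l) * (Complex.I * rate k l (-k + l)) *
      (Complex.I * rate k l (-k + l)) : ℂ) = 1 by
        linear_combination -e2' + hI * (fundFactor k l * -l * rate k l (2 * k + l) ^ 2 +
          fundFactor k l * -k * rate k l (-(k + 2 * l)) ^ 2 +
          fundFactor k l * (k + l) * rate k l (-k + l) ^ 2)] at hs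
  simp only [zero_mul, one_mul, zero_add] at hs
  rw [zC]
  interval_cases n
  · simpa only [pow_zero, mul_one] using hs.1.symm
  · simpa only [pow_one] using hs.2.1.symm
  · simpa only [pow_two, mul_assoc] using hs.2.2.symm

lemma fund_reflect (hk : 0 < k) (hl : 0 < l) {x : ℝ} (hx : x ≤ critLength k l) {n : ℕ}
    (hn : n < 3) :
    fund n (zC k l) (critLength k l - x) = omega k l * star (tri k l
      (fundFactor k l * -l * (-Complex.I * rate k l (2 * k + l)) ^ n)
      (fundFactor k l * -k * (-Complex.I * rate k l (-(k + 2 * l))) ^ n)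
      (fundFactor k l * (k + l) * (-Complex.I * rate k l (-k + l)) ^ n) x) := by
  rw [fund_eq_tri hk hl (sub_nonneg.2 hx) hn, tri_reflect hk]
  simp

/-- At the critical length the fundamental solution repeats its initial data up to the factor `ω`,
since the three waves do. -/
lemma fund_critLength (hk : 0 < k) (hl : 0 < l) :
    fund 0 (zC k l) (critLength k l) = 0 ∧ fund 1 (zC k l) (critLength k l) = 0 ∧
      fund 2 (zC k l) (critLength k l) = omega k l := by
  have h0 : ∀ n < 3, fund n (zC k l) (critLength k l) = omega k l * fund n (zC k l) 0 := by
    intro n hn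
    rw [fund_eq_tri hk hl (critLength_pos hk l).le hn, fund_eq_tri hk hl le_rfl hn,
      tri_critLength hk, tri_zero]
  exact ⟨by simpa using h0 0, by simpa using h0 1, by simpa using h0 2⟩

/-- By reflection and orthogonality of the waves, the convolution at the critical length is a sum
of three terms. -/
lemma integral_fund_mul (hk : 0 < k) (hl : 0 < l) {n : ℕ} (hn : n < 3) :
    ∫ t in (0 : ℝ)..critLength k l, fund 0 (zC k l) t * fund n (zC k l) (critLength k l - t) =
      omega k l * Complex.I ^ n * ((critLength k l * fundFactor k l ^ 2 *
        (l ^ 2 * rate k l (2 * k + l) ^ n + k ^ 2 * rate k l (-(k + 2 * l)) ^ n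
          + (k + l) ^ 2 * rate k l (-k + l) ^ n) : ℝ) : ℂ) := by
  have e : ∀ t ∈ uIcc (0 : ℝ) (critLength k l),
      fund 0 (zC k l) t * fund n (zC k l) (critLength k l - t) =
      omega k l * (tri k l (fundFactor k l * -l) (fundFactor k l * -k)
        (fundFactor k l * (k + l)) t * star (tri k l
      (fundFactor k l * -l * (-Complex.I * rate k l (2 * k + l)) ^ n)
      (fundFactor k l * -k * (-Complex.I * rate k l (-(k + 2 * l))) ^ n)
      (fundFactor k l * (k + l) * (-Complex.I * rate k l (-k + l)) ^ n) t)) := by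
    intro t ht
    rw [uIcc_of_le (critLength_pos hk l).le] at ht
    rw [fund_reflect hk hl ht.2 hn, fund_eq_tri hk hl ht.1 (by norm_num : 0 < 3)]
    simp only [pow_zero, mul_one]
    ring
  rw [intervalIntegral.integral_congr e, intervalIntegral.integral_const_mul,
    integral_tri_mul hk hl]
  simp
  ring

/-- The convolutions of the critical fundamental solution with itself and its derivatives. -/
lemma integral_fund_zero_one_two (hk : 0 < k) (hl : 0 < l) :
    (∫ t in (0 : ℝ)..critLength k l, fund 0 (zC k l) t * fund 0 (zC k l) (critLength k l - t) =
      omega k l * ((√3 * scale k l : ℝ) : ℂ)) ∧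
    (∫ t in (0 : ℝ)..critLength k l, fund 0 (zC k l) t * fund 1 (zC k l) (critLength k l - t) =
      -omega k l * Complex.I * ((scale k l * cosPar k l : ℝ) : ℂ)) ∧
    (∫ t in (0 : ℝ)..critLength k l, fund 0 (zC k l) t * fund 2 (zC k l) (critLength k l - t) =
      -omega k l * ((scale k l / √3 : ℝ) : ℂ)) := by
  have h := q_pos hk l
  have hk' : (0 : ℝ) < k := by exact_mod_cast hk
  have hl' : (0 : ℝ) < l := by exact_mod_cast hl
  have h3 : 0 < √(3 : ℝ) := by positivity
  have h33 : √(3 : ℝ) ^ 2 = 3 := Real.sq_sqrt (by norm_num)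
  have hs := Real.sqrt_pos.2 h
  have hss : √(q k l) ^ 2 = q k l := Real.sq_sqrt h.le
  have hq : q k l = (k : ℝ) ^ 2 + k * l + (l : ℝ) ^ 2 := rfl
  have hW : critLength k l * fundFactor k l ^ 2 * (2 * q k l) = √3 * scale k l := by
    rw [scale, one_sub_cosPar_sq hk, critLength_eq, fundFactor]
    field_simp
    rw [h33]
    ring
  have hA : critLength k l * fundFactor k l ^ 2 = √3 * scale k l / (2 * q k l) := by
    rw [← hW]
    field_simp
  refine ⟨?_, ?_, ?_⟩
  · rw [integral_fund_mul hk hl (by norm_num)]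
    rw [hA]
    simp only [pow_zero, mul_one]
    congr 2
    rw [hq]
    have : (k : ℝ) ^ 2 + k * l + (l : ℝ) ^ 2 ≠ 0 := hq ▸ h.ne'
    field_simp
    ring
  · rw [integral_fund_mul hk hl (by norm_num), hA]
    have e : √3 * scale k l / (2 * q k l) * (l ^ 2 * rate k l (2 * k + l) ^ 1 +
        k ^ 2 * rate k l (-(k + 2 * l)) ^ 1 + (k + l) ^ 2 * rate k l (-k + l) ^ 1) =
        -(scale k l * cosPar k l) := by
      simp only [rate, cosPar, pow_one]
      field_simp
      rw [h33]
      ring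
    rw [e]
    push_cast
    ring
  · rw [integral_fund_mul hk hl (by norm_num), hA]
    have e : √3 * scale k l / (2 * q k l) * (l ^ 2 * rate k l (2 * k + l) ^ 2 +
        k ^ 2 * rate k l (-(k + 2 * l)) ^ 2 + (k + l) ^ 2 * rate k l (-k + l) ^ 2) =
        scale k l / √3 := by
      simp only [sq_rate hk]
      field_simp
      rw [h33, hq]
      ring
    rw [e, Complex.I_sq]
    ring

/-! ### The critical eigenfunctions -/

/-- Combinations of the three waves vanishing at `0` are eigenfunctions at the critical length,
either because `ω = 1` or because their slope vanishes. -/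
lemma isNormalizedEigenfunction_tri (hk : 0 < k) (hl : 0 < l) {p₁ p₂ p₃ : ℂ}
    (hp : p₁ + p₂ + p₃ = 0)
    (hs : omega k l = 1 ∨ triSlope k l p₁ p₂ p₃ = 0)
    (hn : (critLength k l : ℂ) * (p₁ * star p₁ + p₂ * star p₂ + p₃ * star p₃) = 1) :
    IsNormalizedEigenfunction (critLength k l) (Complex.I * lamC k l) (tri k l p₁ p₂ p₃) := by
  have hL := critLength_pos hk l
  have hint : ∫ x in (0 : ℝ)..critLength k l, ‖tri k l p₁ p₂ p₃ x‖ ^ 2 = 1 := by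
    have := integral_tri_mul hk hl p₁ p₂ p₃ p₁ p₂ p₃
    simp only [mul_star_eq (tri k l p₁ p₂ p₃ _)] at this
    rw [intervalIntegral.integral_ofReal, hn] at this
    exact_mod_cast this
  refine ⟨(solves_tri hk l p₁ p₂ p₃ _).isEigenfunction hL (by simp [hp])
    (by rw [tri_critLength hk, hp, mul_zero]) ?_ ?_, hint⟩
  · rw [tri_critLength hk, tri_zero]
    rcases hs with h | h
    · rw [h, one_mul]
    · have : p₁ * (Complex.I * rate k l (2 * k + l)) +
          p₂ * (Complex.I * rate k l (-(k + 2 * l))) + p₃ * (Complex.I * rate k l (-k + l)) = 0 := by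
        rw [← h, triSlope]
        ring
      rw [this, mul_zero]
  · by_contra! hc
    rw [intervalIntegral.integral_congr (g := fun _ => (0 : ℝ)) (fun x hx => ?_)] at hint
    · simp at hint
    · rw [uIcc_of_le hL.le] at hx
      simp [hc x hx]

/-- The amplitude `1 / √(2 L₀)`. -/
noncomputable def amp (k l : ℕ) : ℝ := 1 / √(2 * critLength k l)

lemma critLength_mul_amp_sq (hk : 0 < k) (l : ℕ) : critLength k l * amp k l ^ 2 = 1 / 2 := by
  have h := critLength_pos hk l
  rw [amp, div_pow, Real.sq_sqrt (by positivity)]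
  field_simp

lemma amp_pos (hk : 0 < k) (l : ℕ) : 0 < amp k l := by
  have h := critLength_pos hk l
  unfold amp
  positivity

lemma typeOne_factor (hk : 0 < k) (l : ℕ) :
    Real.pi * √(2 / (3 * critLength k l ^ 3)) = amp k l / √(q k l) := by
  have h := critLength_pos hk l
  have hq := q_pos hk l
  have hs := Real.sqrt_pos.2 hq
  have hpi := Real.pi_pos
  have h33 : √(3 : ℝ) ^ 2 = 3 := Real.sq_sqrt (by norm_num)
  have ha := amp_pos hk l
  have hL2 : 3 * critLength k l ^ 2 = (2 * Real.pi) ^ 2 * q k l := by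
    rw [critLength_eq, div_pow, h33, mul_pow, Real.sq_sqrt hq.le]
    ring
  refine (sq_eq_sq₀ (by positivity) (by positivity)).1 ?_
  rw [mul_pow, Real.sq_sqrt (by positivity), div_pow, Real.sq_sqrt hq.le, amp, div_pow,
    Real.sq_sqrt (by positivity)]
  field_simp
  linear_combination -hL2

lemma typeOne_eq_tri (hk : 0 < k) (l : ℕ) : typeOne k l =
    tri k l (((amp k l / √(q k l) : ℝ) : ℂ) * -l) (((amp k l / √(q k l) : ℝ) : ℂ) * -k)
      (((amp k l / √(q k l) : ℝ) : ℂ) * (k + l)) := by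
  funext x
  rw [typeOne, typeOne_factor hk, tri]
  ring

lemma typeTwo_eq_tri (k l : ℕ) : typeTwo k l = tri k l (amp k l) (-amp k l) 0 := by
  funext x
  rw [typeTwo, tri, ← amp]
  ring

/-- The cosine `(k - l) / (2 √q)` of the angle between the two critical eigenfunctions. -/
noncomputable def cosAngle (k l : ℕ) : ℝ := (k - l) / (2 * √(q k l))

lemma cosAngle_sq (hk : 0 < k) (l : ℕ) :
    1 - cosAngle k l ^ 2 = (√3 * (k + l) / (2 * √(q k l))) ^ 2 := by
  have hq := q_pos hk l
  have h33 : √(3 : ℝ) ^ 2 = 3 := Real.sq_sqrt (by norm_num)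
  rw [cosAngle, div_pow, mul_pow 2, Real.sq_sqrt hq.le, div_pow, mul_pow √3, h33, mul_pow 2,
    Real.sq_sqrt hq.le]
  field_simp
  unfold q
  ring

lemma angle_eq (hk : 0 < k) (l : ℕ) : angle k l = Real.arccos (cosAngle k l) := by
  have hs := Real.sqrt_pos.2 (q_pos hk l)
  have h3 : 0 < √(3 : ℝ) := by positivity
  rw [angle, cosAngle, critLength_eq]
  congr 1
  field_simp

lemma cos_angle (hk : 0 < k) (l : ℕ) : Real.cos (angle k l) = cosAngle k l := by
  have h := cosAngle_sq hk l
  have h1 : cosAngle k l ^ 2 ≤ 1 := by nlinarith [sq_nonneg (√3 * (k + l) / (2 * √(q k l)))]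
  have h2 := (sq_le_one_iff_abs_le_one _).1 h1
  rw [angle_eq hk, Real.cos_arccos (abs_le.1 h2).1 (abs_le.1 h2).2]

lemma sin_angle (hk : 0 < k) (l : ℕ) :
    Real.sin (angle k l) = √3 * (k + l) / (2 * √(q k l)) := by
  rw [angle_eq hk, Real.sin_arccos, cosAngle_sq hk, Real.sqrt_sq (by positivity)]

lemma sin_angle_pos (hk : 0 < k) (l : ℕ) : 0 < Real.sin (angle k l) := by
  have hs := Real.sqrt_pos.2 (q_pos hk l)
  have hk' : (0 : ℝ) < k := by exact_mod_cast hk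
  rw [sin_angle hk]
  positivity

lemma typeTwoOrth_eq (hk : 0 < k) (l : ℕ) (x : ℝ) :
    typeTwoOrth k l x = ((1 / Real.sin (angle k l) : ℝ) : ℂ) *
      (typeTwo k l x - (Real.cos (angle k l) : ℝ) * typeOne k l x) := by
  have hs := Real.sqrt_pos.2 (q_pos hk l)
  have h3 : 0 < √(3 : ℝ) := by positivity
  have hk' : (0 : ℝ) < k := by exact_mod_cast hk
  have hpi := Real.pi_pos
  have e1 : -((k - l) / (√3 * (k + l))) =
      -(1 / Real.sin (angle k l) * Real.cos (angle k l)) := by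
    rw [sin_angle hk, cos_angle hk, cosAngle]
    field_simp
  have e2 : critLength k l / (Real.pi * (k + l)) = 1 / Real.sin (angle k l) := by
    rw [sin_angle hk, critLength_eq]
    field_simp
  rw [typeTwoOrth, e1, e2]
  push_cast
  ring

lemma typeTwoOrth_eq_tri (hk : 0 < k) (l : ℕ) : typeTwoOrth k l = tri k l
    (((1 / Real.sin (angle k l) * (amp k l + cosAngle k l * (amp k l / √(q k l)) * l) : ℝ) : ℂ))
    (((1 / Real.sin (angle k l) * (-amp k l + cosAngle k l * (amp k l / √(q k l)) * k) : ℝ) : ℂ))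
    (((1 / Real.sin (angle k l) * (-(cosAngle k l * (amp k l / √(q k l)) * (k + l))) : ℝ) : ℂ))
    := by
  funext x
  rw [typeTwoOrth_eq hk, typeOne_eq_tri hk, typeTwo_eq_tri, cos_angle hk]
  simp only [tri]
  push_cast
  ring

lemma isNormalizedEigenfunction_typeOne (hk : 0 < k) (hl : 0 < l) :
    IsNormalizedEigenfunction (critLength k l) (Complex.I * lamC k l) (typeOne k l) := by
  have hq := q_pos hk l
  rw [typeOne_eq_tri hk]
  refine isNormalizedEigenfunction_tri hk hl (by ring) (Or.inr ?_) ?_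
  · simp only [triSlope, rate]
    push_cast
    ring
  · have : critLength k l * ((amp k l / √(q k l) * -l) ^ 2 + (amp k l / √(q k l) * -k) ^ 2 +
        (amp k l / √(q k l) * (k + l)) ^ 2) = 1 := by
      have e := critLength_mul_amp_sq hk l
      simp only [mul_pow, div_pow, Real.sq_sqrt hq.le]
      field_simp
      have hq' : (l : ℝ) ^ 2 + k ^ 2 + (k + l) ^ 2 = 2 * q k l := by unfold q; ring
      linear_combination (2 * e) * q k l + critLength k l * amp k l ^ 2 * hq'
    have h := congrArg (fun x : ℝ => (x : ℂ)) this
    push_cast at h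
    simp
    linear_combination h

lemma isNormalizedEigenfunction_typeTwo (hk : 0 < k) (hl : 0 < l) (hω : omega k l = 1) :
    IsNormalizedEigenfunction (critLength k l) (Complex.I * lamC k l) (typeTwo k l) := by
  rw [typeTwo_eq_tri]
  refine isNormalizedEigenfunction_tri hk hl (by ring) (Or.inl hω) ?_
  have h := congrArg (fun x : ℝ => (x : ℂ)) (critLength_mul_amp_sq hk l)
  push_cast at h
  simp
  linear_combination 2 * h

lemma orth_aux (hk : 0 < k) (l : ℕ) :
    critLength k l * ((amp k l / √(q k l) * -l) *
      (1 / Real.sin (angle k l) * (amp k l + cosAngle k l * (amp k l / √(q k l)) * l)) +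
      (amp k l / √(q k l) * -k) *
      (1 / Real.sin (angle k l) * (-amp k l + cosAngle k l * (amp k l / √(q k l)) * k)) +
      (amp k l / √(q k l) * (k + l)) *
      (1 / Real.sin (angle k l) * (-(cosAngle k l * (amp k l / √(q k l)) * (k + l))))) = 0 := by
  have hq := q_pos hk l
  have hs := Real.sqrt_pos.2 hq
  have hss : √(q k l) ^ 2 = q k l := Real.sq_sqrt hq.le
  have hsin := sin_angle_pos hk l
  rw [cosAngle]
  field_simp
  rw [hss]
  unfold q
  ring

lemma isNormalizedEigenfunction_typeTwoOrth (hk : 0 < k) (hl : 0 < l) (hω : omega k l = 1) :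
    IsNormalizedEigenfunction (critLength k l) (Complex.I * lamC k l) (typeTwoOrth k l) := by
  have hq := q_pos hk l
  have hs := Real.sqrt_pos.2 hq
  have hss : √(q k l) ^ 2 = q k l := Real.sq_sqrt hq.le
  have hsin := sin_angle_pos hk l
  have hk' : (0 : ℝ) < k := by exact_mod_cast hk
  rw [typeTwoOrth_eq_tri hk]
  refine isNormalizedEigenfunction_tri hk hl (by push_cast; ring) (Or.inl hω) ?_
  have : critLength k l * (
      (1 / Real.sin (angle k l) * (amp k l + cosAngle k l * (amp k l / √(q k l)) * l)) ^ 2 +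
      (1 / Real.sin (angle k l) * (-amp k l + cosAngle k l * (amp k l / √(q k l)) * k)) ^ 2 +
      (1 / Real.sin (angle k l) * (-(cosAngle k l * (amp k l / √(q k l)) * (k + l)))) ^ 2)
      = 1 := by
    have e := critLength_mul_amp_sq hk l
    have hsq : Real.sin (angle k l) ^ 2 = 1 - cosAngle k l ^ 2 := by
      rw [Real.sin_sq, cos_angle hk]
    have h1 : (1 + cosAngle k l / √(q k l) * l) ^ 2 + (-1 + cosAngle k l / √(q k l) * k) ^ 2 +
        (cosAngle k l / √(q k l) * (k + l)) ^ 2 = 2 * Real.sin (angle k l) ^ 2 := by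
      rw [hsq, cosAngle]
      field_simp
      rw [hss]
      unfold q
      ring
    calc _ = critLength k l * amp k l ^ 2 / Real.sin (angle k l) ^ 2 *
          ((1 + cosAngle k l / √(q k l) * l) ^ 2 + (-1 + cosAngle k l / √(q k l) * k) ^ 2 +
        (cosAngle k l / √(q k l) * (k + l)) ^ 2) := by ring
      _ = 1 := by
        rw [h1, e]
        field_simp
  have h := congrArg (fun x : ℝ => (x : ℂ)) this
  simp only [Complex.star_def, Complex.conj_ofReal]
  push_cast at h ⊢
  linear_combination h

lemma integral_typeOne_mul_typeTwoOrth (hk : 0 < k) (hl : 0 < l) :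
    ∫ x in (0 : ℝ)..critLength k l,
      typeOne k l x * (starRingEnd ℂ) (typeTwoOrth k l x) = 0 := by
  have h := congrArg (fun x : ℝ => (x : ℂ)) (orth_aux hk l)
  have h2 := integral_tri_mul hk hl (((amp k l / √(q k l) : ℝ) : ℂ) * -l)
    (((amp k l / √(q k l) : ℝ) : ℂ) * -k) (((amp k l / √(q k l) : ℝ) : ℂ) * (k + l))
    (((1 / Real.sin (angle k l) * (amp k l + cosAngle k l * (amp k l / √(q k l)) * l) : ℝ) : ℂ))
    (((1 / Real.sin (angle k l) * (-amp k l + cosAngle k l * (amp k l / √(q k l)) * k) : ℝ) : ℂ))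
    (((1 / Real.sin (angle k l) * (-(cosAngle k l * (amp k l / √(q k l)) * (k + l))) : ℝ) : ℂ))
  rw [typeOne_eq_tri hk, typeTwoOrth_eq_tri hk]
  refine h2.trans ?_
  simp only [Complex.star_def, Complex.conj_ofReal]
  push_cast at h ⊢
  exact h

end

section
variable {k l : ℕ}

/-! ### The limiting profiles -/

/-- `√(2 q + s √q (k - l))`. -/
noncomputable def profileDen (k l : ℕ) (s : ℝ) : ℝ := √(2 * q k l + s * (√(q k l) * (k - l)))

lemma sub_sq_lt (hk : 0 < k) (hl : 0 < l) : ((k : ℝ) - l) ^ 2 < q k l := by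
  have hk' : (0 : ℝ) < k := by exact_mod_cast hk
  have hl' : (0 : ℝ) < l := by exact_mod_cast hl
  have := mul_pos hk' hl'
  unfold q
  nlinarith

lemma abs_sub_lt (hk : 0 < k) (hl : 0 < l) : |(k : ℝ) - l| < √(q k l) :=
  Real.lt_sqrt_of_sq_lt (by rw [sq_abs]; exact sub_sq_lt hk hl)

lemma profileDen_pos (hk : 0 < k) (hl : 0 < l) {s : ℝ} (hs : s ^ 2 = 1) :
    0 < 2 * q k l + s * (√(q k l) * (k - l)) := by
  have h := abs_sub_lt hk hl
  have hq := q_pos hk l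
  have hsq := Real.sqrt_pos.2 hq
  have hss : √(q k l) ^ 2 = q k l := Real.sq_sqrt hq.le
  rw [abs_lt] at h
  rcases mul_self_eq_one_iff.1 ((pow_two s).symm.trans hs) with rfl | rfl <;> nlinarith

lemma profileNorm_eq (hk : 0 < k) (l : ℕ) (s : ℝ) :
    profileNorm k l s = 2 * Real.pi * profileDen k l s := by
  have hq := q_pos hk l
  have h3 : 0 < √(3 : ℝ) := by positivity
  have h33 : √(3 : ℝ) ^ 2 = 3 := Real.sq_sqrt (by norm_num)
  have hss : √(q k l) ^ 2 = q k l := Real.sq_sqrt hq.le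
  have hpi := Real.pi_pos
  have e : 6 * critLength k l ^ 2 + s * (2 * √3 * Real.pi * critLength k l * (k - l)) =
      (2 * Real.pi) ^ 2 * (2 * q k l + s * (√(q k l) * (k - l))) := by
    rw [critLength_eq]
    field_simp
    linear_combination 6 * hss - 2 * q k l * h33
  rw [profileNorm, profileDen, e, Real.sqrt_mul (by positivity), Real.sqrt_sq (by positivity)]

lemma profile_eq (hk : 0 < k) (l : ℕ) (s x : ℝ) : profile k l s x =
    (((1 / profileDen k l s : ℝ)) : ℂ) * ((√(q k l) : ℂ) * typeOne k l x
      - ((k - l + s * √(q k l) : ℝ) : ℂ) * typeTwo k l x) := by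
  have h3 : 0 < √(3 : ℝ) := by positivity
  have hpi := Real.pi_pos
  have e1 : √3 * critLength k l = 2 * Real.pi * √(q k l) := by
    rw [critLength_eq]
    field_simp
  have e2 : 2 * Real.pi * (k - l) + s * (√3 * critLength k l) =
      2 * Real.pi * (k - l + s * √(q k l)) := by
    rw [e1]
    ring
  have hpi' : (Real.pi : ℂ) ≠ 0 := by exact_mod_cast hpi.ne'
  rw [profile, e2, e1, profileNorm_eq hk]
  have e3 : ((2 * Real.pi * √(q k l) : ℝ) : ℂ) * typeOne k l x -
      ((2 * Real.pi * (k - l + s * √(q k l)) : ℝ) : ℂ) * typeTwo k l x =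
      (2 * Real.pi : ℂ) * (√(q k l) * typeOne k l x
        - ((k - l + s * √(q k l) : ℝ) : ℂ) * typeTwo k l x) := by
    push_cast
    ring
  rw [e3, Complex.ofReal_mul (2 * Real.pi), Complex.ofReal_mul 2, Complex.ofReal_ofNat,
    mul_div_mul_left _ _ (by simp [hpi'])]
  push_cast
  ring

lemma profile_eq_tri (hk : 0 < k) (l : ℕ) (s : ℝ) : profile k l s =
    tri k l ((amp k l / profileDen k l s * (-k - s * √(q k l)) : ℝ) : ℂ)
      ((amp k l / profileDen k l s * (-l + s * √(q k l)) : ℝ) : ℂ)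
      ((amp k l / profileDen k l s * (k + l) : ℝ) : ℂ) := by
  have hs := Real.sqrt_pos.2 (q_pos hk l)
  have hs' : (√(q k l) : ℂ) ≠ 0 := by exact_mod_cast hs.ne'
  funext x
  rw [profile_eq hk, typeOne_eq_tri hk, typeTwo_eq_tri]
  simp only [tri]
  push_cast
  field_simp
  ring

/-- The initial curvature of the limiting profile. -/
noncomputable def boundaryCurv (k l : ℕ) (s : ℝ) : ℂ :=
  ((amp k l / profileDen k l s * (k + l) * (k - l + s * √(q k l)) * (s / √(q k l)) : ℝ) : ℂ)

lemma boundarySlope_eq (hk : 0 < k) (hl : 0 < l) {s : ℝ} (hs : s ^ 2 = 1) :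
    boundarySlope k l s = -(s * √3 * Complex.I) * boundaryCurv k l s := by
  have hq := q_pos hk l
  have h3 : 0 < √(3 : ℝ) := by positivity
  have h33 : √(3 : ℝ) ^ 2 = 3 := Real.sq_sqrt (by norm_num)
  have hsq := Real.sqrt_pos.2 hq
  have hL := critLength_pos hk l
  have hpi := Real.pi_pos
  have hLs := Real.sqrt_pos.2 hL
  have hLss : √(critLength k l) ^ 2 = critLength k l := Real.sq_sqrt hL.le
  have h22 : √(2 : ℝ) ^ 2 = 2 := Real.sq_sqrt (by norm_num)
  have hD : 0 < profileDen k l s := Real.sqrt_pos.2 (profileDen_pos hk hl hs)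
  have e1 : √3 * critLength k l = 2 * Real.pi * √(q k l) := by
    rw [critLength_eq]
    field_simp
  have e : √2 * Real.pi * (k + l) / critLength k l ^ (3 / 2 : ℝ)
      * ((2 * Real.pi * (k - l) + s * (√3 * critLength k l)) / profileNorm k l s) =
      s * √3 * (amp k l / profileDen k l s * (k + l) * (k - l + s * √(q k l)) *
        (s / √(q k l))) := by
    rw [profileNorm_eq hk, amp, Real.sqrt_mul (by norm_num), e1,
      show (3 / 2 : ℝ) = 1 + 1 / 2 by norm_num, Real.rpow_add hL, Real.rpow_one,
      ← Real.sqrt_eq_rpow]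
    have e3 : s * √3 * (1 / (√2 * √(critLength k l)) / profileDen k l s * (k + l) *
        (k - l + s * √(q k l)) * (s / √(q k l))) =
        s ^ 2 * (√3 * (1 / (√2 * √(critLength k l)) / profileDen k l s * (k + l) *
        (k - l + s * √(q k l)) * (1 / √(q k l)))) := by ring
    rw [e3, hs]
    field_simp
    rw [h22]
    linear_combination -(k - l + s * √(q k l)) * e1
  rw [boundarySlope, boundaryCurv, e]
  push_cast
  ring

lemma boundaryCurv_ne_zero (hk : 0 < k) (hl : 0 < l) {s : ℝ} (hs : s ^ 2 = 1) :
    boundaryCurv k l s ≠ 0 := by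
  have hq := q_pos hk l
  have hsq := Real.sqrt_pos.2 hq
  have hD : 0 < profileDen k l s := Real.sqrt_pos.2 (profileDen_pos hk hl hs)
  have ha := amp_pos hk l
  have hk' : (0 : ℝ) < k := by exact_mod_cast hk
  have h := abs_sub_lt hk hl
  rw [abs_lt] at h
  have h1 : (k - l + s * √(q k l) : ℝ) ≠ 0 := by
    rcases mul_self_eq_one_iff.1 ((pow_two s).symm.trans hs) with rfl | rfl <;> intro h0 <;> linarith
  have h2 : s ≠ 0 := by rintro rfl; norm_num at hs
  have h4 : (k + l : ℝ) ≠ 0 := by positivity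
  rw [boundaryCurv, Complex.ofReal_ne_zero]
  exact mul_ne_zero (mul_ne_zero (mul_ne_zero (div_ne_zero ha.ne' hD.ne') h4) h1)
    (div_ne_zero h2 hsq.ne')

lemma boundarySlope_ne_zero (hk : 0 < k) (hl : 0 < l) {s : ℝ} (hs : s ^ 2 = 1) :
    boundarySlope k l s ≠ 0 := by
  have h2 : s ≠ 0 := by rintro rfl; norm_num at hs
  rw [boundarySlope_eq hk hl hs]
  refine mul_ne_zero ?_ (boundaryCurv_ne_zero hk hl hs)
  simp [h2]

lemma profile_eq_sol (hk : 0 < k) (hl : 0 < l) {s : ℝ} (hs : s ^ 2 = 1) {x : ℝ} (hx : 0 ≤ x) :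
    profile k l s x = sol (boundarySlope k l s) (boundaryCurv k l s) (zC k l) 0 x := by
  have hq := q_pos hk l
  have h3 : 0 < √(3 : ℝ) := by positivity
  have h33 : √(3 : ℝ) ^ 2 = 3 := Real.sq_sqrt (by norm_num)
  have hsq := Real.sqrt_pos.2 hq
  have hss : √(q k l) ^ 2 = q k l := Real.sq_sqrt hq.le
  have hD : 0 < profileDen k l s := Real.sqrt_pos.2 (profileDen_pos hk hl hs)
  rw [profile_eq_tri hk, tri_eq_sol hk l (by push_cast; ring) hx, ← zC]
  congr 1
  · rw [boundarySlope_eq hk hl hs, triSlope, boundaryCurv]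
    have e : (amp k l / profileDen k l s * (-k - s * √(q k l))) * rate k l (2 * k + l) +
        (amp k l / profileDen k l s * (-l + s * √(q k l))) * rate k l (-(k + 2 * l)) +
        (amp k l / profileDen k l s * (k + l)) * rate k l (-k + l) =
        -(s * √3) * (amp k l / profileDen k l s * (k + l) * (k - l + s * √(q k l)) *
          (s / √(q k l))) := by
      have e3 : -(s * √3) * (amp k l / profileDen k l s * (k + l) * (k - l + s * √(q k l)) *
          (s / √(q k l))) = s ^ 2 * (-√3 * (amp k l / profileDen k l s * (k + l) *
          (k - l + s * √(q k l)) * (1 / √(q k l)))) := by ring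
      rw [e3, hs]
      simp only [rate]
      field_simp
      ring
    have e' := congrArg (fun x : ℝ => (x : ℂ)) e
    push_cast at e' ⊢
    linear_combination Complex.I * e'
  · rw [triCurv, boundaryCurv]
    have e : (amp k l / profileDen k l s * (-k - s * √(q k l))) * rate k l (2 * k + l) ^ 2 +
        (amp k l / profileDen k l s * (-l + s * √(q k l))) * rate k l (-(k + 2 * l)) ^ 2 +
        (amp k l / profileDen k l s * (k + l)) * rate k l (-k + l) ^ 2 =
        -(amp k l / profileDen k l s * (k + l) * (k - l + s * √(q k l)) * (s / √(q k l))) := by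
      have e3 : amp k l / profileDen k l s * (k + l) * (k - l + s * √(q k l)) * (s / √(q k l)) =
          amp k l / profileDen k l s * (k + l) * (s * (k - l) + s ^ 2 * √(q k l)) *
          (1 / √(q k l)) := by ring
      rw [e3, hs]
      simp only [sq_rate hk]
      field_simp
      have hq' : q k l = (k : ℝ) ^ 2 + k * l + (l : ℝ) ^ 2 := rfl
      linear_combination -amp k l * ((3 * s * ((k : ℝ) - l) * (k + l)) * hss -
        3 * √(q k l) * (k + l) * hq')
    have e' := congrArg (fun x : ℝ => (x : ℂ)) e
    push_cast at e' ⊢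
    linear_combination -e'

lemma integral_profile_sq (hk : 0 < k) (hl : 0 < l) {s : ℝ} (hs : s ^ 2 = 1) :
    ∫ x in (0 : ℝ)..critLength k l, ‖profile k l s x‖ ^ 2 = 1 := by
  have hq := q_pos hk l
  have hss : √(q k l) ^ 2 = q k l := Real.sq_sqrt hq.le
  have hD2 := profileDen_pos hk hl hs
  have hD : profileDen k l s ^ 2 = 2 * q k l + s * (√(q k l) * (k - l)) :=
    Real.sq_sqrt hD2.le
  have hDp : 0 < profileDen k l s := Real.sqrt_pos.2 hD2
  rw [profile_eq_tri hk]
  have h := integral_tri_mul hk hl ((amp k l / profileDen k l s * (-k - s * √(q k l)) : ℝ) : ℂ)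
      ((amp k l / profileDen k l s * (-l + s * √(q k l)) : ℝ) : ℂ)
      ((amp k l / profileDen k l s * (k + l) : ℝ) : ℂ)
      ((amp k l / profileDen k l s * (-k - s * √(q k l)) : ℝ) : ℂ)
      ((amp k l / profileDen k l s * (-l + s * √(q k l)) : ℝ) : ℂ)
      ((amp k l / profileDen k l s * (k + l) : ℝ) : ℂ)
  simp only [mul_star_eq (tri k l _ _ _ _)] at h
  rw [intervalIntegral.integral_ofReal] at h
  simp only [Complex.star_def, Complex.conj_ofReal] at h
  have h' := congrArg Complex.re h
  rw [Complex.ofReal_re] at h'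
  rw [h']
  simp only [← Complex.ofReal_mul, ← Complex.ofReal_add, Complex.ofReal_re]
  have e : (-k - s * √(q k l)) ^ 2 + (-l + s * √(q k l)) ^ 2 + (k + l) ^ 2 =
      2 * profileDen k l s ^ 2 := by
    rw [hD]
    have hq' : q k l = (k : ℝ) ^ 2 + k * l + (l : ℝ) ^ 2 := rfl
    linear_combination 2 * √(q k l) ^ 2 * hs + 2 * hss - 2 * hq'
  calc _ = critLength k l * amp k l ^ 2 / profileDen k l s ^ 2 *
        ((-k - s * √(q k l)) ^ 2 + (-l + s * √(q k l)) ^ 2 + (k + l) ^ 2) := by ring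
    _ = 1 := by
      rw [e, critLength_mul_amp_sq hk]
      field_simp

lemma sqrt_two_add (hk : 0 < k) (l : ℕ) (s : ℝ) :
    profileDen k l s = √(q k l) * √(2 + s * (2 * Real.cos (angle k l))) := by
  have hq := q_pos hk l
  have hsq := Real.sqrt_pos.2 hq
  have hss : √(q k l) ^ 2 = q k l := Real.sq_sqrt hq.le
  rw [profileDen, ← Real.sqrt_mul hq.le, cos_angle hk, cosAngle]
  congr 1
  field_simp
  linear_combination s * (k - l) * hss

lemma half_angle_pos (hk : 0 < k) (l : ℕ) :
    0 < Real.cos (angle k l / 2) ∧ 0 < Real.sin (angle k l / 2) := by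
  have h := sin_angle_pos hk l
  have h0 : 0 ≤ angle k l := Real.arccos_nonneg _
  have hpi : angle k l ≤ Real.pi := Real.arccos_le_pi _
  have h1 : Real.sin (angle k l) = 2 * Real.sin (angle k l / 2) * Real.cos (angle k l / 2) := by
    rw [← Real.sin_two_mul]
    congr 1
    ring
  have hc : 0 ≤ Real.cos (angle k l / 2) :=
    Real.cos_nonneg_of_neg_pi_div_two_le_of_le (by linarith) (by linarith)
  have hs : 0 ≤ Real.sin (angle k l / 2) :=
    Real.sin_nonneg_of_nonneg_of_le_pi (by linarith) (by linarith)
  constructor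
  · refine lt_of_le_of_ne hc fun h' => ?_
    rw [h1, ← h'] at h
    simp at h
  · refine lt_of_le_of_ne hs fun h' => ?_
    rw [h1, ← h'] at h
    simp at h

/-- The profile in terms of the angle `θ`, where `2 cos θ = (k - l) / √q`. -/
lemma profile_eq_angle (hk : 0 < k) (l : ℕ) (s x : ℝ) : profile k l s x =
    (((1 / √(2 + s * (2 * Real.cos (angle k l))) : ℝ)) : ℂ) * (typeOne k l x
      - ((2 * Real.cos (angle k l) + s : ℝ) : ℂ) * typeTwo k l x) := by
  have hsq := Real.sqrt_pos.2 (q_pos hk l)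
  have hs' : (√(q k l) : ℂ) ≠ 0 := by exact_mod_cast hsq.ne'
  have e : (k - l + s * √(q k l)) = √(q k l) * (2 * Real.cos (angle k l) + s) := by
    rw [cos_angle hk, cosAngle]
    field_simp
  have e2 : (1 / profileDen k l s : ℝ) = 1 / √(q k l) *
      (1 / √(2 + s * (2 * Real.cos (angle k l)))) := by
    rw [sqrt_two_add hk]
    field_simp
  rw [profile_eq hk, e, e2]
  generalize √(2 + s * (2 * Real.cos (angle k l))) = D
  push_cast
  field_simp

lemma profile_one (hk : 0 < k) (l : ℕ) (x : ℝ) : profile k l 1 x =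
    -((Real.cos (3 * angle k l / 2) : ℝ) : ℂ) * typeOne k l x
      - ((Real.sin (3 * angle k l / 2) : ℝ) : ℂ) * typeTwoOrth k l x := by
  obtain ⟨hc, hs⟩ := half_angle_pos hk l
  rw [profile_eq_angle hk, typeTwoOrth_eq hk]
  set φ := angle k l / 2 with hφ
  have h1 : angle k l = 2 * φ := by rw [hφ]; ring
  have h3 : 3 * angle k l / 2 = 3 * φ := by rw [hφ]; ring
  have hsq : Real.sin φ ^ 2 = 1 - Real.cos φ ^ 2 := Real.sin_sq φ
  have hd : √(2 + 1 * (2 * Real.cos (2 * φ))) = 2 * Real.cos φ := by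
    rw [Real.cos_two_mul, show 2 + 1 * (2 * (2 * Real.cos φ ^ 2 - 1)) = (2 * Real.cos φ) ^ 2 by
      ring, Real.sqrt_sq (by positivity)]
  rw [h3, h1, hd]
  have eA : 1 / (2 * Real.cos φ) = -Real.cos (3 * φ) +
      Real.sin (3 * φ) * (1 / Real.sin (2 * φ)) * Real.cos (2 * φ) := by
    rw [Real.cos_three_mul, Real.sin_three_mul, Real.sin_two_mul, Real.cos_two_mul]
    field_simp
    rw [hsq]
    ring
  have eB : 1 / (2 * Real.cos φ) * (2 * Real.cos (2 * φ) + 1) =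
      Real.sin (3 * φ) * (1 / Real.sin (2 * φ)) := by
    rw [Real.sin_three_mul, Real.sin_two_mul, Real.cos_two_mul]
    field_simp
    rw [hsq]
    ring
  have eA' := congrArg (fun x : ℝ => (x : ℂ)) eA
  have eB' := congrArg (fun x : ℝ => (x : ℂ)) eB
  simp only [Complex.ofReal_mul, Complex.ofReal_add, Complex.ofReal_neg, Complex.ofReal_div,
    Complex.ofReal_one, Complex.ofReal_ofNat] at eA' eB' ⊢
  linear_combination typeOne k l x * eA' - typeTwo k l x * eB'

lemma profile_neg_one (hk : 0 < k) (l : ℕ) (x : ℝ) : profile k l (-1) x =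
    ((Real.sin (3 * angle k l / 2) : ℝ) : ℂ) * typeOne k l x
      - ((Real.cos (3 * angle k l / 2) : ℝ) : ℂ) * typeTwoOrth k l x := by
  obtain ⟨hc, hs⟩ := half_angle_pos hk l
  rw [profile_eq_angle hk, typeTwoOrth_eq hk]
  set φ := angle k l / 2 with hφ
  have h1 : angle k l = 2 * φ := by rw [hφ]; ring
  have h3 : 3 * angle k l / 2 = 3 * φ := by rw [hφ]; ring
  have hcq : Real.cos φ ^ 2 = 1 - Real.sin φ ^ 2 := Real.cos_sq' φ
  have hd : √(2 + -1 * (2 * Real.cos (2 * φ))) = 2 * Real.sin φ := by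
    rw [Real.cos_two_mul, hcq, show 2 + -1 * (2 * (2 * (1 - Real.sin φ ^ 2) - 1)) =
      (2 * Real.sin φ) ^ 2 by ring, Real.sqrt_sq (by positivity)]
  rw [h3, h1, hd]
  have eA : 1 / (2 * Real.sin φ) = Real.sin (3 * φ) +
      Real.cos (3 * φ) * (1 / Real.sin (2 * φ)) * Real.cos (2 * φ) := by
    rw [Real.cos_three_mul, Real.sin_three_mul, Real.sin_two_mul, Real.cos_two_mul]
    field_simp
    rw [hcq]
    ring
  have eB : 1 / (2 * Real.sin φ) * (2 * Real.cos (2 * φ) + -1) =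
      Real.cos (3 * φ) * (1 / Real.sin (2 * φ)) := by
    rw [Real.cos_three_mul, Real.sin_two_mul, Real.cos_two_mul]
    field_simp
    ring
  have eA' := congrArg (fun x : ℝ => (x : ℂ)) eA
  have eB' := congrArg (fun x : ℝ => (x : ℂ)) eB
  simp only [Complex.ofReal_mul, Complex.ofReal_add, Complex.ofReal_neg, Complex.ofReal_div,
    Complex.ofReal_one, Complex.ofReal_ofNat] at eA' eB' ⊢
  linear_combination typeOne k l x * eA' - typeTwo k l x * eB'

/-! ### Isolation of the critical length -/

/-- Critical lengths are isolated, since `3 L² / (4 π²)` is an integer at each of them. -/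
lemma exists_isolated (hk : 0 < k) (hl : 0 < l) : ∃ δ₀ > 0, ∀ δ, 0 < δ → δ ≤ δ₀ →
    Icc (critLength k l - δ) (critLength k l + δ) ∩ criticalLengths = {critLength k l} := by
  have hL := critLength_pos hk l
  have hsq : ∀ k l : ℕ, 0 < k → 3 * critLength k l ^ 2 = 4 * Real.pi ^ 2 * q k l := by
    intro k l hk
    have h := q_pos hk l
    rw [critLength_eq, div_pow, mul_pow, Real.sq_sqrt h.le, Real.sq_sqrt (by norm_num)]
    ring
  refine ⟨1 / (2 * critLength k l + 1), by positivity, fun δ hδ hδ0 => ?_⟩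
  ext L
  simp only [mem_inter_iff, mem_singleton_iff, mem_Icc]
  constructor
  · rintro ⟨⟨h1, h2⟩, k', l', hk', hl', rfl⟩
    by_contra hne
    have hL' := critLength_pos hk' l'
    have hq : ((k' ^ 2 + k' * l' + l' ^ 2 : ℕ) : ℤ) ≠ ((k ^ 2 + k * l + l ^ 2 : ℕ) : ℤ) := by
      intro h
      apply hne
      have : q k' l' = q k l := by
        unfold q
        exact_mod_cast h
      rw [critLength, critLength, this]
    have hq1 : (1 : ℝ) ≤ |q k' l' - q k l| := by
      have := Int.one_le_abs (sub_ne_zero.2 hq)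
      have h' : (1 : ℝ) ≤ ((|((k' ^ 2 + k' * l' + l' ^ 2 : ℕ) : ℤ) -
        ((k ^ 2 + k * l + l ^ 2 : ℕ) : ℤ)| : ℤ) : ℝ) := by exact_mod_cast this
      unfold q
      push_cast at h'
      exact h'
    have hpi := Real.pi_gt_three
    have h3 : 36 ≤ |3 * (critLength k' l' ^ 2 - critLength k l ^ 2)| := by
      have : 3 * (critLength k' l' ^ 2 - critLength k l ^ 2) =
          4 * Real.pi ^ 2 * (q k' l' - q k l) := by
        rw [mul_sub, hsq k' l' hk', hsq k l hk]
        ring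
      rw [this, abs_mul, abs_of_pos (by positivity)]
      nlinarith
    have hδ1 : δ * (2 * critLength k l + 1) ≤ 1 := by
      rw [le_div_iff₀ (by positivity)] at hδ0
      exact hδ0
    have hd1 : δ ≤ 1 := by nlinarith
    have h4 : |critLength k' l' - critLength k l| ≤ δ := abs_le.2 ⟨by linarith, by linarith⟩
    have h5 : |3 * (critLength k' l' ^ 2 - critLength k l ^ 2)| ≤
        3 * (δ * (2 * critLength k l + 1)) := by
      rw [sq_sub_sq, abs_mul, abs_mul, abs_of_pos (by norm_num : (0 : ℝ) < 3),
        abs_of_pos (by positivity : 0 < critLength k' l' + critLength k l)]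
      have := mul_le_mul h4 (by linarith : critLength k' l' + critLength k l ≤
        2 * critLength k l + 1) (by positivity) hδ.le
      linarith
    linarith
  · rintro rfl
    exact ⟨⟨by linarith, by linarith⟩, k, l, hk, hl, rfl⟩

end

/-! ### Dependence on the length and on the spectral parameter -/

lemma exists_fund_sub_le (n : ℕ) (R : ℝ) : ∃ B, 0 < B ∧ ∀ z : ℂ, ‖z‖ ≤ R → ∀ x y : ℝ,
    |x| ≤ R → |y| ≤ R → ‖fund n z x - fund n z y‖ ≤ B * |x - y| := by
  obtain ⟨B, hB0, hB⟩ := exists_norm_fund_le (n + 1) R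
  refine ⟨B, hB0, fun z hz x y hx hy => ?_⟩
  exact (convex_Icc (-R) R).norm_image_sub_le_of_norm_hasDerivWithin_le
    (fun s _ => (hasDerivAt_fund n z s).hasDerivWithinAt)
    (fun s hs => hB z hz s (abs_le.2 hs)) (abs_le.1 hy) (abs_le.1 hx)

lemma exists_fund_taylor (n : ℕ) (R : ℝ) : ∃ B, 0 < B ∧ ∀ z : ℂ, ‖z‖ ≤ R → ∀ x y : ℝ,
    |x| ≤ R → |y| ≤ R →
    ‖fund n z x - fund n z y - ((x - y : ℝ) : ℂ) * fund (n + 1) z y‖ ≤ B * |x - y| ^ 2 := by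
  obtain ⟨B, hB0, hB⟩ := exists_fund_sub_le (n + 1) R
  refine ⟨B, hB0, fun z hz x y hx hy => ?_⟩
  have hd : ∀ s : ℝ, HasDerivAt (fun s : ℝ => fund n z s - (s : ℂ) * fund (n + 1) z y)
      (fund (n + 1) z s - fund (n + 1) z y) s := by
    intro s
    have h1 : HasDerivAt (fun s : ℝ => (s : ℂ)) 1 s := by
      simpa using (hasDerivAt_id s).ofReal_comp
    exact ((hasDerivAt_fund n z s).sub (h1.mul_const (fund (n + 1) z y))).congr_deriv
      (by rw [one_mul])
  have hb : ∀ s ∈ uIcc y x, ‖fund (n + 1) z s - fund (n + 1) z y‖ ≤ B * |x - y| := by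
    intro s hs
    have hsR : |s| ≤ R := by
      rw [abs_le] at hx hy ⊢
      rcases mem_uIcc.1 hs with h | h <;> constructor <;> linarith
    refine (hB z hz s y hsR hy).trans (mul_le_mul_of_nonneg_left ?_ hB0.le)
    exact abs_sub_left_of_mem_uIcc hs
  have := (convex_uIcc y x).norm_image_sub_le_of_norm_hasDerivWithin_le
    (fun s _ => (hd s).hasDerivWithinAt) hb left_mem_uIcc right_mem_uIcc
  calc _ = ‖fund n z x - (x : ℂ) * fund (n + 1) z y -
        (fund n z y - (y : ℂ) * fund (n + 1) z y)‖ := by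
        congr 1
        push_cast
        ring
    _ ≤ _ := this
    _ = _ := by
      rw [Real.norm_eq_abs]
      ring

lemma exists_fund_lipschitz {n : ℕ} (hn : n < 3) {R : ℝ} (hR : 0 ≤ R) :
    ∃ B, 0 < B ∧ ∀ z z₀ : ℂ, ‖z‖ ≤ R → ‖z₀‖ ≤ R → ∀ s : ℝ, 0 ≤ s → s ≤ R →
      ‖fund n z s - fund n z₀ s‖ ≤ B * ‖z - z₀‖ := by
  obtain ⟨B₀, hB₀, h0⟩ := exists_norm_fund_le 0 R
  obtain ⟨B₁, hB₁, h1⟩ := exists_norm_fund_le n R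
  refine ⟨B₀ * B₁ * R + 1, by positivity, fun z z₀ hz hz₀ s hs hsR => ?_⟩
  rw [fund_sub_fund hn z z₀ hs, norm_neg, norm_mul, mul_comm]
  refine mul_le_mul_of_nonneg_right ?_ (norm_nonneg _)
  have := intervalIntegral.norm_integral_le_of_norm_le_const (a := 0) (b := s) (C := B₀ * B₁)
    (f := fun t => fund 0 z t * fund n z₀ (s - t)) (fun t ht => by
      rw [uIoc_of_le hs] at ht
      rw [norm_mul]
      exact mul_le_mul (h0 z hz t (abs_le.2 ⟨by linarith [ht.1], by linarith [ht.2]⟩))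
        (h1 z₀ hz₀ _ (abs_le.2 ⟨by linarith [ht.2], by linarith [ht.1]⟩))
        (norm_nonneg _) hB₀.le)
  rw [sub_zero, abs_of_nonneg hs] at this
  have h2 : B₀ * B₁ * s ≤ B₀ * B₁ * R := mul_le_mul_of_nonneg_left hsR (by positivity)
  linarith

lemma exists_fund_lipschitz_three {R : ℝ} (hR : 0 ≤ R) :
    ∃ B, 0 < B ∧ ∀ z z₀ : ℂ, ‖z‖ ≤ R → ‖z₀‖ ≤ R → ∀ s : ℝ, 0 ≤ s → s ≤ R →
      ‖fund 3 z s - fund 3 z₀ s‖ ≤ B * ‖z - z₀‖ := by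
  obtain ⟨B₀, hB₀, h0⟩ := exists_norm_fund_le 0 R
  obtain ⟨B₁, hB₁, h1⟩ := exists_fund_lipschitz (n := 0) (by norm_num) hR
  obtain ⟨B₂, hB₂, h2⟩ := exists_fund_lipschitz (n := 1) (by norm_num) hR
  refine ⟨B₂ + R * B₁ + B₀, by positivity, fun z z₀ hz hz₀ s hs hsR => ?_⟩
  have e : fund 3 z s - fund 3 z₀ s = -(fund 1 z s - fund 1 z₀ s)
      - z * (fund 0 z s - fund 0 z₀ s) - (z - z₀) * fund 0 z₀ s := by
    rw [fund_three, fund_three]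
    ring
  rw [e]
  refine (norm_sub_le _ _).trans ((add_le_add (norm_sub_le _ _) le_rfl).trans ?_)
  rw [norm_neg, norm_mul, norm_mul]
  have a1 := h1 z z₀ hz hz₀ s hs hsR
  have a2 := h2 z z₀ hz hz₀ s hs hsR
  have a3 := h0 z₀ hz₀ s (abs_le.2 ⟨by linarith, hsR⟩)
  have a4 := mul_le_mul hz a1 (norm_nonneg _) hR
  have a5 := mul_le_mul_of_nonneg_left a3 (norm_nonneg (z - z₀))
  nlinarith

/-- First-order expansion, with quadratic remainder, of the fundamental solution and its
derivatives in the length and the spectral parameter. -/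
lemma exists_fund_expansion {n : ℕ} (hn : n < 3) {R : ℝ} (hR : 0 ≤ R) :
    ∃ B, 0 < B ∧ ∀ z z₀ : ℂ, ‖z‖ ≤ R → ‖z₀‖ ≤ R → ∀ L L₀ : ℝ, 0 ≤ L → L ≤ R → 0 ≤ L₀ →
      L₀ ≤ R → ‖fund n z L - (fund n z₀ L₀ + ((L - L₀ : ℝ) : ℂ) * fund (n + 1) z₀ L₀ -
        (z - z₀) * ∫ t in (0 : ℝ)..L₀, fund 0 z₀ t * fund n z₀ (L₀ - t))‖ ≤
        B * (|L - L₀| + ‖z - z₀‖) ^ 2 := by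
  obtain ⟨B₀, hB₀, h0⟩ := exists_fund_taylor n R
  obtain ⟨B₁, hB₁, h1⟩ : ∃ B, 0 < B ∧ ∀ z z₀ : ℂ, ‖z‖ ≤ R → ‖z₀‖ ≤ R → ∀ s : ℝ, 0 ≤ s →
      s ≤ R → ‖fund (n + 1) z s - fund (n + 1) z₀ s‖ ≤ B * ‖z - z₀‖ := by
    rcases Nat.lt_or_ge (n + 1) 3 with h | h
    · exact exists_fund_lipschitz h hR
    · obtain rfl : n = 2 := by omega
      exact exists_fund_lipschitz_three hR
  obtain ⟨B₂, hB₂, h2⟩ := exists_fund_lipschitz (n := 0) (by norm_num) hR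
  obtain ⟨B₃, hB₃, h3⟩ := exists_norm_fund_le n R
  refine ⟨B₀ + B₁ + B₂ * B₃ * R, by positivity, fun z z₀ hz hz₀ L L₀ hL hLR hL₀ hL₀R => ?_⟩
  have a1 := h0 z hz L L₀ (abs_le.2 ⟨by linarith, hLR⟩) (abs_le.2 ⟨by linarith, hL₀R⟩)
  have a2 := h1 z z₀ hz hz₀ L₀ hL₀ hL₀R
  have hint : ∀ w, IntervalIntegrable (fun t => fund 0 w t * fund n z₀ (L₀ - t)) volume 0 L₀ :=
    fun w => ((continuous_fund 0 w).mul ((continuous_fund n z₀).comp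
      (continuous_const.sub continuous_id))).intervalIntegrable _ _
  have a3 : ‖∫ t in (0 : ℝ)..L₀, (fund 0 z t - fund 0 z₀ t) * fund n z₀ (L₀ - t)‖ ≤
      B₂ * ‖z - z₀‖ * B₃ * L₀ := by
    have := intervalIntegral.norm_integral_le_of_norm_le_const (a := 0) (b := L₀)
      (C := B₂ * ‖z - z₀‖ * B₃)
      (f := fun t => (fund 0 z t - fund 0 z₀ t) * fund n z₀ (L₀ - t)) (fun t ht => by
        rw [uIoc_of_le hL₀] at ht
        rw [norm_mul]
        exact mul_le_mul (h2 z z₀ hz hz₀ t ht.1.le (by linarith [ht.2]))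
          (h3 z₀ hz₀ _ (abs_le.2 ⟨by linarith [ht.2], by linarith [ht.1]⟩))
          (norm_nonneg _) (by positivity))
    rwa [sub_zero, abs_of_nonneg hL₀] at this
  have e4 : ∫ t in (0 : ℝ)..L₀, (fund 0 z t - fund 0 z₀ t) * fund n z₀ (L₀ - t) =
      (∫ t in (0 : ℝ)..L₀, fund 0 z t * fund n z₀ (L₀ - t)) -
        ∫ t in (0 : ℝ)..L₀, fund 0 z₀ t * fund n z₀ (L₀ - t) := by
    rw [← intervalIntegral.integral_sub (hint z) (hint z₀)]
    congr 1
    funext t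
    ring
  have e5 := fund_sub_fund hn z z₀ hL₀
  have e : fund n z L - (fund n z₀ L₀ + ((L - L₀ : ℝ) : ℂ) * fund (n + 1) z₀ L₀ -
        (z - z₀) * ∫ t in (0 : ℝ)..L₀, fund 0 z₀ t * fund n z₀ (L₀ - t)) =
      (fund n z L - fund n z L₀ - ((L - L₀ : ℝ) : ℂ) * fund (n + 1) z L₀) +
      ((L - L₀ : ℝ) : ℂ) * (fund (n + 1) z L₀ - fund (n + 1) z₀ L₀) -
      (z - z₀) * ∫ t in (0 : ℝ)..L₀, (fund 0 z t - fund 0 z₀ t) * fund n z₀ (L₀ - t) := by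
    rw [e4]
    linear_combination e5
  rw [e]
  refine (norm_sub_le _ _).trans ((add_le_add (norm_add_le _ _) le_rfl).trans ?_)
  rw [norm_mul, norm_mul, Complex.norm_real, Real.norm_eq_abs]
  have b1 := mul_le_mul_of_nonneg_left a2 (abs_nonneg (L - L₀))
  have b2 := mul_le_mul_of_nonneg_left a3 (norm_nonneg (z - z₀))
  have b3 : B₂ * B₃ * L₀ * ‖z - z₀‖ ^ 2 ≤ B₂ * B₃ * R * ‖z - z₀‖ ^ 2 := by gcongr
  have hx := abs_nonneg (L - L₀)
  have hy := norm_nonneg (z - z₀)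
  generalize |L - L₀| = X at *
  generalize ‖z - z₀‖ = Y at *
  have c1 : B₀ * X ^ 2 ≤ B₀ * (X + Y) ^ 2 := by gcongr; linarith
  have c2 : B₁ * (X * Y) ≤ B₁ * (X + Y) ^ 2 := by gcongr; nlinarith
  have c3 : B₂ * B₃ * R * Y ^ 2 ≤ B₂ * B₃ * R * (X + Y) ^ 2 := by gcongr; linarith
  linarith

lemma continuous_sol_uncurry (n : ℕ) :
    Continuous fun p : (ℂ × ℂ × ℂ) × ℝ => sol p.1.1 p.1.2.1 p.1.2.2 n p.2 := by
  have h : ∀ m, Continuous fun p : (ℂ × ℂ × ℂ) × ℝ => fund m p.1.2.2 p.2 := fun m =>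
    (continuous_fund_uncurry m).comp
      ((continuous_snd.comp (continuous_snd.comp continuous_fst)).prodMk continuous_snd)
  unfold sol
  exact ((continuous_fst.comp continuous_fst).mul (h _)).add
    ((continuous_fst.comp (continuous_snd.comp continuous_fst)).mul (h _))

/-! ### Lipschitz dependence of the eigenvalues on the length -/

lemma IsEigenData.exists_norm_one {L : ℝ} {z a b : ℂ} (h : IsEigenData L z a b) :
    ∃ p : ℂ × ℂ, ‖p‖ = 1 ∧ IsEigenData L z p.1 p.2 := by
  have hne : ((a, b) : ℂ × ℂ) ≠ 0 := by
    intro h0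
    rcases h.ne with h1 | h1
    · exact h1 (congrArg Prod.fst h0)
    · exact h1 (congrArg Prod.snd h0)
  have hN : (0 : ℝ) < ‖((a, b) : ℂ × ℂ)‖ := norm_pos_iff.2 hne
  set N : ℂ := ((‖((a, b) : ℂ × ℂ)‖⁻¹ : ℝ) : ℂ) with hNdef
  have hN0 : N ≠ 0 := by
    rw [hNdef, Complex.ofReal_ne_zero]
    positivity
  refine ⟨N • (a, b), ?_, ?_, ?_, ?_⟩
  · rw [norm_smul, hNdef, Complex.norm_real, norm_inv, norm_norm, inv_mul_cancel₀ hN.ne']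
  · rcases h.ne with h1 | h1
    · exact Or.inl (mul_ne_zero hN0 h1)
    · exact Or.inr (mul_ne_zero hN0 h1)
  · have := h.right
    simp only [sol, Prod.smul_fst, Prod.smul_snd, smul_eq_mul] at this ⊢
    linear_combination N * this
  · have := h.slope
    simp only [sol, Prod.smul_fst, Prod.smul_snd, smul_eq_mul] at this ⊢
    linear_combination N * this

/-- The shift of an eigenvalue, weighted by the overlap with an eigenfunction at `L₀`, is at most
linear in `L - L₀`: by Green's formula on `(0, L₀)` it is a boundary term. -/
lemma IsEigenData.exists_shift_le {L₀ μ' : ℝ} {a' b' : ℂ} (hL₀ : 0 < L₀)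
    (hd' : IsEigenData L₀ (Complex.I * μ') a' b') (M : ℝ) :
    ∃ D, 0 ≤ D ∧ ∀ (L μ : ℝ) (p : ℂ × ℂ), |L - L₀| ≤ L₀ / 2 → |μ| ≤ M → ‖p‖ = 1 →
      IsEigenData L (Complex.I * μ) p.1 p.2 →
      |μ - μ'| * ‖∫ x in (0 : ℝ)..L₀, sol p.1 p.2 (Complex.I * μ) 0 x *
        star (sol a' b' (Complex.I * μ') 0 x)‖ ≤ D * |L - L₀| := by
  set R : ℝ := max (2 * L₀) M with hR
  obtain ⟨B₀, hB₀, hf0⟩ := exists_fund_sub_le 0 R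
  obtain ⟨B₁, hB₁, hf1⟩ := exists_fund_sub_le 1 R
  obtain ⟨B₂, hB₂, hf2⟩ := exists_fund_sub_le 2 R
  refine ⟨(B₁ + B₀) * ‖sol a' b' (Complex.I * μ') 2 L₀‖ + (B₂ + B₁) * ‖a'‖, by positivity,
    fun L μ p hL1 hμ hp hd => ?_⟩
  have hg := green_identity p.1 p.2 a' b' (Complex.I * μ) (Complex.I * μ') L₀
  rw [hd'.right, hd'.slope] at hg
  have hr := hd.right
  have hs := hd.slope
  have hz : ‖Complex.I * (μ : ℂ)‖ ≤ R := by
    rw [norm_mul, Complex.norm_I, one_mul, Complex.norm_real]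
    exact hμ.trans (le_max_right _ _)
  have hLL := abs_le.1 (hL1)
  have hLR : |L| ≤ R := (abs_le.2 ⟨by linarith, by linarith⟩ : |L| ≤ 2 * L₀).trans
    (le_max_left _ _)
  have hL0R : |L₀| ≤ R := (abs_le.2 ⟨by linarith, by linarith⟩ : |L₀| ≤ 2 * L₀).trans
    (le_max_left _ _)
  have hp1 : ‖p.1‖ ≤ 1 := (norm_fst_le _).trans (hp).le
  have hp2 : ‖p.2‖ ≤ 1 := (norm_snd_le _).trans (hp).le
  have hdiff : ∀ m B B', (∀ z : ℂ, ‖z‖ ≤ R → ∀ x y : ℝ, |x| ≤ R → |y| ≤ R →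
      ‖fund (m + 1) z x - fund (m + 1) z y‖ ≤ B * |x - y|) →
      (∀ z : ℂ, ‖z‖ ≤ R → ∀ x y : ℝ, |x| ≤ R → |y| ≤ R →
      ‖fund m z x - fund m z y‖ ≤ B' * |x - y|) →
      ‖sol p.1 p.2 (Complex.I * μ) m (L) -
        sol p.1 p.2 (Complex.I * μ) m L₀‖ ≤ (B + B') * |L - L₀| := by
    intro m B B' h1 h2
    have e : sol p.1 p.2 (Complex.I * μ) m (L) -
        sol p.1 p.2 (Complex.I * μ) m L₀ =
        p.1 * (fund (m + 1) (Complex.I * μ) (L) - fund (m + 1) (Complex.I * μ) L₀) +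
        p.2 * (fund m (Complex.I * μ) (L) - fund m (Complex.I * μ) L₀) := by
      simp only [sol]
      ring
    rw [e]
    refine (norm_add_le _ _).trans ?_
    rw [norm_mul, norm_mul, add_mul]
    refine add_le_add ?_ ?_
    · exact (mul_le_of_le_one_left (norm_nonneg _) hp1).trans (h1 _ hz _ _ hLR hL0R)
    · exact (mul_le_of_le_one_left (norm_nonneg _) hp2).trans (h2 _ hz _ _ hLR hL0R)
  have d0 := hdiff 0 B₁ B₀ hf1 hf0
  have d1 := hdiff 1 B₂ B₁ hf2 hf1
  rw [hr] at d0
  rw [hs] at d1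
  set S := sol p.1 p.2 (Complex.I * μ) with hS
  have e : Complex.I * ((μ - μ' : ℝ) : ℂ) * ∫ x in (0 : ℝ)..L₀, sol p.1 p.2 (Complex.I * μ) 0 x *
        star (sol a' b' (Complex.I * μ') 0 x) =
      (0 - S 0 L₀) * star (sol a' b' (Complex.I * μ') 2 L₀) - (p.1 - S 1 L₀) * star a' := by
    have hst : star (Complex.I * (μ' : ℂ)) = -(Complex.I * μ') := by simp
    rw [hst] at hg
    simp only [star_zero, mul_zero] at hg
    push_cast
    linear_combination -hg
  have h4 := congrArg norm e
  rw [norm_mul, norm_mul, Complex.norm_I, one_mul, Complex.norm_real, Real.norm_eq_abs] at h4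
  rw [h4]
  refine (norm_sub_le _ _).trans ?_
  rw [norm_mul, norm_mul, norm_star, norm_star]
  have c1 := mul_le_mul_of_nonneg_right d0 (norm_nonneg (sol a' b' (Complex.I * μ') 2 L₀))
  have c2 := mul_le_mul_of_nonneg_right d1 (norm_nonneg a')
  linarith

/-- Eigenvalues in a bounded set are Lipschitz in the length: along a sequence of eigenfunctions
converging to an eigenfunction `u` at `L₀`, pairing the equation with `u` bounds the shift of the
eigenvalue by boundary terms of size `|L - L₀|`. -/
lemma exists_eigenvalue_near {L₀ : ℝ} (hL₀ : 0 < L₀) (M : ℝ) : ∃ δ C, 0 < δ ∧ 0 < C ∧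
    ∀ L, |L - L₀| ≤ δ → ∀ μ : ℝ, |μ| ≤ M → IsEigenvalue L (Complex.I * μ) →
      ∃ μ₀ : ℝ, IsEigenvalue L₀ (Complex.I * μ₀) ∧ |μ - μ₀| ≤ C * |L - L₀| := by
  by_contra! hcon
  have hseq : ∀ n : ℕ, ∃ L μ : ℝ, ∃ p : ℂ × ℂ, |L - L₀| ≤ L₀ / 2 ∧ |L - L₀| ≤ 1 / ((n : ℝ) + 1) ∧
      |μ| ≤ M ∧ ‖p‖ = 1 ∧ IsEigenData L (Complex.I * μ) p.1 p.2 ∧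
      ∀ μ₀ : ℝ, IsEigenvalue L₀ (Complex.I * μ₀) → ((n : ℝ) + 1) * |L - L₀| < |μ - μ₀| := by
    intro n
    obtain ⟨L, hL, μ, hμ, he, hfar⟩ := hcon (min (L₀ / 2) (1 / ((n : ℝ) + 1))) ((n : ℝ) + 1)
      (by positivity) (by positivity)
    have h1 := hL.trans (min_le_left _ _)
    have hLpos : 0 < L := by
      have := abs_le.1 h1
      linarith
    obtain ⟨a, b, hd⟩ := (isEigenvalue_iff_exists_data hLpos).1 he
    obtain ⟨p, hp, hd'⟩ := hd.exists_norm_one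
    exact ⟨L, μ, p, h1, hL.trans (min_le_right _ _), hμ, hp, hd', hfar⟩
  choose L μ p hL1 hL2 hμ hp hd hfar using hseq
  have hcomp : IsCompact (Icc (-M) M ×ˢ Metric.sphere (0 : ℂ × ℂ) 1) :=
    isCompact_Icc.prod (isCompact_sphere _ _)
  obtain ⟨⟨μ', a', b'⟩, hmem, φ, hφ, hlim⟩ := hcomp.tendsto_subseq
    (x := fun n => (μ n, p n)) (fun n => ⟨abs_le.1 (hμ n), by simpa using hp n⟩)
  have hLlim : Filter.Tendsto (fun n => L (φ n)) Filter.atTop (nhds L₀) := by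
    have h0 : Filter.Tendsto L Filter.atTop (nhds L₀) := by
      rw [tendsto_iff_norm_sub_tendsto_zero]
      exact squeeze_zero (fun n => norm_nonneg _) hL2 tendsto_one_div_add_atTop_nhds_zero_nat
    exact h0.comp hφ.tendsto_atTop
  have hμlim : Filter.Tendsto (fun n => μ (φ n)) Filter.atTop (nhds μ') :=
    (continuous_fst.tendsto _).comp hlim
  have hplim : Filter.Tendsto (fun n => p (φ n)) Filter.atTop (nhds (a', b')) :=
    (continuous_snd.tendsto _).comp hlim
  have halim : Filter.Tendsto (fun n => (p (φ n)).1) Filter.atTop (nhds a') :=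
    (continuous_fst.tendsto _).comp hplim
  have hblim : Filter.Tendsto (fun n => (p (φ n)).2) Filter.atTop (nhds b') :=
    (continuous_snd.tendsto _).comp hplim
  have hzlim : Filter.Tendsto (fun n => Complex.I * (μ (φ n) : ℂ)) Filter.atTop
      (nhds (Complex.I * μ')) :=
    (Complex.continuous_ofReal.tendsto μ').comp hμlim |>.const_mul _
  have hparam := halim.prodMk_nhds (hblim.prodMk_nhds hzlim)
  have hsol : ∀ m, Filter.Tendsto
      (fun n => sol (p (φ n)).1 (p (φ n)).2 (Complex.I * μ (φ n)) m (L (φ n))) Filter.atTop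
      (nhds (sol a' b' (Complex.I * μ') m L₀)) := by
    intro m
    have h1 := ((continuous_sol_uncurry m).tendsto ((a', b', Complex.I * μ'), L₀)).comp
      (hparam.prodMk_nhds hLlim)
    simpa only [Function.comp_def] using h1
  -- the limit is an eigenfunction at `L₀`
  have hne : a' ≠ 0 ∨ b' ≠ 0 := by
    by_contra! h
    have h1 := hmem.2
    rw [h.1, h.2] at h1
    simp at h1
  have hright : sol a' b' (Complex.I * μ') 0 L₀ = 0 := tendsto_nhds_unique (hsol 0)
    (tendsto_const_nhds.congr fun n => (hd (φ n)).right.symm)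
  have hslope : sol a' b' (Complex.I * μ') 1 L₀ = a' := tendsto_nhds_unique (hsol 1)
    (halim.congr fun n => (hd (φ n)).slope.symm)
  have hd' : IsEigenData L₀ (Complex.I * μ') a' b' := IsEigenData.mk hne hright hslope
  have hev : IsEigenvalue L₀ (Complex.I * μ') := (isEigenvalue_iff_exists_data hL₀).2 ⟨_, _, hd'⟩
  have hpos := hd'.integral_pos hL₀
  -- the overlaps with the limit converge to its norm, so they stay away from `0`
  set J : ℂ × ℂ × ℂ → ℂ := fun r =>
    ∫ x in (0 : ℝ)..L₀, sol r.1 r.2.1 r.2.2 0 x * star (sol a' b' (Complex.I * μ') 0 x) with hJ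
  have hJc : Continuous J := by
    apply intervalIntegral.continuous_parametric_intervalIntegral_of_continuous'
    exact (continuous_sol_uncurry 0).mul ((continuous_sol _ _ _ 0).comp continuous_snd).star
  set J₀ : ℝ := ∫ x in (0 : ℝ)..L₀, ‖sol a' b' (Complex.I * μ') 0 x‖ ^ 2 with hJ₀
  have hJlim : Filter.Tendsto
      (fun n => ‖J ((p (φ n)).1, (p (φ n)).2, Complex.I * μ (φ n))‖) Filter.atTop (nhds J₀) := by
    have h1 := ((hJc.tendsto (a', b', Complex.I * μ')).comp hparam).norm
    have h2 : ‖J (a', b', Complex.I * μ')‖ = J₀ := by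
      simp only [hJ, mul_star_eq]
      rw [intervalIntegral.integral_ofReal, Complex.norm_real, Real.norm_eq_abs, abs_of_pos hpos]
    rw [h2] at h1
    exact h1
  obtain ⟨D, hD0, hD⟩ := hd'.exists_shift_le hL₀ M
  have hshift : ∀ n, |μ n - μ'| * ‖J ((p n).1, (p n).2, Complex.I * μ n)‖ ≤ D * |L n - L₀| :=
    fun n => hD (L n) (μ n) (p n) (hL1 n) (hμ n) (hp n) (hd n)
  have hev1 := hJlim.eventually (lt_mem_nhds (half_lt_self hpos))
  have hev2 := (tendsto_natCast_atTop_atTop (R := ℝ)).eventually_ge_atTop (2 * D / J₀)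
  obtain ⟨n, hn1, hn2⟩ := (hev1.and (hφ.tendsto_atTop.eventually hev2)).exists
  have h1 := hshift (φ n)
  have h2 := hfar (φ n) μ' hev
  have h3 : |μ (φ n) - μ'| * (J₀ / 2) ≤ D * |L (φ n) - L₀| :=
    (mul_le_mul_of_nonneg_left hn1.le (abs_nonneg _)).trans h1
  rw [div_le_iff₀ hpos] at hn2
  have h5 := mul_lt_mul_of_pos_right h2 (half_pos hpos)
  have h6 := mul_le_mul_of_nonneg_right hn2 (abs_nonneg (L (φ n) - L₀))
  have h7 := mul_nonneg hpos.le (abs_nonneg (L (φ n) - L₀))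
  linarith

/-! ### Eigenfunctions close to a limiting profile -/

/-- The parameter and the initial data `(z, a, b)` are within `ε` of `(z₀, a₀, b₀)`. -/
structure NearData (ε : ℝ) (z₀ a₀ b₀ z a b : ℂ) : Prop where
  z : ‖z - z₀‖ ≤ ε
  a : ‖a - a₀‖ ≤ ε
  b : ‖b - b₀‖ ≤ ε

/-- Solutions with nearby data are uniformly close. -/
lemma exists_norm_sol_sub_le {X : ℝ} (hX : 0 < X) (z₀ a₀ b₀ : ℂ) : ∃ D P, 0 < D ∧ 0 < P ∧
    (∀ x ∈ Icc 0 X, ‖sol a₀ b₀ z₀ 0 x‖ ≤ P) ∧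
    ∀ ε ≤ 1, ∀ z a b, NearData ε z₀ a₀ b₀ z a b → ∀ x ∈ Icc 0 X,
      ‖sol a b z 0 x - sol a₀ b₀ z₀ 0 x‖ ≤ D * ε := by
  set R := max X (‖z₀‖ + 1) with hR
  have hR0 : 0 ≤ R := hX.le.trans (le_max_left _ _)
  obtain ⟨B₀, hB₀, h0⟩ := exists_norm_fund_le 0 R
  obtain ⟨B₁, hB₁, h1⟩ := exists_norm_fund_le 1 R
  obtain ⟨C₀, hC₀, l0⟩ := exists_fund_lipschitz (n := 0) (by norm_num) hR0
  obtain ⟨C₁, hC₁, l1⟩ := exists_fund_lipschitz (n := 1) (by norm_num) hR0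
  have hz₀ : ‖z₀‖ ≤ R := by
    have := le_max_right X (‖z₀‖ + 1)
    linarith
  refine ⟨B₁ + B₀ + ‖a₀‖ * C₁ + ‖b₀‖ * C₀, ‖a₀‖ * B₁ + ‖b₀‖ * B₀ + 1, by positivity,
    by positivity, fun x hx => ?_, fun ε hε z a b hn x hx => ?_⟩
  · have hxR : |x| ≤ R := abs_le.2 ⟨by linarith [hx.1], hx.2.trans (le_max_left _ _)⟩
    refine (norm_add_le _ _).trans ?_
    rw [norm_mul, norm_mul]
    have c1 := mul_le_mul_of_nonneg_left (h1 z₀ hz₀ x hxR) (norm_nonneg a₀)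
    have c0 := mul_le_mul_of_nonneg_left (h0 z₀ hz₀ x hxR) (norm_nonneg b₀)
    simp only [zero_add] at *
    linarith
  · have hxR' : x ≤ R := hx.2.trans (le_max_left _ _)
    have hxR : |x| ≤ R := abs_le.2 ⟨by linarith [hx.1], hxR'⟩
    have hz : ‖z‖ ≤ R := by
      have h2 := norm_le_norm_add_norm_sub' z z₀
      have h3 := le_max_right X (‖z₀‖ + 1)
      have := hn.z
      linarith
    have e : sol a b z 0 x - sol a₀ b₀ z₀ 0 x = (a - a₀) * fund 1 z x + (b - b₀) * fund 0 z x +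
        a₀ * (fund 1 z x - fund 1 z₀ x) + b₀ * (fund 0 z x - fund 0 z₀ x) := by
      simp only [sol]
      ring
    rw [e]
    refine (norm_add_le _ _).trans ((add_le_add ((norm_add_le _ _).trans
      (add_le_add (norm_add_le _ _) le_rfl)) le_rfl).trans ?_)
    rw [norm_mul, norm_mul, norm_mul, norm_mul]
    have hε0 : 0 ≤ ε := (norm_nonneg _).trans hn.z
    have c1 := mul_le_mul hn.a (h1 z hz x hxR) (norm_nonneg _) hε0
    have c2 := mul_le_mul hn.b (h0 z hz x hxR) (norm_nonneg _) hε0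
    have c3 := mul_le_mul_of_nonneg_left ((l1 z z₀ hz hz₀ x hx.1 hxR').trans
      (mul_le_mul_of_nonneg_left hn.z hC₁.le)) (norm_nonneg a₀)
    have c4 := mul_le_mul_of_nonneg_left ((l0 z z₀ hz hz₀ x hx.1 hxR').trans
      (mul_le_mul_of_nonneg_left hn.z hC₀.le)) (norm_nonneg b₀)
    linarith

/-- The overlap of two solutions with data close to those of a normalized profile is almost `1`. -/
lemma exists_overlap_le {L₀ : ℝ} (hL₀ : 0 < L₀) {z₀ a₀ b₀ : ℂ}
    (hP : ∫ x in (0 : ℝ)..L₀, ‖sol a₀ b₀ z₀ 0 x‖ ^ 2 = 1) {K : ℝ} (hK : 0 < K) :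
    ∃ D δ, 0 < D ∧ 0 < δ ∧ ∀ L, |L - L₀| ≤ δ → ∀ z a b z' a' b',
      NearData (K * |L - L₀|) z₀ a₀ b₀ z a b → NearData (K * |L - L₀|) z₀ a₀ b₀ z' a' b' →
      ‖(∫ x in (0 : ℝ)..L, sol a b z 0 x * star (sol a' b' z' 0 x)) - 1‖ ≤ D * |L - L₀| := by
  obtain ⟨D, P, hD, hP0, hPb, hclose⟩ :=
    exists_norm_sol_sub_le (by positivity : 0 < 2 * L₀) z₀ a₀ b₀
  refine ⟨(D * K * (P + D) + P * (D * K)) * (2 * L₀) + P ^ 2, min L₀ (1 / K), by positivity,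
    by positivity, fun L hL z a b z' a' b' hn hn' => ?_⟩
  have hL1 := abs_le.1 (hL.trans (min_le_left _ _))
  have hKt : K * |L - L₀| ≤ 1 := by
    have := (le_div_iff₀ hK).1 (hL.trans (min_le_right _ _))
    linarith
  have hL0 : 0 ≤ L := by linarith
  have hsub : ∀ x, 0 ≤ x → x ≤ L → x ∈ Icc 0 (2 * L₀) := fun x h0 h1 => ⟨h0, by linarith⟩
  set t := |L - L₀| with ht
  have ht0 : 0 ≤ t := abs_nonneg _
  have hi : ∀ (a b z a' b' z' : ℂ) (u v : ℝ), IntervalIntegrable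
      (fun x => sol a b z 0 x * star (sol a' b' z' 0 x)) volume u v := fun a b z a' b' z' u v =>
    ((continuous_sol a b z 0).mul (continuous_sol a' b' z' 0).star).intervalIntegrable _ _
  have h1 : ‖(∫ x in (0 : ℝ)..L, sol a b z 0 x * star (sol a' b' z' 0 x)) -
      ∫ x in (0 : ℝ)..L, sol a₀ b₀ z₀ 0 x * star (sol a₀ b₀ z₀ 0 x)‖ ≤
      (D * (K * t) * (P + D) + P * (D * (K * t))) * L := by
    rw [← intervalIntegral.integral_sub (hi ..) (hi ..)]
    have := intervalIntegral.norm_integral_le_of_norm_le_const (a := 0) (b := L)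
      (C := D * (K * t) * (P + D) + P * (D * (K * t)))
      (f := fun x => sol a b z 0 x * star (sol a' b' z' 0 x) -
        sol a₀ b₀ z₀ 0 x * star (sol a₀ b₀ z₀ 0 x)) (fun x hx => by
        rw [uIoc_of_le hL0] at hx
        have hxI := hsub x hx.1.le hx.2
        have e : sol a b z 0 x * star (sol a' b' z' 0 x) -
            sol a₀ b₀ z₀ 0 x * star (sol a₀ b₀ z₀ 0 x) =
            (sol a b z 0 x - sol a₀ b₀ z₀ 0 x) * star (sol a' b' z' 0 x) +
            sol a₀ b₀ z₀ 0 x * star (sol a' b' z' 0 x - sol a₀ b₀ z₀ 0 x) := by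
          rw [star_sub]
          ring
        rw [e]
        refine (norm_add_le _ _).trans ?_
        rw [norm_mul, norm_mul, norm_star, norm_star]
        have c1 := hclose _ hKt z a b hn x hxI
        have c2 := hclose _ hKt z' a' b' hn' x hxI
        have c3 := hPb x hxI
        have c4 : ‖sol a' b' z' 0 x‖ ≤ P + D := by
          have := norm_le_norm_add_norm_sub' (sol a' b' z' 0 x) (sol a₀ b₀ z₀ 0 x)
          have := mul_le_mul_of_nonneg_left hKt hD.le
          linarith
        gcongr)
    rwa [sub_zero, abs_of_nonneg hL0] at this
  have h2 : ‖(∫ x in (0 : ℝ)..L, sol a₀ b₀ z₀ 0 x * star (sol a₀ b₀ z₀ 0 x)) - 1‖ ≤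
      P ^ 2 * t := by
    have e1 : ∫ x in (0 : ℝ)..L₀, sol a₀ b₀ z₀ 0 x * star (sol a₀ b₀ z₀ 0 x) = 1 := by
      simp only [mul_star_eq]
      rw [intervalIntegral.integral_ofReal, hP, Complex.ofReal_one]
    rw [← e1, intervalIntegral.integral_interval_sub_left (hi ..) (hi ..)]
    refine intervalIntegral.norm_integral_le_of_norm_le_const fun x hx => ?_
    have hxI : x ∈ Icc 0 (2 * L₀) := by
      have := uIoc_subset_uIcc hx
      rcases mem_uIcc.1 this with h | h <;> constructor <;> linarith
    rw [norm_mul, norm_star, ← pow_two]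
    have := hPb x hxI
    gcongr
  calc _ = ‖((∫ x in (0 : ℝ)..L, sol a b z 0 x * star (sol a' b' z' 0 x)) -
      ∫ x in (0 : ℝ)..L, sol a₀ b₀ z₀ 0 x * star (sol a₀ b₀ z₀ 0 x)) +
      ((∫ x in (0 : ℝ)..L, sol a₀ b₀ z₀ 0 x * star (sol a₀ b₀ z₀ 0 x)) - 1)‖ := by
        congr 1
        ring
    _ ≤ (D * (K * t) * (P + D) + P * (D * (K * t))) * L + P ^ 2 * t :=
      (norm_add_le _ _).trans (add_le_add h1 h2)
    _ ≤ (D * (K * t) * (P + D) + P * (D * (K * t))) * (2 * L₀) + P ^ 2 * t := by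
      gcongr
      linarith
    _ = _ := by ring

/-- Two eigenfunctions close to the same profile belong to the same eigenvalue, since
eigenfunctions for different eigenvalues are orthogonal. -/
lemma exists_unique_near {L₀ : ℝ} (hL₀ : 0 < L₀) {z₀ a₀ b₀ : ℂ}
    (hP : ∫ x in (0 : ℝ)..L₀, ‖sol a₀ b₀ z₀ 0 x‖ ^ 2 = 1) {K : ℝ} (hK : 0 < K) :
    ∃ δ, 0 < δ ∧ ∀ L, |L - L₀| ≤ δ → ∀ (μ μ' : ℝ) (a b a' b' : ℂ),
      NearData (K * |L - L₀|) z₀ a₀ b₀ (Complex.I * μ) a b →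
      NearData (K * |L - L₀|) z₀ a₀ b₀ (Complex.I * μ') a' b' →
      IsEigenData L (Complex.I * μ) a b → IsEigenData L (Complex.I * μ') a' b' → μ = μ' := by
  obtain ⟨D, δ, hD, hδ, h⟩ := exists_overlap_le hL₀ hP hK
  refine ⟨min δ (1 / (2 * D)), by positivity, fun L hL μ μ' a b a' b' hn hn' hd hd' => ?_⟩
  have h1 := h L (hL.trans (min_le_left _ _)) _ a b _ a' b' hn hn'
  have h2 : |L - L₀| * (2 * D) ≤ 1 := (le_div_iff₀ (by positivity)).1 (hL.trans (min_le_right _ _))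
  rcases mul_eq_zero.1 (hd.green hd') with h3 | h3
  · have h4 : star (Complex.I * (μ' : ℂ)) = -(Complex.I * μ') := by simp
    rw [h4, ← sub_eq_add_neg, ← mul_sub] at h3
    have := (mul_eq_zero.1 h3).resolve_left Complex.I_ne_zero
    exact_mod_cast sub_eq_zero.1 this
  · rw [h3] at h1
    norm_num at h1
    linarith

/-- The boundary conditions have a one-dimensional kernel unless `g'(L) = 0` and `g''(L) = 1`. -/
lemma IsEigenData.exists_eq_mul {L : ℝ} {z a b a' b' : ℂ} (h : IsEigenData L z a b)
    (h' : IsEigenData L z a' b') (hM : fund 1 z L ≠ 0 ∨ fund 2 z L ≠ 1) :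
    ∃ κ, a' = κ * a ∧ b' = κ * b := by
  have e1 := h.right
  have e2 := h.slope
  have e1' := h'.right
  have e2' := h'.slope
  simp only [sol] at e1 e2 e1' e2'
  have hd : a * b' - a' * b = 0 := by
    rcases hM with h0 | h0
    · refine (mul_eq_zero (a := fund 1 z L).1 ?_).resolve_left h0
      linear_combination b' * e1 - b * e1'
    · refine (mul_eq_zero (a := fund 2 z L - 1).1 ?_).resolve_left (sub_ne_zero.2 h0)
      linear_combination b' * e2 - b * e2'
  rcases h.ne with h0 | h0
  · refine ⟨a' / a, by field_simp, ?_⟩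
    field_simp
    linear_combination hd
  · refine ⟨b' / b, ?_, by field_simp⟩
    field_simp
    linear_combination -hd

/-- A normalized eigenfunction whose data are proportional to data close to those of a normalized
profile is close to the profile, up to a phase. -/
lemma exists_close_of_near {L₀ : ℝ} (hL₀ : 0 < L₀) {z₀ a₀ b₀ : ℂ}
    (hP : ∫ x in (0 : ℝ)..L₀, ‖sol a₀ b₀ z₀ 0 x‖ ^ 2 = 1) {K : ℝ} (hK : 0 < K) :
    ∃ C δ, 0 < C ∧ 0 < δ ∧ ∀ L, |L - L₀| ≤ δ → ∀ z a b,
      NearData (K * |L - L₀|) z₀ a₀ b₀ z a b → IsEigenData L z a b →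
      (fund 1 z L ≠ 0 ∨ fund 2 z L ≠ 1) → ∀ E, IsNormalizedEigenfunction L z E →
      ∃ κ w : ℂ, ‖w‖ = 1 ∧ 1 / 2 ≤ ‖κ‖ ∧ ‖κ‖ ≤ 2 ∧
        (∀ x ∈ Icc 0 L, ‖E x - w * sol a₀ b₀ z₀ 0 x‖ ≤ C * |L - L₀|) ∧
        derivWithin E (Icc 0 L) 0 = κ * a ∧ derivWithin E (Icc 0 L) L = κ * a ∧
        ‖κ * a - w * a₀‖ ≤ C * |L - L₀| := by
  obtain ⟨D, δ, hD, hδ, hov⟩ := exists_overlap_le hL₀ hP hK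
  obtain ⟨D', P, hD', hP0, hPb, hclose⟩ :=
    exists_norm_sol_sub_le (by positivity : 0 < 2 * L₀) z₀ a₀ b₀
  refine ⟨2 * (D' * K) + 2 * D * P + 2 * K + 2 * D * ‖a₀‖,
    min (min δ (1 / (2 * D))) (min (L₀ / 2) (1 / K)), by positivity, by positivity,
    fun L hL z a b hn hd hM E hE => ?_⟩
  have hLδ := hL.trans ((min_le_left _ _).trans (min_le_left _ _))
  have hLD : |L - L₀| * (2 * D) ≤ 1 := (le_div_iff₀ (by positivity)).1
    (hL.trans ((min_le_left _ _).trans (min_le_right _ _)))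
  have hLL := abs_le.1 (hL.trans ((min_le_right _ _).trans (min_le_left _ _)))
  have hLK : |L - L₀| * K ≤ 1 := (le_div_iff₀ hK).1
    (hL.trans ((min_le_right _ _).trans (min_le_right _ _)))
  have hLpos : 0 < L := by linarith
  obtain ⟨a', b', hd', hE0, hE1, hE2⟩ := hE.toIsEigenfunction.exists_data hLpos
  obtain ⟨κ, rfl, rfl⟩ := hd.exists_eq_mul hd' hM
  set t := |L - L₀| with ht
  have ht0 : 0 ≤ t := abs_nonneg _
  have hEs : ∀ x ∈ Icc 0 L, E x = κ * sol a b z 0 x := by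
    intro x hx
    rw [hE0 x hx]
    simp only [sol]
    ring
  set N := ∫ x in (0 : ℝ)..L, ‖sol a b z 0 x‖ ^ 2 with hN
  have hκN : ‖κ‖ ^ 2 * N = 1 := by
    rw [← hE.norm_eq, hN, ← intervalIntegral.integral_const_mul]
    refine intervalIntegral.integral_congr fun x hx => ?_
    rw [uIcc_of_le hLpos.le] at hx
    simp only [hEs x hx, norm_mul, mul_pow]
  have hN1 : |N - 1| ≤ D * t := by
    have := hov L hLδ z a b z a b hn hn
    simp only [mul_star_eq] at this
    rw [intervalIntegral.integral_ofReal, ← Complex.ofReal_one, ← Complex.ofReal_sub,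
      Complex.norm_real, Real.norm_eq_abs] at this
    exact this
  have hN2 := abs_le.1 hN1
  have hNl : 1 / 2 ≤ N := by linarith
  have hNu : N ≤ 3 / 2 := by linarith
  have hκ0 := norm_nonneg κ
  have hκu : ‖κ‖ ≤ 2 := by
    by_contra! h
    nlinarith
  have hκl : 1 / 2 ≤ ‖κ‖ := by
    by_contra! h
    nlinarith
  have hκ1 : |‖κ‖ - 1| ≤ 2 * D * t := by
    have e : (‖κ‖ - 1) * ((‖κ‖ + 1) * N) = 1 - N := by linear_combination hκN
    have h1 : |‖κ‖ - 1| * ((‖κ‖ + 1) * N) ≤ D * t := by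
      have h2 := congrArg abs e
      rw [abs_mul, abs_of_pos (by positivity : 0 < (‖κ‖ + 1) * N)] at h2
      rw [h2, abs_sub_comm]
      exact hN1
    have h3 : 1 / 2 ≤ (‖κ‖ + 1) * N := by nlinarith
    have h4 := mul_le_mul_of_nonneg_left h3 (abs_nonneg (‖κ‖ - 1))
    linarith
  have hκne : (‖κ‖ : ℂ) ≠ 0 := by
    rw [Complex.ofReal_ne_zero]
    linarith
  have hw : ‖κ / ‖κ‖‖ = 1 := by
    rw [norm_div, Complex.norm_real, norm_norm, div_self]
    linarith
  have hκw : ‖κ - κ / ‖κ‖‖ ≤ 2 * D * t := by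
    have e : κ - κ / ‖κ‖ = κ / ‖κ‖ * ((‖κ‖ - 1 : ℝ) : ℂ) := by
      push_cast
      field_simp
    rw [e, norm_mul, hw, one_mul, Complex.norm_real, Real.norm_eq_abs]
    exact hκ1
  refine ⟨κ, κ / ‖κ‖, hw, hκl, hκu, fun x hx => ?_, hE1, hE2, ?_⟩
  · have hxI : x ∈ Icc 0 (2 * L₀) := ⟨hx.1, by linarith [hx.2]⟩
    have e : E x - κ / ‖κ‖ * sol a₀ b₀ z₀ 0 x =
        κ * (sol a b z 0 x - sol a₀ b₀ z₀ 0 x) + (κ - κ / ‖κ‖) * sol a₀ b₀ z₀ 0 x := by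
      rw [hEs x hx]
      ring
    rw [e]
    refine (norm_add_le _ _).trans ?_
    rw [norm_mul, norm_mul]
    have c1 := mul_le_mul hκu (hclose _ (by linarith) z a b hn x hxI) (norm_nonneg _) (by norm_num)
    have c2 := mul_le_mul hκw (hPb x hxI) (norm_nonneg _) (by positivity)
    have c3 : 0 ≤ (2 * K + 2 * D * ‖a₀‖) * t := by positivity
    linarith
  · have e : κ * a - κ / ‖κ‖ * a₀ = κ * (a - a₀) + (κ - κ / ‖κ‖) * a₀ := by ring
    rw [e]
    refine (norm_add_le _ _).trans ?_
    rw [norm_mul, norm_mul]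
    have c1 := mul_le_mul hκu hn.a (norm_nonneg _) (by norm_num)
    have c2 := mul_le_mul_of_nonneg_right hκw (norm_nonneg a₀)
    have c3 : 0 ≤ (2 * (D' * K) + 2 * D * P) * t := by positivity
    linarith

section
variable {k l : ℕ}

/-! ### Expansion at the critical point -/

/-- The values at `L` of the fundamental solution and its derivatives, to first order in
`t = L - L₀` and `m = μ - λ_c`: the derivative in `μ` is a convolution of critical solutions. -/
lemma exists_crit_expansion (hk : 0 < k) (hl : 0 < l) : ∃ B, 0 < B ∧ ∀ L μ t m : ℝ,
    L - critLength k l = t → μ - lamC k l = m → |t| ≤ critLength k l / 2 → |m| ≤ 1 →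
    ‖fund 0 (Complex.I * μ) L - omega k l * (-Complex.I * ((√3 * scale k l * m : ℝ) : ℂ))‖ ≤
      B * (|t| + |m|) ^ 2 ∧
    ‖fund 1 (Complex.I * μ) L - omega k l * ((t - scale k l * cosPar k l * m : ℝ) : ℂ)‖ ≤
      B * (|t| + |m|) ^ 2 ∧
    ‖fund 2 (Complex.I * μ) L - omega k l * (1 + Complex.I * ((scale k l / √3 * m : ℝ) : ℂ))‖ ≤
      B * (|t| + |m|) ^ 2 := by
  have hL := critLength_pos hk l
  set R := max (2 * critLength k l) (|lamC k l| + 1) with hR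
  have hR0 : 0 ≤ R := le_trans (by positivity) (le_max_left _ _)
  obtain ⟨B₀, hB₀, h0⟩ := exists_fund_expansion (n := 0) (by norm_num) hR0
  obtain ⟨B₁, hB₁, h1⟩ := exists_fund_expansion (n := 1) (by norm_num) hR0
  obtain ⟨B₂, hB₂, h2⟩ := exists_fund_expansion (n := 2) (by norm_num) hR0
  obtain ⟨f0, f1, f2⟩ := fund_critLength hk hl
  have f3 : fund 3 (zC k l) (critLength k l) = 0 := by rw [fund_three, f0, f1]; simp
  obtain ⟨i0, i1, i2⟩ := integral_fund_zero_one_two hk hl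
  refine ⟨max B₀ (max B₁ B₂), by positivity, fun L μ t m hLt hμm ht hm => ?_⟩
  have htt := abs_le.1 ht
  have hz₀ : ‖zC k l‖ ≤ R := by
    rw [zC, norm_mul, Complex.norm_I, one_mul, Complex.norm_real, Real.norm_eq_abs]
    exact le_trans (by linarith) (le_max_right _ _)
  have hz : ‖Complex.I * (μ : ℂ)‖ ≤ R := by
    rw [norm_mul, Complex.norm_I, one_mul, Complex.norm_real, Real.norm_eq_abs]
    refine le_trans ?_ (le_max_right _ _)
    have : |μ| ≤ |lamC k l| + |m| := by
      rw [← hμm]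
      have := abs_add_le (lamC k l) (μ - lamC k l)
      rwa [add_sub_cancel] at this
    linarith
  have hzz : Complex.I * (μ : ℂ) - zC k l = Complex.I * (m : ℂ) := by
    rw [zC, ← hμm]
    push_cast
    ring
  have hnz : ‖Complex.I * (m : ℂ)‖ = |m| := by
    rw [norm_mul, Complex.norm_I, one_mul, Complex.norm_real, Real.norm_eq_abs]
  have hLR : L ≤ R := le_trans (by linarith) (le_max_left _ _)
  have hL₀R : critLength k l ≤ R := le_trans (by linarith) (le_max_left _ _)
  have hI : Complex.I ^ 2 = -1 := Complex.I_sq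
  have e0 := h0 _ _ hz hz₀ L (critLength k l) (by linarith) hLR hL.le hL₀R
  have e1 := h1 _ _ hz hz₀ L (critLength k l) (by linarith) hLR hL.le hL₀R
  have e2 := h2 _ _ hz hz₀ L (critLength k l) (by linarith) hLR hL.le hL₀R
  simp only [Nat.reduceAdd] at e0 e1 e2
  rw [i0, f0, f1, hzz, hnz, hLt] at e0
  rw [i1, f1, f2, hzz, hnz, hLt] at e1
  rw [i2, f2, f3, hzz, hnz, hLt] at e2
  have hS : 0 ≤ (|t| + |m|) ^ 2 := by positivity
  refine ⟨le_trans (le_of_eq ?_) (e0.trans (mul_le_mul_of_nonneg_right (le_max_left _ _) hS)),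
    le_trans (le_of_eq ?_) (e1.trans (mul_le_mul_of_nonneg_right
      ((le_max_left _ _).trans (le_max_right _ _)) hS)),
    le_trans (le_of_eq ?_) (e2.trans (mul_le_mul_of_nonneg_right
      ((le_max_right _ _).trans (le_max_right _ _)) hS))⟩
  · congr 1
    push_cast
    ring
  · congr 1
    push_cast
    linear_combination (omega k l * scale k l * cosPar k l * m) * hI
  · congr 1
    push_cast
    ring

lemma continuous_fund_zero_re (L : ℝ) :
    Continuous fun μ : ℝ => (fund 0 (Complex.I * μ) L).re :=
  Complex.continuous_re.comp ((continuous_fund_uncurry 0).comp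
    ((continuous_const.mul Complex.continuous_ofReal).prodMk continuous_const))

lemma exists_zero_of_mul_nonpos {f : ℝ → ℝ} (hf : Continuous f) {a b : ℝ} (hab : a ≤ b)
    (h : f a * f b ≤ 0) : ∃ x ∈ Icc a b, f x = 0 := by
  rcases mul_nonpos_iff.1 h with h | h
  · exact intermediate_value_Icc' hab hf.continuousOn ⟨h.2, h.1⟩
  · exact intermediate_value_Icc hab hf.continuousOn h

lemma mul_nonpos_of_abs_le {x x' y : ℝ} (h : |x + y| ≤ |y|) (h' : |x' - y| ≤ |y|) :
    x * x' ≤ 0 := by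
  rcases le_total 0 y with h0 | h0
  · rw [abs_of_nonneg h0, abs_le] at h h'
    exact mul_nonpos_of_nonpos_of_nonneg (by linarith) (by linarith)
  · rw [abs_of_nonpos h0, abs_le] at h h'
    exact mul_nonpos_of_nonneg_of_nonpos (by linarith) (by linarith)

/-- The kernel of the boundary conditions when `g''(L) ≠ 1`. -/
lemma isEigenData_simple {L μ : ℝ} (hL : 0 ≤ L) (hF : (fund 0 (Complex.I * μ) L).re = 0)
    {η : ℂ} (h : η * (1 - fund 2 (Complex.I * μ) L) ≠ 0) :
    IsEigenData L (Complex.I * μ) (η * fund 1 (Complex.I * μ) L)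
      (η * (1 - fund 2 (Complex.I * μ) L)) := by
  have hdet := det_eq_two_re μ hL
  rw [hF] at hdet
  simp at hdet
  refine ⟨Or.inr h, ?_, ?_⟩
  · simp only [sol]
    linear_combination η * hdet
  · simp only [sol]
    ring

/-- The kernel of the boundary conditions when `g'(L) ≠ 0`. -/
lemma isEigenData_double {L μ : ℝ} (hL : 0 ≤ L) (hF : (fund 0 (Complex.I * μ) L).re = 0)
    {η : ℂ} (h : η * fund 1 (Complex.I * μ) L ≠ 0) :
    IsEigenData L (Complex.I * μ) (-(η * fund 0 (Complex.I * μ) L))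
      (η * fund 1 (Complex.I * μ) L) := by
  have hdet := det_eq_two_re μ hL
  rw [hF] at hdet
  simp at hdet
  refine ⟨Or.inr h, ?_, ?_⟩
  · simp only [sol]
    ring
  · simp only [sol]
    linear_combination η * hdet

/-! ### The simple critical eigenvalue -/

lemma re_omega_mul (k l : ℕ) (x : ℝ) :
    (omega k l * (-Complex.I * (x : ℂ))).re = (omega k l).im * x := by
  simp [Complex.mul_re]

/-- For `ω ≠ 1` the characteristic function has a simple zero at the critical point, so that its
zeros are `O((L - L₀)²)`-close to `λ_c`. -/
lemma exists_zeros_simple (hk : 0 < k) (hl : 0 < l) (hω : (omega k l).im ≠ 0) :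
    ∃ K r₀, 0 < K ∧ 0 < r₀ ∧ r₀ ≤ 1 ∧ ∀ r, 0 < r → r ≤ r₀ → ∃ δ, 0 < δ ∧
      ∀ L, |L - critLength k l| ≤ δ →
        (∀ μ : ℝ, |μ - lamC k l| < r → (fund 0 (Complex.I * μ) L).re = 0 →
          |μ - lamC k l| ≤ K * (L - critLength k l) ^ 2) ∧
        ∃ μ : ℝ, |μ - lamC k l| < r ∧ (fund 0 (Complex.I * μ) L).re = 0 := by
  obtain ⟨B, hB, hexp⟩ := exists_crit_expansion hk hl
  have hL₀ := critLength_pos hk l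
  have hW := scale_pos hk hl
  have h3 : 0 < √(3 : ℝ) := by positivity
  set v := (omega k l).im with hv
  set A := √3 * scale k l * |v| with hA
  have hA0 : 0 < A := by positivity
  have hF : ∀ L μ t m : ℝ, L - critLength k l = t → μ - lamC k l = m →
      |t| ≤ critLength k l / 2 → |m| ≤ 1 →
      |(fund 0 (Complex.I * μ) L).re - √3 * scale k l * v * m| ≤ B * (|t| + |m|) ^ 2 := by
    intro L μ t m h1 h2 h3 h4
    have h5 := (hexp L μ t m h1 h2 h3 h4).1
    have h6 := (Complex.abs_re_le_norm _).trans h5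
    rw [Complex.sub_re, re_omega_mul] at h6
    refine le_trans (le_of_eq ?_) h6
    congr 1
    ring
  refine ⟨4 * B / A, min 1 (A / (8 * B)), by positivity, by positivity, min_le_left _ _,
    fun r hr hr₀ => ?_⟩
  have hr1 : r ≤ 1 := hr₀.trans (min_le_left _ _)
  have hrA : r * (8 * B) ≤ A := (le_div_iff₀ (by positivity)).1 (hr₀.trans (min_le_right _ _))
  refine ⟨min (min (critLength k l / 2) (r / 2)) (A / (4 * B)), by positivity, fun L hL => ?_⟩
  have ht1 : |L - critLength k l| ≤ critLength k l / 2 :=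
    hL.trans ((min_le_left _ _).trans (min_le_left _ _))
  have ht2 : |L - critLength k l| ≤ r / 2 :=
    hL.trans ((min_le_left _ _).trans (min_le_right _ _))
  have ht3 : |L - critLength k l| * (4 * B) ≤ A :=
    (le_div_iff₀ (by positivity)).1 (hL.trans (min_le_right _ _))
  obtain ⟨t, ht⟩ : ∃ t, L - critLength k l = t := ⟨_, rfl⟩
  rw [ht] at ht1 ht2 ht3 ⊢
  have ht0 := abs_nonneg t
  constructor
  · intro μ hμ hz
    obtain ⟨m, hm⟩ : ∃ m, μ - lamC k l = m := ⟨_, rfl⟩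
    rw [hm] at hμ ⊢
    have h1 := hF L μ t m ht hm ht1 (hμ.le.trans hr1)
    rw [hz, zero_sub, abs_neg, abs_mul, abs_mul, abs_of_pos (by positivity : 0 < √3 * scale k l),
      ← hA] at h1
    have h2 : B * |m| * |m| ≤ B * |m| * r := by gcongr
    have h4 : B * (|t| + |m|) ^ 2 ≤ 2 * B * |t| ^ 2 + 2 * B * |m| ^ 2 := by
      nlinarith [sq_nonneg (|t| - |m|)]
    have h5 := mul_le_mul_of_nonneg_right hrA (abs_nonneg m)
    rw [div_mul_eq_mul_div, le_div_iff₀ hA0, ← sq_abs t]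
    nlinarith
  · -- at `m = ± d` the linear term `± √3 W v d` of the characteristic function dominates
    set d := 4 * B / A * t ^ 2 with hd
    have hd0 : 0 ≤ d := by positivity
    have hAd : A * d = 4 * B * |t| ^ 2 := by
      rw [hd, sq_abs]
      field_simp
    have hdt : d ≤ |t| := by
      rw [hd, div_mul_eq_mul_div, div_le_iff₀ hA0, ← sq_abs t]
      nlinarith
    have hbd : ∀ m, |m| = d → |(fund 0 (Complex.I * ((lamC k l + m : ℝ) : ℂ)) L).re -
        √3 * scale k l * v * m| ≤ |√3 * scale k l * v * m| := by
      intro m hm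
      refine (hF L _ t m ht (by ring) ht1 (by rw [hm]; linarith)).trans ?_
      rw [abs_mul _ m, abs_mul, abs_of_pos (by positivity : 0 < √3 * scale k l), ← hA, hm, hAd]
      have : (|t| + d) ^ 2 ≤ (2 * |t|) ^ 2 := by gcongr; linarith
      nlinarith
    have h1 := hbd d (abs_of_nonneg hd0)
    have h2 := hbd (-d) (by rw [abs_neg, abs_of_nonneg hd0])
    rw [mul_neg, abs_neg, sub_neg_eq_add] at h2
    obtain ⟨μ, hμ, hz⟩ := exists_zero_of_mul_nonpos (continuous_fund_zero_re L)
      (a := lamC k l + -d) (b := lamC k l + d) (by linarith) (mul_nonpos_of_abs_le h2 h1)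
    refine ⟨μ, ?_, hz⟩
    have : |μ - lamC k l| ≤ d := abs_le.2 ⟨by linarith [hμ.1], by linarith [hμ.2]⟩
    linarith

end

section
variable {k l : ℕ}

/-! ### The double critical eigenvalue -/

/-- For `ω = 1` the characteristic function is, to leading order, the product of two real linear
forms in `t = L - L₀` and `m = μ - λ_c`. -/
lemma exists_quadratic_expansion (hk : 0 < k) (hl : 0 < l) (hω : omega k l = 1) :
    ∃ B, 0 < B ∧ ∀ L μ t m : ℝ, L - critLength k l = t → μ - lamC k l = m →
      |t| ≤ critLength k l / 2 → |t| ≤ 1 → |m| ≤ 1 →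
      |2 * (fund 0 (Complex.I * μ) L).re - (t - scale k l * (cosPar k l + 1) * m) *
        (t - scale k l * (cosPar k l - 1) * m)| ≤ B * (|t| + |m|) ^ 3 := by
  obtain ⟨B, hB, hexp⟩ := exists_crit_expansion hk hl
  have hL₀ := critLength_pos hk l
  have hW := scale_pos hk hl
  have h3 : 0 < √(3 : ℝ) := by positivity
  have h33 : √(3 : ℝ) ^ 2 = 3 := Real.sq_sqrt (by norm_num)
  set W := scale k l with hWdef
  set c := cosPar k l with hcdef
  have hc1 : |c| ≤ 1 := ((sq_lt_one_iff_abs_lt_one _).1 (cosPar_sq_lt_one hk hl)).le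
  set D := 1 + √3 * W + W + W / √3 with hD
  have hD0 : 0 < D := by positivity
  refine ⟨2 * (B * (2 * D + 2 * B)), by positivity, fun L μ t m ht hm ht1 ht2 hm1 => ?_⟩
  obtain ⟨e0, e1, e2⟩ := hexp L μ t m ht hm ht1 hm1
  rw [hω, one_mul] at e0 e1 e2
  have htt := abs_nonneg t
  have hmm := abs_nonneg m
  have hdet := det_eq_two_re μ (by linarith [abs_le.1 ht1] : 0 ≤ L)
  set f0 := fund 0 (Complex.I * μ) L
  set f1 := fund 1 (Complex.I * μ) L
  set f2 := fund 2 (Complex.I * μ) L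
  obtain ⟨S, hS⟩ : ∃ S, S = |t| + |m| := ⟨_, rfl⟩
  rw [← hS] at e0 e1 e2 ⊢
  have hS0 : 0 ≤ S := by rw [hS]; positivity
  have hS2 : S ≤ 2 := by linarith
  have hmS : |m| ≤ S := by linarith
  have htS : |t| ≤ S := by linarith
  have e2' : ‖(f2 - 1) - Complex.I * ((W / √3 * m : ℝ) : ℂ)‖ ≤ B * S ^ 2 := by
    refine le_trans (le_of_eq ?_) e2
    congr 1
    ring
  have n0 : ‖-Complex.I * ((√3 * W * m : ℝ) : ℂ)‖ ≤ D * S := by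
    rw [norm_mul, norm_neg, Complex.norm_I, one_mul, Complex.norm_real, Real.norm_eq_abs, abs_mul,
      abs_of_pos (by positivity : 0 < √3 * W)]
    have : √3 * W ≤ D := by rw [hD]; linarith [div_pos hW h3]
    gcongr
  have n1 : ‖((t - W * c * m : ℝ) : ℂ)‖ ≤ D * S := by
    rw [Complex.norm_real, Real.norm_eq_abs]
    have h1 : |t - W * c * m| ≤ |t| + |W * c * m| := abs_sub _ _
    have h2 : |W * c * m| ≤ W * |m| := by
      rw [abs_mul, abs_mul, abs_of_pos hW]
      have : W * |c| ≤ W * 1 := by gcongr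
      nlinarith
    have h4 : 0 ≤ (√3 * W + W / √3) * S := by positivity
    have h5 : W * |m| ≤ W * S := by gcongr
    rw [hD]
    linarith
  have n2 : ‖Complex.I * ((W / √3 * m : ℝ) : ℂ)‖ ≤ D * S := by
    rw [norm_mul, Complex.norm_I, one_mul, Complex.norm_real, Real.norm_eq_abs, abs_mul,
      abs_of_pos (by positivity : 0 < W / √3)]
    have : W / √3 ≤ D := by rw [hD]; linarith [mul_pos h3 hW]
    gcongr
  have hprod : ∀ x y x₀ y₀ : ℂ, ‖x - x₀‖ ≤ B * S ^ 2 → ‖y - y₀‖ ≤ B * S ^ 2 → ‖x₀‖ ≤ D * S →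
      ‖y₀‖ ≤ D * S → ‖x * y - x₀ * y₀‖ ≤ B * (2 * D + 2 * B) * S ^ 3 := by
    intro x y x₀ y₀ h1 h2 h4 h5
    have hy : ‖y‖ ≤ (D + 2 * B) * S := by
      have h6 := norm_le_norm_add_norm_sub' y y₀
      have : B * S ^ 2 ≤ B * (2 * S) := by gcongr; nlinarith
      linarith
    have e : x * y - x₀ * y₀ = (x - x₀) * y + x₀ * (y - y₀) := by ring
    rw [e]
    refine (norm_add_le _ _).trans ?_
    rw [norm_mul, norm_mul]
    have c1 := mul_le_mul h1 hy (norm_nonneg _) (by positivity)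
    have c2 := mul_le_mul h4 h2 (norm_nonneg _) (by positivity)
    refine (add_le_add c1 c2).trans (le_of_eq ?_)
    ring
  have p1 := hprod f1 f1 _ _ e1 e1 n1 n1
  have p2 := hprod f0 (f2 - 1) _ _ e0 e2' n0 n2
  have hI : Complex.I ^ 2 = -1 := Complex.I_sq
  have hs3 : (√3 : ℂ) ≠ 0 := by exact_mod_cast h3.ne'
  have e : ((2 * f0.re - (t - W * (c + 1) * m) * (t - W * (c - 1) * m) : ℝ) : ℂ) =
      (f1 * f1 - ((t - W * c * m : ℝ) : ℂ) * ((t - W * c * m : ℝ) : ℂ)) -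
      (f0 * (f2 - 1) - -Complex.I * ((√3 * W * m : ℝ) : ℂ) *
        (Complex.I * ((W / √3 * m : ℝ) : ℂ))) := by
    rw [Complex.ofReal_sub, ← hdet]
    push_cast
    field_simp
    linear_combination (W : ℂ) ^ 2 * m ^ 2 * hI
  have h6 := (norm_sub_le (f1 * f1 - ((t - W * c * m : ℝ) : ℂ) * ((t - W * c * m : ℝ) : ℂ))
    (f0 * (f2 - 1) - -Complex.I * ((√3 * W * m : ℝ) : ℂ) *
        (Complex.I * ((W / √3 * m : ℝ) : ℂ)))).trans (add_le_add p1 p2)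
  rw [← e, Complex.norm_real, Real.norm_eq_abs] at h6
  linarith

/-- The slope `(τ - c) / (π √q)` of the branch `τ = ±1` of eigenvalues. -/
noncomputable def branchSlope (k l : ℕ) (τ : ℝ) : ℝ := (τ - cosPar k l) / (Real.pi * √(q k l))

lemma scale_mul_branchSlope (hk : 0 < k) (hl : 0 < l) {τ : ℝ} (hτ : τ ^ 2 = 1) :
    scale k l * (cosPar k l + τ) * branchSlope k l τ = 1 := by
  have hs := Real.sqrt_pos.2 (q_pos hk l)
  have hc := cosPar_sq_lt_one hk hl
  have hc' : 1 - cosPar k l ^ 2 ≠ 0 := by linarith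
  have hpi := Real.pi_pos
  rw [scale, branchSlope]
  field_simp
  linear_combination hτ

/-- Every zero near the critical point lies on one of the two branches: the larger of the two
linear forms of the leading term controls `|t| + |m|`, so the smaller one is quadratically small. -/
lemma exists_zeros_on_branch (hk : 0 < k) (hl : 0 < l) (hω : omega k l = 1) :
    ∃ K r δ, 0 < K ∧ 0 < r ∧ 0 < δ ∧ ∀ L, |L - critLength k l| ≤ δ → ∀ μ : ℝ,
      |μ - lamC k l| < r → (fund 0 (Complex.I * μ) L).re = 0 →
      ∃ τ : ℝ, τ ^ 2 = 1 ∧ |μ - lamC k l - branchSlope k l τ * (L - critLength k l)| ≤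
        K * (L - critLength k l) ^ 2 := by
  obtain ⟨B, hB, hexp⟩ := exists_quadratic_expansion hk hl hω
  have hL₀ := critLength_pos hk l
  have hW := scale_pos hk hl
  have hsl := fun τ (hτ : τ ^ 2 = 1) => scale_mul_branchSlope hk hl hτ
  have hg' : |cosPar k l| < 1 := (sq_lt_one_iff_abs_lt_one _).1 (cosPar_sq_lt_one hk hl)
  set W := scale k l with hWdef
  set c := cosPar k l with hcdef
  set g := 1 - |c| with hg
  have hg0 : 0 < g := by rw [hg]; linarith
  set G := B * (3 + 1 / W) with hG
  have hG0 : 0 < G := by positivity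
  set M := 2 * (1 + 2 * G) / (W * g) with hM
  have hM0 : 0 < M := by positivity
  refine ⟨G * (1 + M) ^ 2 / (W * g), min 1 (W * g / (4 * G)), min 1 (critLength k l / 2),
    by positivity, by positivity, by positivity, fun L hL μ hμ hF => ?_⟩
  obtain ⟨t, ht⟩ : ∃ t, L - critLength k l = t := ⟨_, rfl⟩
  obtain ⟨m, hm⟩ : ∃ m, μ - lamC k l = m := ⟨_, rfl⟩
  rw [ht] at hL
  rw [hm] at hμ
  rw [ht, hm]
  have ht1 : |t| ≤ 1 := hL.trans (min_le_left _ _)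
  have hm1 : |m| ≤ 1 := (hμ.trans_le (min_le_left _ _)).le
  have hmG : |m| * (4 * G) ≤ W * g :=
    (le_div_iff₀ (by positivity)).1 (hμ.trans_le (min_le_right _ _)).le
  have h1 := hexp L μ t m ht hm (hL.trans (min_le_right _ _)) ht1 hm1
  rw [hF, mul_zero, zero_sub, abs_neg, abs_mul] at h1
  have ht0 := abs_nonneg t
  have hm0 := abs_nonneg m
  obtain ⟨S, hS⟩ : ∃ S, S = |t| + |m| := ⟨_, rfl⟩
  rw [← hS] at h1
  have hS0 : 0 ≤ S := by rw [hS]; positivity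
  obtain ⟨X, hX⟩ : ∃ X, X = t - W * (c + 1) * m := ⟨_, rfl⟩
  obtain ⟨Y, hY⟩ : ∃ Y, Y = t - W * (c - 1) * m := ⟨_, rfl⟩
  rw [← hX, ← hY] at h1
  -- `X` and `Y` are independent linear forms in `t` and `m`
  have hSb : ∀ Z, |X| ≤ Z → |Y| ≤ Z → S ≤ (3 + 1 / W) * Z := by
    intro Z hXZ hYZ
    have a1 : |2 * W * m| ≤ 2 * Z := by
      have : 2 * W * m = Y - X := by rw [hX, hY]; ring
      rw [this]
      exact (abs_sub _ _).trans (by linarith)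
    rw [abs_mul, abs_of_pos (by positivity : 0 < 2 * W)] at a1
    have a2 : |m| ≤ 1 / W * Z := by
      rw [div_mul_eq_mul_div, le_div_iff₀ hW]
      linarith
    have a3 : |t| ≤ 3 * Z := by
      have e : t = (X + Y) / 2 + c * (W * m) := by rw [hX, hY]; ring
      have b1 : |c * (W * m)| ≤ W * |m| := by
        rw [abs_mul, abs_mul, abs_of_pos hW]
        exact mul_le_of_le_one_left (by positivity) hg'.le
      have b2 : |(X + Y) / 2| ≤ Z := by
        rw [abs_div, abs_two]
        have := abs_add_le X Y
        linarith
      have b3 := abs_add_le ((X + Y) / 2) (c * (W * m))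
      rw [← e] at b3
      linarith
    rw [hS]
    linarith
  have hsmall : ∀ U V : ℝ, |V| ≤ |U| → |U| * |V| ≤ B * S ^ 3 → S ≤ (3 + 1 / W) * |U| →
      |V| ≤ G * S ^ 2 := by
    intro U V hVU hp hSU
    rcases (abs_nonneg U).eq_or_lt with h0 | h0
    · rw [← h0] at hVU
      exact hVU.trans (by positivity)
    · have a1 : |U| * |V| ≤ |U| * (G * S ^ 2) := by
        refine hp.trans ?_
        have : B * S ^ 2 * S ≤ B * S ^ 2 * ((3 + 1 / W) * |U|) := by gcongr
        rw [hG]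
        linarith
      exact le_of_mul_le_mul_left a1 h0
  obtain ⟨τ, hτ, hlin⟩ : ∃ τ : ℝ, τ ^ 2 = 1 ∧ |t - W * (c + τ) * m| ≤ G * S ^ 2 := by
    rcases le_total |Y| |X| with h | h
    · exact ⟨-1, by norm_num, by
        have := hsmall X Y h h1 (hSb _ le_rfl h)
        rwa [hY, sub_eq_add_neg c] at this⟩
    · exact ⟨1, by norm_num, by
        have := hsmall Y X h (by rwa [mul_comm]) (hSb _ h le_rfl)
        rwa [hX] at this⟩
  refine ⟨τ, hτ, ?_⟩
  have hgτ : g ≤ |c + τ| := by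
    have : |τ| = 1 := by rwa [← sq_eq_sq₀ (abs_nonneg _) zero_le_one, sq_abs, one_pow]
    have h2 := abs_sub_abs_le_abs_sub τ (-c)
    rw [abs_neg, sub_neg_eq_add, add_comm] at h2
    rw [hg]
    linarith
  have hmt : |m| ≤ M * |t| := by
    have a1 : W * g * |m| ≤ |t| + G * S ^ 2 := by
      have a2 : |W * (c + τ) * m| ≤ |t| + G * S ^ 2 := by
        have e : W * (c + τ) * m = t - (t - W * (c + τ) * m) := by ring
        rw [e]
        exact (abs_sub _ _).trans (by linarith)
      rw [abs_mul, abs_mul, abs_of_pos hW] at a2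
      refine le_trans ?_ a2
      gcongr
    have a3 : S ^ 2 ≤ 2 * |t| ^ 2 + 2 * |m| ^ 2 := by
      rw [hS]
      nlinarith [sq_nonneg (|t| - |m|)]
    have a4 : G * S ^ 2 ≤ G * (2 * |t| ^ 2 + 2 * |m| ^ 2) := by gcongr
    have a5 : G * |t| ^ 2 ≤ G * |t| := by
      gcongr
      nlinarith
    have a6 := mul_le_mul_of_nonneg_right hmG hm0
    rw [hM, div_mul_eq_mul_div, le_div_iff₀ (by positivity)]
    nlinarith
  have hSt : S ≤ (1 + M) * |t| := by rw [hS]; linarith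
  have e : W * (c + τ) * (m - branchSlope k l τ * t) = -(t - W * (c + τ) * m) := by
    linear_combination -t * hsl τ hτ
  have h5 := congrArg abs e
  rw [abs_neg, abs_mul, abs_mul, abs_of_pos hW] at h5
  have h6 : W * g * |m - branchSlope k l τ * t| ≤ G * ((1 + M) * |t|) ^ 2 := by
    calc _ ≤ W * |c + τ| * |m - branchSlope k l τ * t| := by gcongr
      _ ≤ G * S ^ 2 := h5 ▸ hlin
      _ ≤ _ := by gcongr
  rw [div_mul_eq_mul_div, le_div_iff₀ (by positivity), ← sq_abs t]
  linarith

/-- At `m = α t ± K t²`, with `α` the slope of a branch, the leading term `∓ 2 τ W K t³` of the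
characteristic function dominates the remainder. -/
lemma exists_branch_bound (hk : 0 < k) (hl : 0 < l) (hω : omega k l = 1) {τ : ℝ}
    (hτ : τ ^ 2 = 1) :
    ∃ K δ, 0 < K ∧ 0 < δ ∧ ∀ L t : ℝ, L - critLength k l = t → |t| ≤ δ → ∀ ρ : ℝ, ρ ^ 2 = 1 →
      |2 * (fund 0 (Complex.I * ((lamC k l + (branchSlope k l τ * t + ρ * (K * t ^ 2)) : ℝ) : ℂ))
        L).re - (-(2 * ρ * τ * scale k l * K * t ^ 3))| ≤
        |2 * ρ * τ * scale k l * K * t ^ 3| := by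
  obtain ⟨B, hB, hexp⟩ := exists_quadratic_expansion hk hl hω
  have hL₀ := critLength_pos hk l
  have hW := scale_pos hk hl
  have hsl := scale_mul_branchSlope hk hl hτ
  have hg' : cosPar k l ^ 2 < 1 := cosPar_sq_lt_one hk hl
  obtain ⟨W, hWdef⟩ : ∃ W, W = scale k l := ⟨_, rfl⟩
  obtain ⟨c, hcdef⟩ : ∃ c, c = cosPar k l := ⟨_, rfl⟩
  obtain ⟨α, hα⟩ : ∃ α, α = branchSlope k l τ := ⟨_, rfl⟩
  rw [← hWdef, ← hcdef] at hexp
  rw [← hWdef] at hW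
  rw [← hcdef] at hg'
  rw [← hWdef, ← hcdef, ← hα] at hsl
  rw [← hWdef, ← hα]
  obtain ⟨M, hM⟩ : ∃ M, M = 2 + |α| := ⟨_, rfl⟩
  have hM0 : 0 < M := by rw [hM]; positivity
  obtain ⟨K, hK⟩ : ∃ K, K = B * M ^ 3 / W := ⟨_, rfl⟩
  have hK0 : 0 < K := by rw [hK]; positivity
  refine ⟨K, min (min 1 (critLength k l / 2)) (min (1 / M) (min (1 / K) (1 / (W * K)))), hK0,
    by positivity, fun L t ht hL ρ hρ => ?_⟩
  have ht1 : |t| ≤ 1 := hL.trans ((min_le_left _ _).trans (min_le_left _ _))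
  have ht2 : |t| ≤ critLength k l / 2 := hL.trans ((min_le_left _ _).trans (min_le_right _ _))
  have hL' := hL.trans (min_le_right _ _)
  have ht3 : |t| * M ≤ 1 := (le_div_iff₀ hM0).1 (hL'.trans (min_le_left _ _))
  have ht4 : |t| * K ≤ 1 :=
    (le_div_iff₀ hK0).1 (hL'.trans ((min_le_right _ _).trans (min_le_left _ _)))
  have ht5 : |t| * (W * K) ≤ 1 :=
    (le_div_iff₀ (by positivity)).1 (hL'.trans ((min_le_right _ _).trans (min_le_right _ _)))
  have ht0 := abs_nonneg t
  obtain ⟨d, hd⟩ : ∃ d, d = K * t ^ 2 := ⟨_, rfl⟩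
  have hd0 : 0 ≤ d := by rw [hd]; positivity
  have hdt : d ≤ |t| := by
    rw [hd, ← sq_abs t]
    have := mul_le_mul_of_nonneg_right ht4 ht0
    linarith
  have hτ1 : |τ| = 1 := by rwa [← sq_eq_sq₀ (abs_nonneg _) zero_le_one, sq_abs, one_pow]
  have hρ1 : |ρ| = 1 := by rwa [← sq_eq_sq₀ (abs_nonneg _) zero_le_one, sq_abs, one_pow]
  rw [← hd]
  obtain ⟨m, hm⟩ : ∃ m, m = α * t + ρ * d := ⟨_, rfl⟩
  rw [← hm]
  have hmb : |m| ≤ (1 + |α|) * |t| := by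
    have := abs_add_le (α * t) (ρ * d)
    rw [abs_mul, abs_mul, hρ1, abs_of_nonneg hd0, ← hm] at this
    linarith
  have hm1 : |m| ≤ 1 := by
    rw [hM] at ht3
    linarith
  have h1 := hexp L _ t m ht (by ring : lamC k l + m - lamC k l = m) ht2 ht1 hm1
  obtain ⟨F, hF⟩ : ∃ F, F = (fund 0 (Complex.I * ((lamC k l + m : ℝ) : ℂ)) L).re := ⟨_, rfl⟩
  rw [← hF] at h1 ⊢
  -- the value of the leading term at this `m`, up to a term of order `t ^ 4`
  have hQ : (t - W * (c + 1) * m) * (t - W * (c - 1) * m) =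
      -(2 * ρ * τ * W * K * t ^ 3) - W ^ 2 * (1 - c ^ 2) * d ^ 2 := by
    have e1 : (t - W * (c + 1) * m) * (t - W * (c - 1) * m) =
        (t - W * (c + τ) * m) * (t - W * (c - τ) * m) := by
      linear_combination (W ^ 2 * m ^ 2) * hτ
    have e2 : t - W * (c + τ) * m = -(ρ * W * (c + τ) * d) := by
      rw [hm]
      linear_combination -t * hsl
    have e3 : (c + τ) * (t - W * (c - τ) * m) = 2 * τ * t - ρ * W * (c ^ 2 - 1) * d := by
      rw [hm]
      linear_combination -(c - τ) * t * hsl + (ρ * W * d) * hτ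
    rw [e1, e2]
    have e4 : -(ρ * W * (c + τ) * d) * (t - W * (c - τ) * m) =
        -(ρ * W * d) * ((c + τ) * (t - W * (c - τ) * m)) := by ring
    rw [e4, e3, hd]
    linear_combination (W ^ 2 * (c ^ 2 - 1) * (K * t ^ 2) ^ 2) * hρ
  rw [hQ] at h1
  have hS : |t| + |m| ≤ M * |t| := by
    rw [hM]
    linarith
  have hB3 : B * (|t| + |m|) ^ 3 ≤ W * K * |t| ^ 3 := by
    calc _ ≤ B * (M * |t|) ^ 3 := by gcongr
      _ = W * K * |t| ^ 3 := by
        rw [hK]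
        field_simp
  have hd2 : |W ^ 2 * (1 - c ^ 2) * d ^ 2| ≤ W * K * |t| ^ 3 := by
    rw [abs_of_nonneg (mul_nonneg (mul_nonneg (by positivity) (by linarith)) (by positivity)),
      hd, ← sq_abs t]
    have a1 : 0 ≤ W * K * |t| ^ 3 := by positivity
    have a2 := mul_le_mul_of_nonneg_left ht5 a1
    have a3 : 0 ≤ c ^ 2 * (W ^ 2 * (K * |t| ^ 2) ^ 2) := by positivity
    linarith
  have hR : |2 * ρ * τ * W * K * t ^ 3| = 2 * (W * K * |t| ^ 3) := by
    rw [abs_mul, abs_mul, abs_mul, abs_mul, abs_mul, hρ1, hτ1, abs_of_pos hW, abs_of_pos hK0,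
      abs_pow, abs_two]
    ring
  rw [hR]
  have e : 2 * F - (-(2 * ρ * τ * W * K * t ^ 3)) =
      (2 * F - (-(2 * ρ * τ * W * K * t ^ 3) - W ^ 2 * (1 - c ^ 2) * d ^ 2)) -
      W ^ 2 * (1 - c ^ 2) * d ^ 2 := by ring
  rw [e]
  refine (abs_sub _ _).trans ?_
  linarith

/-- On each branch there is a zero. -/
lemma exists_zero_branch (hk : 0 < k) (hl : 0 < l) (hω : omega k l = 1) {τ : ℝ}
    (hτ : τ ^ 2 = 1) :
    ∃ K δ, 0 < K ∧ 0 < δ ∧ ∀ L, |L - critLength k l| ≤ δ →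
      ∃ μ : ℝ, (fund 0 (Complex.I * μ) L).re = 0 ∧
        |μ - lamC k l - branchSlope k l τ * (L - critLength k l)| ≤
        K * (L - critLength k l) ^ 2 := by
  obtain ⟨K, δ, hK, hδ, hval⟩ := exists_branch_bound hk hl hω hτ
  refine ⟨K, δ, hK, hδ, fun L hL => ?_⟩
  have hd0 : 0 ≤ K * (L - critLength k l) ^ 2 := by positivity
  have h1 := hval L _ rfl hL 1 (by norm_num)
  have h2 := hval L _ rfl hL (-1) (by norm_num)
  generalize L - critLength k l = t at *
  generalize K * t ^ 2 = d at h1 h2 hd0 ⊢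
  have e : 2 * (-1) * τ * scale k l * K * t ^ 3 = -(2 * 1 * τ * scale k l * K * t ^ 3) := by ring
  rw [e, neg_neg, abs_neg] at h2
  generalize 2 * 1 * τ * scale k l * K * t ^ 3 = y at h1 h2
  rw [sub_neg_eq_add] at h1
  obtain ⟨μ, hμ, hz⟩ := exists_zero_of_mul_nonpos (continuous_fund_zero_re L)
    (a := lamC k l + (branchSlope k l τ * t + -1 * d))
    (b := lamC k l + (branchSlope k l τ * t + 1 * d)) (by linarith)
    (by linarith [mul_nonpos_of_abs_le h1 h2])
  exact ⟨μ, hz, abs_le.2 ⟨by linarith [hμ.1], by linarith [hμ.2]⟩⟩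

end

section
variable {k l : ℕ}

/-! ### Eigenfunctions near the critical length -/

lemma norm_I_mul_sub_zC (k l : ℕ) (μ : ℝ) :
    ‖Complex.I * (μ : ℂ) - zC k l‖ = |μ - lamC k l| := by
  rw [zC, ← mul_sub, norm_mul, Complex.norm_I, one_mul, ← Complex.ofReal_sub, Complex.norm_real,
    Real.norm_eq_abs]

/-- The data of an eigenfunction on the branch `τ` converge to those of the limiting profile with
sign `-τ`. -/
lemma exists_nearData_double (hk : 0 < k) (hl : 0 < l) (hω : omega k l = 1) {τ : ℝ}
    (hτ : τ ^ 2 = 1) {K : ℝ} (hK : 0 < K) :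
    ∃ K' δ, 0 < K' ∧ 0 < δ ∧ ∀ L, |L - critLength k l| ≤ δ → L ≠ critLength k l → ∀ μ : ℝ,
      (fund 0 (Complex.I * μ) L).re = 0 →
      |μ - lamC k l - branchSlope k l τ * (L - critLength k l)| ≤ K * (L - critLength k l) ^ 2 →
      fund 1 (Complex.I * μ) L ≠ 0 ∧ ∃ a b, IsEigenData L (Complex.I * μ) a b ∧
        NearData (K' * |L - critLength k l|) (zC k l) (boundarySlope k l (-τ))
          (boundaryCurv k l (-τ)) (Complex.I * μ) a b := by
  obtain ⟨B, hB, hexp⟩ := exists_crit_expansion hk hl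
  have hL₀ := critLength_pos hk l
  have hW := scale_pos hk hl
  have hsl := scale_mul_branchSlope hk hl hτ
  have hτs : (-τ) ^ 2 = 1 := by rw [neg_sq, hτ]
  have hb₀ := boundaryCurv_ne_zero hk hl hτs
  rw [boundarySlope_eq hk hl hτs]
  have hτ0 : τ ≠ 0 := by rintro rfl; norm_num at hτ
  have hτ1 : |τ| = 1 := by rwa [← sq_eq_sq₀ (abs_nonneg _) zero_le_one, sq_abs, one_pow]
  generalize boundaryCurv k l (-τ) = b₀ at hb₀ ⊢
  obtain ⟨W, hWdef⟩ : ∃ W, W = scale k l := ⟨_, rfl⟩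
  obtain ⟨c, hcdef⟩ : ∃ c, c = cosPar k l := ⟨_, rfl⟩
  obtain ⟨α, hα⟩ : ∃ α, α = branchSlope k l τ := ⟨_, rfl⟩
  -- on the branch, `g(L)` and `g'(L)` are `-i √3 γ t` and `τ γ t` to leading order
  obtain ⟨γ, hγ⟩ : ∃ γ, γ = W * α := ⟨_, rfl⟩
  rw [← hWdef, ← hcdef, hω] at hexp
  rw [← hWdef] at hW
  rw [← hWdef, ← hcdef, ← hα] at hsl
  rw [← hα]
  have hγ0 : γ ≠ 0 := by
    rintro rfl
    have : W * (c + τ) * α = (c + τ) * (W * α) := by ring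
    rw [this, ← hγ, mul_zero] at hsl
    norm_num at hsl
  have hγa := abs_pos.2 hγ0
  obtain ⟨N, hN⟩ : ∃ N, N = B * (1 + |α| + K) ^ 2 + (√3 * W + W * |c|) * K := ⟨_, rfl⟩
  have hN0 : 0 < N := by rw [hN]; positivity
  have hb₀' := norm_pos_iff.2 hb₀
  refine ⟨|α| + K + ‖b₀‖ / |γ| * N,
    min (min 1 (critLength k l / 2)) (min (1 / (|α| + K)) (|γ| / (2 * N))),
    by positivity, by positivity, fun L hL hne μ hF hμ => ?_⟩
  obtain ⟨t, ht⟩ : ∃ t, L - critLength k l = t := ⟨_, rfl⟩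
  obtain ⟨m, hm⟩ : ∃ m, μ - lamC k l = m := ⟨_, rfl⟩
  have hz := norm_I_mul_sub_zC k l μ
  have ht0 : t ≠ 0 := by rw [← ht]; exact sub_ne_zero.2 hne
  rw [ht] at hL hμ ⊢
  rw [hm] at hμ hz
  have ht1 : |t| ≤ 1 := hL.trans ((min_le_left _ _).trans (min_le_left _ _))
  have ht2 : |t| ≤ critLength k l / 2 := hL.trans ((min_le_left _ _).trans (min_le_right _ _))
  have ht3 : |t| * (|α| + K) ≤ 1 := (le_div_iff₀ (by positivity)).1
    (hL.trans ((min_le_right _ _).trans (min_le_left _ _)))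
  have ht4 : |t| * (2 * N) ≤ |γ| := (le_div_iff₀ (by positivity)).1
    (hL.trans ((min_le_right _ _).trans (min_le_right _ _)))
  have hta := abs_pos.2 ht0
  have htt : t ^ 2 = |t| ^ 2 := (sq_abs t).symm
  have htt' : |t| ^ 2 ≤ |t| := by
    have := mul_le_mul_of_nonneg_left ht1 hta.le
    linarith
  have hmt : |m| ≤ (|α| + K) * |t| := by
    have e : m = α * t + (m - α * t) := by ring
    have h1 := abs_add_le (α * t) (m - α * t)
    rw [← e, abs_mul] at h1
    have : K * t ^ 2 ≤ K * |t| := by rw [htt]; gcongr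
    linarith
  obtain ⟨e0, e1, -⟩ := hexp L μ t m ht hm ht2 (hmt.trans (by linarith))
  have hS : B * (|t| + |m|) ^ 2 ≤ B * (1 + |α| + K) ^ 2 * |t| ^ 2 := by
    rw [mul_assoc, ← mul_pow]
    gcongr
    linarith
  have hL0 : 0 ≤ L := by linarith [(abs_le.1 ht2).1]
  rw [one_mul] at e0 e1
  have hdata := fun η h => isEigenData_double hL0 hF (η := η) h
  generalize fund 0 (Complex.I * (μ : ℂ)) L = f0 at e0 hdata
  generalize fund 1 (Complex.I * (μ : ℂ)) L = f1 at e1 hdata ⊢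
  have hKW : √3 * W * (K * t ^ 2) + B * (1 + |α| + K) ^ 2 * |t| ^ 2 ≤ N * |t| ^ 2 := by
    have : 0 ≤ W * |c| * K * |t| ^ 2 := by positivity
    rw [hN, htt]
    linarith
  have hKc : W * |c| * (K * t ^ 2) + B * (1 + |α| + K) ^ 2 * |t| ^ 2 ≤ N * |t| ^ 2 := by
    have : 0 ≤ √3 * W * K * |t| ^ 2 := by positivity
    rw [hN, htt]
    linarith
  have d0 : ‖f0 + Complex.I * ((√3 * γ * t : ℝ) : ℂ)‖ ≤ N * |t| ^ 2 := by
    have e : f0 + Complex.I * ((√3 * γ * t : ℝ) : ℂ) =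
        (f0 - -Complex.I * ((√3 * W * m : ℝ) : ℂ)) +
          -Complex.I * ((√3 * W * (m - α * t) : ℝ) : ℂ) := by
      rw [hγ]
      push_cast
      ring
    have h1 : ‖-Complex.I * ((√3 * W * (m - α * t) : ℝ) : ℂ)‖ ≤ √3 * W * (K * t ^ 2) := by
      rw [norm_mul, norm_neg, Complex.norm_I, one_mul, Complex.norm_real, Real.norm_eq_abs,
        abs_mul, abs_of_pos (by positivity : 0 < √3 * W)]
      gcongr
    rw [e]
    refine (norm_add_le _ _).trans ?_
    linarith
  have d1 : ‖f1 - ((τ * γ * t : ℝ) : ℂ)‖ ≤ N * |t| ^ 2 := by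
    have e : f1 - ((τ * γ * t : ℝ) : ℂ) = (f1 - ((t - W * c * m : ℝ) : ℂ)) +
        ((-(W * c * (m - α * t)) : ℝ) : ℂ) := by
      have : τ * γ * t = t - W * c * α * t := by
        rw [hγ]
        linear_combination t * hsl
      rw [this]
      push_cast
      ring
    have h1 : ‖((-(W * c * (m - α * t)) : ℝ) : ℂ)‖ ≤ W * |c| * (K * t ^ 2) := by
      rw [Complex.norm_real, Real.norm_eq_abs, abs_neg, abs_mul, abs_mul, abs_of_pos hW]
      gcongr
    rw [e]
    refine (norm_add_le _ _).trans ?_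
    linarith
  have hf1 : f1 ≠ 0 := by
    rintro rfl
    rw [zero_sub, norm_neg, Complex.norm_real, Real.norm_eq_abs, abs_mul, abs_mul, hτ1,
      one_mul] at d1
    have h1 : |γ| * |t| ≤ N * |t| * |t| := by linarith
    have h2 := le_of_mul_le_mul_right h1 hta
    linarith [mul_pos hN0 hta]
  -- normalised so that `η τ γ t = b₀`, where `τ γ t` is the leading term of `g'(L)`
  obtain ⟨η, hη⟩ : ∃ η : ℂ, η = b₀ * τ / (γ * t) := ⟨_, rfl⟩
  have hγc : (γ : ℂ) ≠ 0 := by exact_mod_cast hγ0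
  have htc : (t : ℂ) ≠ 0 := by exact_mod_cast ht0
  have hτc : (τ : ℂ) ≠ 0 := by exact_mod_cast hτ0
  have hτ2 : (τ : ℂ) ^ 2 = 1 := by exact_mod_cast hτ
  have hη0 : η ≠ 0 := by rw [hη]; exact div_ne_zero (mul_ne_zero hb₀ hτc) (mul_ne_zero hγc htc)
  have hηt : η * (γ * t) = b₀ * τ := by rw [hη]; field_simp
  have hηn : ‖η‖ * (N * |t| ^ 2) = ‖b₀‖ / |γ| * N * |t| := by
    rw [hη, norm_div, norm_mul, norm_mul, Complex.norm_real, Complex.norm_real, Complex.norm_real,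
      Real.norm_eq_abs, Real.norm_eq_abs, Real.norm_eq_abs, hτ1]
    field_simp
  have hα0 := abs_nonneg α
  have hb : 0 ≤ ‖b₀‖ / |γ| * N * |t| := by positivity
  have hmt0 : 0 ≤ (|α| + K) * |t| := by positivity
  refine ⟨hf1, _, _, hdata η (mul_ne_zero hη0 hf1), ?_, ?_, ?_⟩
  · rw [hz]
    linarith
  · have e : -(η * f0) - -(((-τ : ℝ) : ℂ) * √3 * Complex.I) * b₀ =
        -(η * (f0 + Complex.I * ((√3 * γ * t : ℝ) : ℂ))) := by
      push_cast
      linear_combination (Complex.I * √3) * hηt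
    rw [e, norm_neg, norm_mul]
    have := mul_le_mul_of_nonneg_left d0 (norm_nonneg η)
    linarith
  · have e : η * f1 - b₀ = η * (f1 - ((τ * γ * t : ℝ) : ℂ)) := by
      push_cast
      linear_combination τ * hηt + b₀ * hτ2
    rw [e, norm_mul]
    have := mul_le_mul_of_nonneg_left d1 (norm_nonneg η)
    linarith

/-- For `ω ≠ 1` the eigenfunction has slope of exact order `L - L₀` at the end points. -/
lemma exists_nearData_simple (hk : 0 < k) (hl : 0 < l) (hω : omega k l ≠ 1) {β : ℂ}
    (hβ : β ≠ 0) {K : ℝ} (hK : 0 < K) :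
    ∃ A K' δ, 0 < A ∧ 0 < K' ∧ 0 < δ ∧ ∀ L, |L - critLength k l| ≤ δ → ∀ μ : ℝ,
      (fund 0 (Complex.I * μ) L).re = 0 → |μ - lamC k l| ≤ K * (L - critLength k l) ^ 2 →
      fund 2 (Complex.I * μ) L ≠ 1 ∧ ∃ a b, IsEigenData L (Complex.I * μ) a b ∧
        NearData (K' * |L - critLength k l|) (zC k l) 0 β (Complex.I * μ) a b ∧
        A * |L - critLength k l| ≤ ‖a‖ ∧ ‖a‖ ≤ 4 * A * |L - critLength k l| := by
  obtain ⟨B, hB, hexp⟩ := exists_crit_expansion hk hl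
  have hL₀ := critLength_pos hk l
  have hW := scale_pos hk hl
  have hω1 := norm_omega hk l
  generalize omega k l = ω at hω hω1 hexp
  obtain ⟨W, hWdef⟩ : ∃ W, W = scale k l := ⟨_, rfl⟩
  obtain ⟨c, hcdef⟩ : ∃ c, c = cosPar k l := ⟨_, rfl⟩
  rw [← hWdef, ← hcdef] at hexp
  rw [← hWdef] at hW
  -- the factor `η` is chosen so that the curvature `η (1 - g''(L))` tends to `β`
  have hω0 : 1 - ω ≠ 0 := sub_ne_zero.2 hω.symm
  have hω0' := norm_pos_iff.2 hω0
  obtain ⟨η, hη⟩ : ∃ η : ℂ, η = β / (1 - ω) := ⟨_, rfl⟩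
  have hη0 : η ≠ 0 := by rw [hη]; exact div_ne_zero hβ hω0
  have hηa := norm_pos_iff.2 hη0
  have hηβ : η * (1 - ω) = β := by rw [hη]; field_simp
  obtain ⟨N, hN⟩ : ∃ N, N = B * (1 + K) ^ 2 + (W / √3 + W * |c|) * K := ⟨_, rfl⟩
  have hN0 : 0 < N := by rw [hN]; positivity
  refine ⟨‖η‖ / 2, K + ‖η‖ * (2 + N),
    min (min 1 (critLength k l / 2)) (min (1 / K) (min (1 / (2 * N)) (‖1 - ω‖ / (2 * N)))),
    by positivity, by positivity, by positivity, fun L hL μ hF hμ => ?_⟩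
  obtain ⟨t, ht⟩ : ∃ t, L - critLength k l = t := ⟨_, rfl⟩
  obtain ⟨m, hm⟩ : ∃ m, μ - lamC k l = m := ⟨_, rfl⟩
  have hz := norm_I_mul_sub_zC k l μ
  rw [ht] at hL hμ ⊢
  rw [hm] at hμ hz
  have ht1 : |t| ≤ 1 := hL.trans ((min_le_left _ _).trans (min_le_left _ _))
  have ht2 : |t| ≤ critLength k l / 2 := hL.trans ((min_le_left _ _).trans (min_le_right _ _))
  have hL' := hL.trans (min_le_right _ _)
  have ht3 : |t| * K ≤ 1 := (le_div_iff₀ (by positivity)).1 (hL'.trans (min_le_left _ _))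
  have hL'' := hL'.trans (min_le_right _ _)
  have ht4 : |t| * (2 * N) ≤ 1 := (le_div_iff₀ (by positivity)).1 (hL''.trans (min_le_left _ _))
  have ht5 : |t| * (2 * N) ≤ ‖1 - ω‖ :=
    (le_div_iff₀ (by positivity)).1 (hL''.trans (min_le_right _ _))
  have hta := abs_nonneg t
  have htt' : |t| ^ 2 ≤ |t| := by
    have := mul_le_mul_of_nonneg_left ht1 hta
    linarith
  rw [← sq_abs t] at hμ
  have hmt : |m| ≤ K * |t| := hμ.trans (by gcongr)
  obtain ⟨-, e1, e2⟩ := hexp L μ t m ht hm ht2 (hmt.trans (by linarith))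
  have hS : B * (|t| + |m|) ^ 2 ≤ B * (1 + K) ^ 2 * |t| ^ 2 := by
    rw [mul_assoc, ← mul_pow]
    gcongr
    linarith
  have hL0 : 0 ≤ L := by linarith [(abs_le.1 ht2).1]
  have hdata := fun η h => isEigenData_simple hL0 hF (η := η) h
  generalize fund 1 (Complex.I * (μ : ℂ)) L = f1 at e1 hdata
  generalize fund 2 (Complex.I * (μ : ℂ)) L = f2 at e2 hdata ⊢
  have d1 : ‖f1 - ω * t‖ ≤ N * |t| ^ 2 := by
    have e : f1 - ω * t = (f1 - ω * ((t - W * c * m : ℝ) : ℂ)) -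
        ω * ((W * c * m : ℝ) : ℂ) := by
      push_cast
      ring
    have h1 : ‖ω * ((W * c * m : ℝ) : ℂ)‖ ≤ W * |c| * (K * |t| ^ 2) := by
      rw [norm_mul, hω1, one_mul, Complex.norm_real, Real.norm_eq_abs, abs_mul, abs_mul,
        abs_of_pos hW]
      gcongr
    have h2 : 0 ≤ W / √3 * K * |t| ^ 2 := by positivity
    rw [e, hN]
    refine (norm_sub_le _ _).trans ?_
    linarith
  have d2 : ‖f2 - ω‖ ≤ N * |t| := by
    have e : f2 - ω = (f2 - ω * (1 + Complex.I * ((W / √3 * m : ℝ) : ℂ))) +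
        ω * (Complex.I * ((W / √3 * m : ℝ) : ℂ)) := by
      ring
    have h1 : ‖ω * (Complex.I * ((W / √3 * m : ℝ) : ℂ))‖ ≤ W / √3 * (K * |t|) := by
      rw [norm_mul, norm_mul, Complex.norm_I, hω1, one_mul, one_mul, Complex.norm_real,
        Real.norm_eq_abs, abs_mul, abs_of_pos (by positivity : 0 < W / √3)]
      gcongr
    have h2 : 0 ≤ W * |c| * K * |t| := by positivity
    have h3 : B * (1 + K) ^ 2 * |t| ^ 2 ≤ B * (1 + K) ^ 2 * |t| := by gcongr
    rw [e, hN]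
    refine (norm_add_le _ _).trans ?_
    linarith
  have hf2 : 1 - f2 ≠ 0 := by
    intro h
    rw [← sub_eq_zero.1 h] at d2
    linarith
  have hlead : ‖ω * (t : ℂ)‖ = |t| := by
    rw [norm_mul, hω1, one_mul, Complex.norm_real, Real.norm_eq_abs]
  have hNt : N * |t| ^ 2 ≤ |t| / 2 := by
    have := mul_le_mul_of_nonneg_right ht4 hta
    linarith
  have hlow := norm_le_norm_add_norm_sub (f1) (ω * (t : ℂ))
  have hup := norm_le_norm_add_norm_sub' (f1) (ω * (t : ℂ))
  rw [hlead] at hlow hup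
  have hlo : |t| / 2 ≤ ‖f1‖ := by linarith
  have hhi : ‖f1‖ ≤ 2 * |t| := by linarith
  have hg1 : 0 ≤ ‖η‖ * |t| := by positivity
  have hg2 : 0 ≤ ‖η‖ * N * |t| := by positivity
  have hg3 : 0 ≤ K * |t| := by positivity
  have hhi' := mul_le_mul_of_nonneg_left hhi (norm_nonneg η)
  have hlo' := mul_le_mul_of_nonneg_left hlo (norm_nonneg η)
  refine ⟨fun h => hf2 (by rw [h, sub_self]), _, _, hdata η (mul_ne_zero hη0 hf2),
    ⟨?_, ?_, ?_⟩, ?_, ?_⟩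
  · rw [hz]
    linarith
  · rw [sub_zero, norm_mul]
    linarith
  · have e : η * (1 - f2) - β = -(η * (f2 - ω)) := by
      linear_combination hηβ
    rw [e, norm_neg, norm_mul]
    have := mul_le_mul_of_nonneg_left d2 (norm_nonneg η)
    linarith
  · rw [norm_mul]
    linarith
  · rw [norm_mul]
    linarith

end

section
variable {k l : ℕ}

/-! ### Eigenvalues and eigenfunctions near the critical eigenvalue -/

lemma isEigenvalue_near_iff {L : ℝ} (hL : 0 < L) {z : ℂ} {r : ℝ} :
    IsEigenvalue L z ∧ ‖z - Complex.I * lamC k l‖ < r ↔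
      ∃ μ : ℝ, z = Complex.I * μ ∧ (fund 0 (Complex.I * μ) L).re = 0 ∧ |μ - lamC k l| < r := by
  constructor
  · rintro ⟨h, hz⟩
    obtain ⟨μ, rfl⟩ := h.exists_eq hL
    refine ⟨μ, rfl, (isEigenvalue_iff_re hL μ).1 h, ?_⟩
    rwa [← norm_I_mul_sub_zC]
  · rintro ⟨μ, rfl, h, hz⟩
    refine ⟨(isEigenvalue_iff_re hL μ).2 h, ?_⟩
    rwa [← norm_I_mul_sub_zC] at hz

lemma isElliptic_of_abs_sub_lt {μ : ℝ} (h : |μ - lamC k l| < 2 * √3 / 9 - |lamC k l|) :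
    IsElliptic μ := by
  have := abs_sub_abs_le_abs_sub μ (lamC k l)
  unfold IsElliptic
  linarith

/-- The Type 1 eigenfunction has vanishing slope at the left end point. -/
lemma exists_typeOne_eq_sol (hk : 0 < k) (hl : 0 < l) :
    ∃ β : ℂ, β ≠ 0 ∧ ∀ x, 0 ≤ x → typeOne k l x = sol 0 β (zC k l) 0 x := by
  obtain ⟨β, hβ⟩ : ∃ β : ℂ, ∀ x, 0 ≤ x → typeOne k l x = sol 0 β (zC k l) 0 x := by
    refine ⟨triCurv k l (((amp k l / √(q k l) : ℝ) : ℂ) * -l)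
      (((amp k l / √(q k l) : ℝ) : ℂ) * -k) (((amp k l / √(q k l) : ℝ) : ℂ) * (k + l)),
      fun x hx => ?_⟩
    rw [typeOne_eq_tri hk, tri_eq_sol hk l (by ring) hx, ← zC]
    congr 1
    simp only [triSlope, rate]
    push_cast
    ring
  refine ⟨β, ?_, hβ⟩
  rintro rfl
  obtain ⟨x, hx, hne⟩ := (isNormalizedEigenfunction_typeOne hk hl).ne_zero
  exact hne (by rw [hβ x hx.1]; simp [sol])

/-- For `k ≢ l` mod `3` the critical eigenvalue persists as a single eigenvalue. -/
theorem exists_simple (hk : 0 < k) (hl : 0 < l) (hkl : ¬ k ≡ l [MOD 3]) :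
    ∃ δ r c C₀, 0 < δ ∧ 0 < r ∧ 0 < c ∧ 0 < C₀ ∧ ∀ C, C₀ ≤ C → ∀ L,
      |L - critLength k l| ≤ δ → ∃ μ : ℝ,
        {z : ℂ | IsEigenvalue L z ∧ ‖z - Complex.I * lamC k l‖ < r} = {Complex.I * μ} ∧
        IsElliptic μ ∧ |μ - lamC k l| ≤ C * (L - critLength k l) ^ 2 ∧
        ∀ E : ℝ → ℂ, IsNormalizedEigenfunction L (Complex.I * μ) E →
          (∃ w : ℂ, ‖w‖ = 1 ∧
            ∀ x ∈ Icc 0 L, ‖E x - w * typeOne k l x‖ ≤ C * |L - critLength k l|) ∧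
          c * |L - critLength k l| ≤ ‖derivWithin E (Icc 0 L) 0‖ ∧
          ‖derivWithin E (Icc 0 L) 0‖ ≤ C * |L - critLength k l| ∧
          c * |L - critLength k l| ≤ ‖derivWithin E (Icc 0 L) L‖ ∧
          ‖derivWithin E (Icc 0 L) L‖ ≤ C * |L - critLength k l| := by
  have hL₀ := critLength_pos hk l
  have him := omega_im_ne_zero hk hkl
  have hω : omega k l ≠ 1 := by
    intro h
    rw [h] at him
    simp at him
  obtain ⟨β, hβ, hsol⟩ := exists_typeOne_eq_sol hk hl
  have hP : ∫ x in (0 : ℝ)..critLength k l, ‖sol 0 β (zC k l) 0 x‖ ^ 2 = 1 := by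
    rw [← (isNormalizedEigenfunction_typeOne hk hl).norm_eq]
    refine intervalIntegral.integral_congr fun x hx => ?_
    rw [uIcc_of_le hL₀.le] at hx
    simp only [hsol x hx.1]
  obtain ⟨K, r₀, hK, hr₀, -, hzero⟩ := exists_zeros_simple hk hl him
  obtain ⟨A, K', δ₁, hA, hK', hδ₁, hnear⟩ := exists_nearData_simple hk hl hω hβ hK
  obtain ⟨δ₂, hδ₂, huniq⟩ := exists_unique_near hL₀ hP hK'
  obtain ⟨C₁, δ₃, hC₁, hδ₃, hclose⟩ := exists_close_of_near hL₀ hP hK'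
  have hell : 0 < 2 * √3 / 9 - |lamC k l| := sub_pos.2 (isElliptic_lamC hk hl)
  obtain ⟨r, hr⟩ : ∃ r, r = min r₀ (2 * √3 / 9 - |lamC k l|) := ⟨_, rfl⟩
  have hr0 : 0 < r := by rw [hr]; positivity
  obtain ⟨δ₄, hδ₄, hz⟩ := hzero r hr0 (hr ▸ min_le_left _ _)
  refine ⟨min (min δ₁ δ₂) (min (min δ₃ δ₄) (critLength k l / 2)), r, A / 2,
    max K (max C₁ (8 * A)), by positivity, hr0, by positivity, by positivity,
    fun C hC L hL => ?_⟩
  have hd₁ : |L - critLength k l| ≤ δ₁ := hL.trans ((min_le_left _ _).trans (min_le_left _ _))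
  have hd₂ : |L - critLength k l| ≤ δ₂ := hL.trans ((min_le_left _ _).trans (min_le_right _ _))
  have hL' := hL.trans (min_le_right _ _)
  have hd₃ : |L - critLength k l| ≤ δ₃ := hL'.trans ((min_le_left _ _).trans (min_le_left _ _))
  have hd₄ : |L - critLength k l| ≤ δ₄ := hL'.trans ((min_le_left _ _).trans (min_le_right _ _))
  have hL0 : 0 < L := by linarith [(abs_le.1 (hL'.trans (min_le_right _ _))).1]
  have hCK : K ≤ C := (le_max_left _ _).trans hC
  have hCC : C₁ ≤ C := (le_max_left _ _).trans ((le_max_right _ _).trans hC)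
  have hCA : 8 * A ≤ C := (le_max_right _ _).trans ((le_max_right _ _).trans hC)
  obtain ⟨hsq, μ, hμr, hF⟩ := hz L hd₄
  have hμ := hsq μ hμr hF
  obtain ⟨hf2, a, b, hdat, hnd, hlo, hhi⟩ := hnear L hd₁ μ hF hμ
  refine ⟨μ, ?_, isElliptic_of_abs_sub_lt (hμr.trans_le (hr ▸ min_le_right _ _)),
    hμ.trans (by gcongr), fun E hE => ?_⟩
  · ext z
    rw [mem_ofPred_eq, isEigenvalue_near_iff hL0, mem_singleton_iff]
    constructor
    · rintro ⟨μ', rfl, hF', hμr'⟩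
      obtain ⟨-, a', b', hdat', hnd', -⟩ := hnear L hd₁ μ' hF' (hsq μ' hμr' hF')
      rw [huniq L hd₂ μ' μ a' b' a b hnd' hnd hdat' hdat]
    · rintro rfl
      exact ⟨μ, rfl, hF, hμr⟩
  · obtain ⟨κ, w, hw, hκ1, hκ2, hsup, h0, h1, -⟩ :=
      hclose L hd₃ _ a b hnd hdat (Or.inr hf2) E hE
    have hup : ‖κ * a‖ ≤ C * |L - critLength k l| := by
      rw [norm_mul]
      calc ‖κ‖ * ‖a‖ ≤ 2 * (4 * A * |L - critLength k l|) := by gcongr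
        _ = 8 * A * |L - critLength k l| := by ring
        _ ≤ _ := by gcongr
    have hlow : A / 2 * |L - critLength k l| ≤ ‖κ * a‖ := by
      rw [norm_mul]
      calc A / 2 * |L - critLength k l| = 1 / 2 * (A * |L - critLength k l|) := by ring
        _ ≤ _ := by gcongr
    rw [h0, h1]
    refine ⟨⟨w, hw, fun x hx => ?_⟩, hlow, hup, hlow, hup⟩
    rw [hsol x hx.1]
    exact (hsup x hx).trans (by gcongr)

/-- On each branch there is exactly one eigenvalue near the critical one, and its eigenfunctions
are close to the limiting profile. -/
lemma exists_branch (hk : 0 < k) (hl : 0 < l) (hω : omega k l = 1) {τ : ℝ} (hτ : τ ^ 2 = 1)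
    {K : ℝ} (hK : 0 < K) :
    ∃ δ c₀ C₀, 0 < δ ∧ 0 < c₀ ∧ 0 < C₀ ∧ ∀ c, c ≤ c₀ → ∀ C, C₀ ≤ C → ∀ L,
      |L - critLength k l| ≤ δ → L ≠ critLength k l → ∃ μ : ℝ,
        (fund 0 (Complex.I * μ) L).re = 0 ∧
        |μ - lamC k l - branchSlope k l τ * (L - critLength k l)| ≤
          C₀ * (L - critLength k l) ^ 2 ∧
        (∀ μ' : ℝ, (fund 0 (Complex.I * μ') L).re = 0 →
          |μ' - lamC k l - branchSlope k l τ * (L - critLength k l)| ≤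
            K * (L - critLength k l) ^ 2 → μ' = μ) ∧
        ∀ E : ℝ → ℂ, IsNormalizedEigenfunction L (Complex.I * μ) E →
          (∃ w : ℂ, ‖w‖ = 1 ∧
            (∀ x ∈ Icc 0 L, ‖E x - w * profile k l (-τ) x‖ ≤ C * |L - critLength k l|) ∧
            ‖derivWithin E (Icc 0 L) 0 - w * boundarySlope k l (-τ)‖ ≤
              C * |L - critLength k l| ∧
            ‖derivWithin E (Icc 0 L) L - w * boundarySlope k l (-τ)‖ ≤
              C * |L - critLength k l|) ∧
          c ≤ ‖derivWithin E (Icc 0 L) 0‖ ∧ ‖derivWithin E (Icc 0 L) 0‖ ≤ C ∧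
          c ≤ ‖derivWithin E (Icc 0 L) L‖ ∧ ‖derivWithin E (Icc 0 L) L‖ ≤ C := by
  have hL₀ := critLength_pos hk l
  have hτs : (-τ) ^ 2 = 1 := by rw [neg_sq, hτ]
  have ha₀ := norm_pos_iff.2 (boundarySlope_ne_zero hk hl hτs)
  have hP : ∫ x in (0 : ℝ)..critLength k l, ‖sol (boundarySlope k l (-τ)) (boundaryCurv k l (-τ))
      (zC k l) 0 x‖ ^ 2 = 1 := by
    rw [← integral_profile_sq hk hl hτs]
    refine intervalIntegral.integral_congr fun x hx => ?_
    rw [uIcc_of_le hL₀.le] at hx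
    simp only [profile_eq_sol hk hl hτs hx.1]
  obtain ⟨K₁, δ₀, hK₁, hδ₀, hzero⟩ := exists_zero_branch hk hl hω hτ
  obtain ⟨K', δ₁, hK', hδ₁, hnear⟩ :=
    exists_nearData_double hk hl hω hτ (lt_max_of_lt_left hK : 0 < max K K₁)
  obtain ⟨δ₂, hδ₂, huniq⟩ := exists_unique_near hL₀ hP hK'
  obtain ⟨C₁, δ₃, hC₁, hδ₃, hclose⟩ := exists_close_of_near hL₀ hP hK'
  refine ⟨min (min δ₀ δ₁) (min (min δ₂ δ₃) (‖boundarySlope k l (-τ)‖ / (2 * C₁))),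
    ‖boundarySlope k l (-τ)‖ / 2, max K₁ (max C₁ (2 * ‖boundarySlope k l (-τ)‖)),
    by positivity, by positivity, by positivity, fun c hc C hC L hL hne => ?_⟩
  have hd₀ : |L - critLength k l| ≤ δ₀ := hL.trans ((min_le_left _ _).trans (min_le_left _ _))
  have hd₁ : |L - critLength k l| ≤ δ₁ := hL.trans ((min_le_left _ _).trans (min_le_right _ _))
  have hL' := hL.trans (min_le_right _ _)
  have hd₂ : |L - critLength k l| ≤ δ₂ := hL'.trans ((min_le_left _ _).trans (min_le_left _ _))
  have hd₃ : |L - critLength k l| ≤ δ₃ := hL'.trans ((min_le_left _ _).trans (min_le_right _ _))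
  have hd₄ := (le_div_iff₀ (by positivity)).1 (hL'.trans (min_le_right _ _))
  have hCC : C₁ ≤ C := (le_max_left _ _).trans ((le_max_right _ _).trans hC)
  have hCA : 2 * ‖boundarySlope k l (-τ)‖ ≤ C :=
    (le_max_right _ _).trans ((le_max_right _ _).trans hC)
  obtain ⟨μ, hF, hμ⟩ := hzero L hd₀
  obtain ⟨hf1, a, b, hdat, hnd⟩ :=
    hnear L hd₁ hne μ hF (hμ.trans (by gcongr; exact le_max_right _ _))
  refine ⟨μ, hF, hμ.trans (by gcongr; exact le_max_left _ _), fun μ' hF' hμ' => ?_,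
    fun E hE => ?_⟩
  · obtain ⟨-, a', b', hdat', hnd'⟩ :=
      hnear L hd₁ hne μ' hF' (hμ'.trans (by gcongr; exact le_max_left _ _))
    exact huniq L hd₂ μ' μ a' b' a b hnd' hnd hdat' hdat
  · obtain ⟨κ, w, hw, -, -, hsup, h0, h1, hslope⟩ :=
      hclose L hd₃ _ a b hnd hdat (Or.inl hf1) E hE
    have hn : ‖w * boundarySlope k l (-τ)‖ = ‖boundarySlope k l (-τ)‖ := by
      rw [norm_mul, hw, one_mul]
    have hup := norm_le_norm_add_norm_sub' (κ * a) (w * boundarySlope k l (-τ))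
    have hlow := norm_le_norm_add_norm_sub (κ * a) (w * boundarySlope k l (-τ))
    rw [hn] at hup hlow
    have hs : ‖κ * a - w * boundarySlope k l (-τ)‖ ≤ C * |L - critLength k l| :=
      hslope.trans (by gcongr)
    have hup' : ‖κ * a‖ ≤ C := by linarith
    have hlow' : c ≤ ‖κ * a‖ := by linarith
    rw [h0, h1]
    refine ⟨⟨w, hw, fun x hx => ?_, hs, hs⟩, hlow', hup', hlow', hup'⟩
    rw [profile_eq_sol hk hl hτs hx.1]
    exact (hsup x hx).trans (by gcongr)

/-- The expansions of the two branches, ordered by the size of the eigenvalue. -/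
lemma branchSlope_mul (hk : 0 < k) (l : ℕ) (σ : ℝ) (t : ℝ) :
    branchSlope k l (σ * Real.sign t) * t =
      -(((k - l) * (k + 2 * l) * (2 * k + l)) / (2 * Real.pi * q k l ^ 2) * t) +
        σ * (|t| / (Real.pi * √(q k l))) := by
  have hq := q_pos hk l
  have hs := Real.sqrt_pos.2 hq
  have hss : √(q k l) ^ 2 = q k l := Real.sq_sqrt hq.le
  have hpi := Real.pi_pos
  have h1 : Real.sign t * t = |t| := by
    rcases lt_trichotomy t 0 with h | h | h
    · rw [Real.sign_of_neg h, abs_of_neg h, neg_one_mul]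
    · rw [h, mul_zero, abs_zero]
    · rw [Real.sign_of_pos h, abs_of_pos h, one_mul]
  have h2 : cosPar k l / (Real.pi * √(q k l)) =
      ((k - l) * (k + 2 * l) * (2 * k + l)) / (2 * Real.pi * q k l ^ 2) := by
    rw [cosPar, div_div]
    congr 1
    linear_combination (2 * q k l * Real.pi) * hss
  rw [← h2, ← h1, branchSlope]
  ring

lemma abs_branchSlope_le (hk : 0 < k) (hl : 0 < l) {τ : ℝ} (hτ : τ ^ 2 = 1) :
    |branchSlope k l τ| ≤ 2 / (Real.pi * √(q k l)) := by
  have hτ1 : |τ| = 1 := by rwa [← sq_eq_sq₀ (abs_nonneg _) zero_le_one, sq_abs, one_pow]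
  have hc : |cosPar k l| < 1 := (sq_lt_one_iff_abs_lt_one _).1 (cosPar_sq_lt_one hk hl)
  have hpos : 0 ≤ Real.pi * √(q k l) := by positivity
  rw [branchSlope, abs_div, abs_of_nonneg hpos]
  gcongr
  linarith [abs_sub τ (cosPar k l)]

/-- For `k ≡ l` mod `3` the double critical eigenvalue splits: the eigenvalue `λ^σ` lies on the
branch `τ = σ sgn (L - L₀)`. -/
theorem exists_splitting (hk : 0 < k) (hl : 0 < l) (hω : omega k l = 1) :
    ∃ δ r c C₀, 0 < δ ∧ 0 < r ∧ 0 < c ∧ 0 < C₀ ∧ ∀ C, C₀ ≤ C → ∀ L,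
      |L - critLength k l| ≤ δ → L ≠ critLength k l →
      ∃ lam : ℝ → ℝ, lam (-1) < lam 1 ∧
        {z : ℂ | IsEigenvalue L z ∧ ‖z - Complex.I * lamC k l‖ < r} =
          {Complex.I * lam (-1), Complex.I * lam 1} ∧
        ∀ σ ∈ ({-1, 1} : Set ℝ),
          IsElliptic (lam σ) ∧
          |lam σ - (lamC k l
            - ((k - l) * (k + 2 * l) * (2 * k + l)) / (2 * Real.pi * q k l ^ 2)
              * (L - critLength k l)
            + σ * (|L - critLength k l| / (Real.pi * √(q k l))))| ≤
              C * (L - critLength k l) ^ 2 ∧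
          ∀ E : ℝ → ℂ, IsNormalizedEigenfunction L (Complex.I * lam σ) E →
            (∃ w : ℂ, ‖w‖ = 1 ∧
              (∀ x ∈ Icc 0 L,
                ‖E x - w * profile k l (-(σ * Real.sign (L - critLength k l))) x‖
                  ≤ C * |L - critLength k l|) ∧
              ‖derivWithin E (Icc 0 L) 0
                - w * boundarySlope k l (-(σ * Real.sign (L - critLength k l)))‖
                  ≤ C * |L - critLength k l| ∧
              ‖derivWithin E (Icc 0 L) L
                - w * boundarySlope k l (-(σ * Real.sign (L - critLength k l)))‖
                  ≤ C * |L - critLength k l|) ∧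
            c ≤ ‖derivWithin E (Icc 0 L) 0‖ ∧ ‖derivWithin E (Icc 0 L) 0‖ ≤ C ∧
            c ≤ ‖derivWithin E (Icc 0 L) L‖ ∧ ‖derivWithin E (Icc 0 L) L‖ ≤ C := by
  have hL₀ := critLength_pos hk l
  have hs := Real.sqrt_pos.2 (q_pos hk l)
  obtain ⟨K, r₁, δ₀, hK, hr₁, hδ₀, hzeros⟩ := exists_zeros_on_branch hk hl hω
  obtain ⟨δ₁, c₁, C₁, hδ₁, hc₁, hC₁, h1⟩ := exists_branch hk hl hω (τ := 1) (by norm_num) hK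
  obtain ⟨δ₂, c₂, C₂, hδ₂, hc₂, hC₂, h2⟩ := exists_branch hk hl hω (τ := -1) (by norm_num) hK
  obtain ⟨P, hP⟩ : ∃ P, P = 1 / (Real.pi * √(q k l)) := ⟨_, rfl⟩
  have hP0 : 0 < P := by
    have := Real.pi_pos
    rw [hP]
    positivity
  obtain ⟨C₀, hC₀⟩ : ∃ C₀, C₀ = max C₁ C₂ := ⟨_, rfl⟩
  have hC₀0 : 0 < C₀ := by rw [hC₀]; positivity
  have hell : 0 < 2 * √3 / 9 - |lamC k l| := sub_pos.2 (isElliptic_lamC hk hl)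
  obtain ⟨r, hr⟩ : ∃ r, r = min r₁ (2 * √3 / 9 - |lamC k l|) := ⟨_, rfl⟩
  have hr0 : 0 < r := by rw [hr]; positivity
  refine ⟨min (min δ₀ (critLength k l / 2)) (min (min δ₁ δ₂)
      (min (P / (2 * C₀)) (min 1 (r / (2 * (2 * P + C₀)))))),
    r, min c₁ c₂, C₀, by positivity, hr0, by positivity, hC₀0, fun C hC L hL hne => ?_⟩
  have hd₀ : |L - critLength k l| ≤ δ₀ := hL.trans ((min_le_left _ _).trans (min_le_left _ _))
  have hL0 : 0 < L := by
    linarith [(abs_le.1 (hL.trans ((min_le_left _ _).trans (min_le_right _ _)))).1]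
  have hL' := hL.trans (min_le_right _ _)
  have hd₁ : |L - critLength k l| ≤ δ₁ := hL'.trans ((min_le_left _ _).trans (min_le_left _ _))
  have hd₂ : |L - critLength k l| ≤ δ₂ := hL'.trans ((min_le_left _ _).trans (min_le_right _ _))
  have hL'' := hL'.trans (min_le_right _ _)
  have hd₃ := (le_div_iff₀ (by positivity)).1 (hL''.trans (min_le_left _ _))
  have hd₄ := hL''.trans ((min_le_right _ _).trans (min_le_left _ _))
  have hd₅ := (le_div_iff₀ (by positivity)).1
    (hL''.trans ((min_le_right _ _).trans (min_le_right _ _)))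
  have hbr : ∀ τ : ℝ, τ ^ 2 = 1 → ∃ μ : ℝ,
      (fund 0 (Complex.I * μ) L).re = 0 ∧
      |μ - lamC k l - branchSlope k l τ * (L - critLength k l)| ≤
        C₀ * (L - critLength k l) ^ 2 ∧
      (∀ μ' : ℝ, (fund 0 (Complex.I * μ') L).re = 0 →
        |μ' - lamC k l - branchSlope k l τ * (L - critLength k l)| ≤
          K * (L - critLength k l) ^ 2 → μ' = μ) ∧
      ∀ E : ℝ → ℂ, IsNormalizedEigenfunction L (Complex.I * μ) E →
        (∃ w : ℂ, ‖w‖ = 1 ∧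
          (∀ x ∈ Icc 0 L, ‖E x - w * profile k l (-τ) x‖ ≤ C * |L - critLength k l|) ∧
          ‖derivWithin E (Icc 0 L) 0 - w * boundarySlope k l (-τ)‖ ≤
            C * |L - critLength k l| ∧
          ‖derivWithin E (Icc 0 L) L - w * boundarySlope k l (-τ)‖ ≤
            C * |L - critLength k l|) ∧
        min c₁ c₂ ≤ ‖derivWithin E (Icc 0 L) 0‖ ∧ ‖derivWithin E (Icc 0 L) 0‖ ≤ C ∧
        min c₁ c₂ ≤ ‖derivWithin E (Icc 0 L) L‖ ∧ ‖derivWithin E (Icc 0 L) L‖ ≤ C := by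
    intro τ hτ
    rcases sq_eq_one_iff.1 hτ with rfl | rfl
    · obtain ⟨μ, hF, hμ, hu, hE⟩ := h1 (min c₁ c₂) (min_le_left _ _) C
        ((le_max_left _ _).trans (hC₀ ▸ hC)) L hd₁ hne
      exact ⟨μ, hF, hμ.trans (by gcongr; exact hC₀ ▸ le_max_left _ _), hu, hE⟩
    · obtain ⟨μ, hF, hμ, hu, hE⟩ := h2 (min c₁ c₂) (min_le_right _ _) C
        ((le_max_right _ _).trans (hC₀ ▸ hC)) L hd₂ hne
      exact ⟨μ, hF, hμ.trans (by gcongr; exact hC₀ ▸ le_max_right _ _), hu, hE⟩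
  choose! f hf using hbr
  have ht0 : L - critLength k l ≠ 0 := sub_ne_zero.2 hne
  have hsg : Real.sign (L - critLength k l) ^ 2 = 1 := by
    rcases Real.sign_apply_eq_of_ne_zero _ ht0 with h | h <;> rw [h] <;> norm_num
  have hslope := branchSlope_mul hk l (t := L - critLength k l)
  have hzL := hzeros L hd₀
  have hta := abs_pos.2 ht0
  have hab := fun τ (hτ : τ ^ 2 = 1) => abs_branchSlope_le hk hl hτ
  generalize L - critLength k l = t at *
  have hσ : ∀ σ : ℝ, σ ^ 2 = 1 → (σ * Real.sign t) ^ 2 = 1 := fun σ h => by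
    rw [mul_pow, h, hsg, one_mul]
  have hbound : ∀ τ : ℝ, τ ^ 2 = 1 → |f τ - lamC k l| < r := by
    intro τ hτ
    have h3 := (hf τ hτ).2.1
    have h4 : |branchSlope k l τ| * |t| ≤ 2 * P * |t| := by
      refine mul_le_mul_of_nonneg_right ((hab τ hτ).trans (le_of_eq ?_)) hta.le
      rw [hP]
      ring
    have h5 := abs_add_le (branchSlope k l τ * t) (f τ - lamC k l - branchSlope k l τ * t)
    rw [add_sub_cancel, abs_mul] at h5
    have h6 : C₀ * t ^ 2 ≤ C₀ * |t| := by
      rw [← sq_abs]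
      gcongr
      have := mul_le_mul_of_nonneg_left hd₄ hta.le
      linarith
    have h7 : (2 * P + C₀) * |t| < |t| * (2 * (2 * P + C₀)) := by
      have : 0 < (2 * P + C₀) * |t| := by positivity
      linarith
    linarith
  have hlt : f (-1 * Real.sign t) < f (1 * Real.sign t) := by
    have a1 := (abs_le.1 (hf _ (hσ (-1) (by norm_num))).2.1).2
    have a2 := (abs_le.1 (hf _ (hσ 1 (by norm_num))).2.1).1
    rw [hslope] at a1 a2
    have a3 : |t| / (Real.pi * √(q k l)) = P * |t| := by rw [hP]; ring
    rw [a3] at a1 a2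
    have a4 : 2 * (C₀ * t ^ 2) ≤ P * |t| := by
      rw [← sq_abs]
      have := mul_le_mul_of_nonneg_right hd₃ hta.le
      linarith
    have a5 := mul_pos hP0 hta
    linarith
  refine ⟨fun σ => f (σ * Real.sign t), hlt, ?_, fun σ hσ' => ?_⟩
  · ext z
    rw [mem_ofPred_eq, isEigenvalue_near_iff hL0, mem_insert_iff, mem_singleton_iff]
    constructor
    · rintro ⟨μ, rfl, hF, hμ⟩
      obtain ⟨τ, hτ, hμτ⟩ := hzL μ (hμ.trans_le (hr ▸ min_le_left _ _)) hF
      rw [(hf τ hτ).2.2.1 μ hF hμτ]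
      have e : τ = τ * Real.sign t * Real.sign t := by
        rw [mul_assoc, ← pow_two, hsg, mul_one]
      rcases sq_eq_one_iff.1 (hσ τ hτ) with h | h
      · rw [h] at e
        exact Or.inr (by simp only [← e])
      · rw [h] at e
        exact Or.inl (by simp only [← e])
    · rintro (rfl | rfl)
      · exact ⟨_, rfl, (hf _ (hσ _ (by norm_num))).1, hbound _ (hσ _ (by norm_num))⟩
      · exact ⟨_, rfl, (hf _ (hσ _ (by norm_num))).1, hbound _ (hσ _ (by norm_num))⟩
  · have hσ2 : σ ^ 2 = 1 := by
      rcases hσ' with rfl | rfl <;> norm_num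
    obtain ⟨-, b1, -, b2⟩ := hf _ (hσ σ hσ2)
    refine ⟨isElliptic_of_abs_sub_lt ((hbound _ (hσ σ hσ2)).trans_le (hr ▸ min_le_right _ _)),
      ?_, b2⟩
    rw [hslope] at b1
    refine le_trans (le_of_eq ?_) (b1.trans (by gcongr))
    congr 1
    ring

end

end KdV

theorem proposition4p7 (k l : ℕ) (hk : 0 < k) (hl : 0 < l) (L₀ : ℝ)
    (hL₀ : L₀ = KdV.critLength k l) :
    ∃ δ r c C : ℝ, 0 < δ ∧ 0 < r ∧ 0 < c ∧ 0 < C ∧ δ < L₀ / 2 ∧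
      Set.Icc (L₀ - δ) (L₀ + δ) ∩ KdV.criticalLengths = {L₀} ∧
      -- every elliptic eigenvalue is close to an eigenvalue at the critical length
      (∀ L ∈ Set.Icc (L₀ - δ) (L₀ + δ), ∀ μ : ℝ, KdV.IsElliptic μ →
        KdV.IsEigenvalue L (Complex.I * μ) →
        ∃ μ₀ : ℝ, KdV.IsEigenvalue L₀ (Complex.I * μ₀) ∧ |μ - μ₀| ≤ C * |L - L₀|) ∧
      -- the case `k ≡ l` mod `3`
      (k ≡ l [MOD 3] →
        -- the critical eigenfunctions, and the limits as rotations of them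
        KdV.IsNormalizedEigenfunction L₀ (Complex.I * KdV.lamC k l) (KdV.typeOne k l) ∧
        KdV.IsNormalizedEigenfunction L₀ (Complex.I * KdV.lamC k l) (KdV.typeTwo k l) ∧
        KdV.IsNormalizedEigenfunction L₀ (Complex.I * KdV.lamC k l) (KdV.typeTwoOrth k l) ∧
        (∫ x in (0 : ℝ)..L₀,
          KdV.typeOne k l x * (starRingEnd ℂ) (KdV.typeTwoOrth k l x)) = 0 ∧
        (∀ x : ℝ, KdV.profile k l 1 x =
          -((Real.cos (3 * KdV.angle k l / 2) : ℝ) : ℂ) * KdV.typeOne k l x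
            - ((Real.sin (3 * KdV.angle k l / 2) : ℝ) : ℂ) * KdV.typeTwoOrth k l x) ∧
        (∀ x : ℝ, KdV.profile k l (-1) x =
          ((Real.sin (3 * KdV.angle k l / 2) : ℝ) : ℂ) * KdV.typeOne k l x
            - ((Real.cos (3 * KdV.angle k l / 2) : ℝ) : ℂ) * KdV.typeTwoOrth k l x) ∧
        -- splitting of the critical eigenvalue
        ∀ L ∈ Set.Icc (L₀ - δ) (L₀ + δ), L ≠ L₀ →
          ∃ lam : ℝ → ℝ, lam (-1) < lam 1 ∧
            {z : ℂ | KdV.IsEigenvalue L z ∧ ‖z - Complex.I * KdV.lamC k l‖ < r} =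
              {Complex.I * lam (-1), Complex.I * lam 1} ∧
            ∀ σ ∈ ({-1, 1} : Set ℝ),
              KdV.IsElliptic (lam σ) ∧
              |lam σ - (KdV.lamC k l
                - ((k - l) * (k + 2 * l) * (2 * k + l)) / (2 * Real.pi * KdV.q k l ^ 2) * (L - L₀)
                + σ * (|L - L₀| / (Real.pi * √(KdV.q k l))))| ≤ C * (L - L₀) ^ 2 ∧
              ∀ E : ℝ → ℂ, KdV.IsNormalizedEigenfunction L (Complex.I * lam σ) E →
                (∃ w : ℂ, ‖w‖ = 1 ∧
                  (∀ x ∈ Set.Icc 0 L,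
                    ‖E x - w * KdV.profile k l (-(σ * Real.sign (L - L₀))) x‖
                      ≤ C * |L - L₀|) ∧
                  ‖derivWithin E (Set.Icc 0 L) 0
                    - w * KdV.boundarySlope k l (-(σ * Real.sign (L - L₀)))‖ ≤ C * |L - L₀| ∧
                  ‖derivWithin E (Set.Icc 0 L) L
                    - w * KdV.boundarySlope k l (-(σ * Real.sign (L - L₀)))‖ ≤ C * |L - L₀|) ∧
                c ≤ ‖derivWithin E (Set.Icc 0 L) 0‖ ∧ ‖derivWithin E (Set.Icc 0 L) 0‖ ≤ C ∧
                c ≤ ‖derivWithin E (Set.Icc 0 L) L‖ ∧ ‖derivWithin E (Set.Icc 0 L) L‖ ≤ C) ∧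
      -- the case `k ≢ l` mod `3`
      (¬ k ≡ l [MOD 3] →
        KdV.IsNormalizedEigenfunction L₀ (Complex.I * KdV.lamC k l) (KdV.typeOne k l) ∧
        ∀ L ∈ Set.Icc (L₀ - δ) (L₀ + δ),
          ∃ μ : ℝ,
            {z : ℂ | KdV.IsEigenvalue L z ∧ ‖z - Complex.I * KdV.lamC k l‖ < r} =
              {Complex.I * μ} ∧
            KdV.IsElliptic μ ∧
            |μ - KdV.lamC k l| ≤ C * (L - L₀) ^ 2 ∧
            ∀ E : ℝ → ℂ, KdV.IsNormalizedEigenfunction L (Complex.I * μ) E →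
              (∃ w : ℂ, ‖w‖ = 1 ∧
                ∀ x ∈ Set.Icc 0 L, ‖E x - w * KdV.typeOne k l x‖ ≤ C * |L - L₀|) ∧
              c * |L - L₀| ≤ ‖derivWithin E (Set.Icc 0 L) 0‖ ∧
              ‖derivWithin E (Set.Icc 0 L) 0‖ ≤ C * |L - L₀| ∧
              c * |L - L₀| ≤ ‖derivWithin E (Set.Icc 0 L) L‖ ∧
              ‖derivWithin E (Set.Icc 0 L) L‖ ≤ C * |L - L₀|) := by
  have hpos := KdV.critLength_pos hk l
  obtain ⟨δ₁, hδ₁, hiso⟩ := KdV.exists_isolated hk hl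
  obtain ⟨δ₂, C₂, hδ₂, hC₂, hnear⟩ := KdV.exists_eigenvalue_near hpos (2 * √3 / 9)
  rw [← hL₀] at hpos hiso hnear
  have hIcc : ∀ {δ L : ℝ}, L ∈ Set.Icc (L₀ - δ) (L₀ + δ) → |L - L₀| ≤ δ := fun h =>
    abs_le.2 ⟨by linarith [h.1], by linarith [h.2]⟩
  by_cases hkl : k ≡ l [MOD 3]
  · have hω := KdV.omega_eq_one hk hkl
    obtain ⟨δ₃, r, c, C₃, hδ₃, hr, hc, hC₃, hsplit⟩ := KdV.exists_splitting hk hl hω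
    rw [← hL₀] at hsplit
    have h1 := KdV.isNormalizedEigenfunction_typeOne hk hl
    have h2 := KdV.isNormalizedEigenfunction_typeTwo hk hl hω
    have h3 := KdV.isNormalizedEigenfunction_typeTwoOrth hk hl hω
    have h4 := KdV.integral_typeOne_mul_typeTwoOrth hk hl
    rw [← hL₀] at h1 h2 h3 h4
    refine ⟨min (min δ₁ (L₀ / 4)) (min δ₂ δ₃), r, c, max C₂ C₃, by positivity, hr, hc,
      by positivity, ?_, hiso _ (by positivity) ((min_le_left _ _).trans (min_le_left _ _)),
      fun L hL μ hμ hev => ?_, fun _ => ⟨h1, h2, h3, h4, KdV.profile_one hk l,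
        KdV.profile_neg_one hk l, fun L hL hne => ?_⟩, fun h => absurd hkl h⟩
    · have := (min_le_left (min δ₁ (L₀ / 4)) (min δ₂ δ₃)).trans (min_le_right _ _)
      linarith
    · obtain ⟨μ₀, h, hle⟩ := hnear L ((hIcc hL).trans ((min_le_right _ _).trans (min_le_left _ _)))
        μ (le_of_lt hμ) hev
      exact ⟨μ₀, h, hle.trans (by gcongr; exact le_max_left _ _)⟩
    · exact hsplit _ (le_max_right _ _) L
        ((hIcc hL).trans ((min_le_right _ _).trans (min_le_right _ _))) hne
  · obtain ⟨δ₃, r, c, C₃, hδ₃, hr, hc, hC₃, hsimple⟩ := KdV.exists_simple hk hl hkl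
    have h1 := KdV.isNormalizedEigenfunction_typeOne hk hl
    rw [← hL₀] at hsimple h1
    refine ⟨min (min δ₁ (L₀ / 4)) (min δ₂ δ₃), r, c, max C₂ C₃, by positivity, hr, hc,
      by positivity, ?_, hiso _ (by positivity) ((min_le_left _ _).trans (min_le_left _ _)),
      fun L hL μ hμ hev => ?_, fun h => absurd h hkl, fun _ => ⟨h1, fun L hL => ?_⟩⟩
    · have := (min_le_left (min δ₁ (L₀ / 4)) (min δ₂ δ₃)).trans (min_le_right _ _)
      linarith
    · obtain ⟨μ₀, h, hle⟩ := hnear L ((hIcc hL).trans ((min_le_right _ _).trans (min_le_left _ _)))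
        μ (le_of_lt hμ) hev
      exact ⟨μ₀, h, hle.trans (by gcongr; exact le_max_left _ _)⟩
    · exact hsimple _ (le_max_right _ _) L
        ((hIcc hL).trans ((min_le_right _ _).trans (min_le_right _ _)))
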